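/- A constant power circuit $\mathcal P$ is a finite directed acyclic graph without multiple edges, with vertex set $V(\mathcal P)$, whose edges $e$ carry labels $\mu(e)\in\{1,-1\}$, together with a non-empty set $M$ of marked vertices and signs $\nu:M\to\{1,-1\}$. Put $\mathcal E(v)=0$ if $v$ is a leaf, and $\mathcal E(v)=2^{\sum_{e=(v\to w)}\mu(e)\mathcal E(w)}$ otherwise, and $\mathcal E(\mathcal P)=\sum_{v\in M}\nu(v)\mathcal E(v)$. The circuit is proper if $\mathcal E(v)\in\mathbb N$ for all vertices $v$ (so that $\mathcal E(\mathcal P)\in\mathbb Z$), and trivial if it has only one vertex. It is in standard form if it is trivial, or if every vertex is reachable from a marked one, there is exactly one leaf $z$, $z$ is unmarked, and an edge $v\to z$ exists only when it is the only edge leaving $v$. It is reduced if it is in standard form, distinct vertices have distinct values $\mathcal E(v)$, and there are no two edges $v\to w_1$, $v\to w_2$ with opposite labels and $\mathcal E(w_1)=\mathcal E(w_2)$ or $\mathcal E(w_1)=2\,\mathcal E(w_2)$. Two circuits are equivalent if they have the same value $\mathcal E(\mathcal P)$. Running time is the number of steps of a random access machine with integer registers and two-dimensional arrays, whose arithmetic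 instructions are adding and subtracting $1$. A circuit with vertices $0,\dots,n-1$ is given by $n$, its array of edge labels and its array of marks. **Proposition.** There is a program $\mathit{Reduce}$ which, for every proper constant power circuit $\mathcal P$, computes in time $O(|V(\mathcal P)|^3)$ a reduced proper circuit $\mathcal P'$ equivalent to $\mathcal P$ together with the list $v_1,\dots,v_k$ of all its vertices, ordered so that $\mathcal E(v_1)<\dots<\mathcal E(v_k)$, and for which the following holds. Let $\mathit{Compare}$ be the algorithm that first runs $\mathit{Reduce}$, then outputs $0$ if $\mathcal P'$ is trivial, and otherwise outputs $\nu(v_i)$ for the marked vertex $v_i$ of $\mathcal P'$ with the greatest index $i$. Then, for every proper constant power circuit $\mathcal P$, $\mathit{Compare}$ computes the sign ($-1$, $0$ or $1$) of $\mathcal E(\mathcal P)$ in time $O(|V(\mathcal P)|^3)$. Moreover, there is a program which, given two proper constant power circuits $\mathcal P_1,\mathcal P_2$, computes the sign of $\mathcal E(\mathcal P_1)-\mathcal E(\mathcal P_2)$ in time $O((|V(\mathcal P_1)|+|V(\mathcal P_2)|)^3)$. The implied constants are absolute. -/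

import Mathlib

/-! ### Constant power circuits -/

/-- A constant power circuit with vertex set `V`: a finite directed acyclic graph without multiple
edges, whose edges carry labels `1` or `-1`, together with a non-empty set of marked vertices, each
of which carries a sign `1` or `-1`. All leaves carry the constant `0`.
`lab v w` is the label of the edge from `v` to `w`, and it is `0` if there is no such edge;
`mark v` is the sign of the marked vertex `v`, and it is `0` if `v` is not marked. -/
structure PowerCircuit (V : Type) [Fintype V] where
  lab : V → V → SignType
  mark : V → SignType
  acyclic : ∀ v, ¬ Relation.TransGen (fun a b => lab a b ≠ 0) v v
  exists_marked : ∃ v, mark v ≠ 0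

namespace PowerCircuit

variable {V : Type} [Fintype V] (P : PowerCircuit V)

/-- There is an edge from `v` to `w`. -/
def Edge (v w : V) : Prop := P.lab v w ≠ 0

/-- `v` is a marked vertex. -/
def Marked (v : V) : Prop := P.mark v ≠ 0

/-- `v` is a leaf; in a constant circuit these are the zero vertices. -/
def IsZeroVertex (v : V) : Prop := ∀ w, ¬ P.Edge v w

theorem wellFounded_edge : WellFounded (fun w v => P.Edge v w) := by
  have h1 : Std.Irrefl (Relation.TransGen (fun w v => P.Edge v w)) :=
    ⟨fun v h => P.acyclic v (Relation.transGen_swap.mp h)⟩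
  have h2 : WellFounded (Relation.TransGen (fun w v => P.Edge v w)) :=
    Finite.wellFounded_of_trans_of_irrefl _
  exact h2.mono fun _ _ h => Relation.TransGen.single h

open Classical in
/-- The real number represented by a vertex: `0` at a leaf, and otherwise `2` to the power of the
sum, over all edges leaving the vertex, of the label times the value of the terminus. -/
noncomputable def value : V → ℝ :=
  P.wellFounded_edge.fix fun v ih =>
    if P.IsZeroVertex v then 0
    else (2 : ℝ) ^ (∑ w : V, if h : P.Edge v w then (P.lab v w : ℝ) * ih w h else 0)

open Classical in
/-- The defining recursion of `value`. -/
theorem value_eq (v : V) : P.value v =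
    if P.IsZeroVertex v then 0 else (2 : ℝ) ^ (∑ w : V, (P.lab v w : ℝ) * P.value w) := by
  unfold value
  rw [WellFounded.fix_eq]
  split_ifs with h
  · rfl
  · congr 1
    refine Finset.sum_congr rfl fun w _ => ?_
    split_ifs with hw
    · rfl
    · have : P.lab v w = 0 := by simpa [Edge] using hw
      simp [this]

/-- The real number represented by the circuit. -/
noncomputable def eval : ℝ := ∑ v : V, (P.mark v : ℝ) * P.value v

/-- The sign of the number represented by the circuit. -/
noncomputable def sgn : SignType := SignType.sign P.eval

/-- The circuit properly represents the integer `N`. -/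
def ProperlyRepresents (N : ℤ) : Prop := P.eval = N ∧ ∀ v, ∃ k : ℕ, P.value v = k

/-- The circuit properly represents some integer. -/
def IsProper : Prop := ∃ N : ℤ, P.ProperlyRepresents N

/-! ### Reduced circuits -/

/-- The circuit consists of a single (marked) vertex. -/
def IsTrivial : Prop := ∃ v, P.Marked v ∧ ∀ w, w = v

/-- Every vertex can be reached from a marked vertex along a directed path. -/
def IsTrimmed : Prop := ∀ v, ∃ m, P.Marked m ∧ Relation.ReflTransGen P.Edge m v

/-- The edge from `v` to `z` goes to a zero vertex and is not the only edge leaving `v`. -/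
def RedundantZeroEdge (v z : V) : Prop :=
  P.Edge v z ∧ P.IsZeroVertex z ∧ ∃ w, w ≠ z ∧ P.Edge v w

/-- The standard form. The trivial circuit is the standard form of the circuits all of whose marked
vertices are zero vertices; any other circuit in standard form is trimmed, has exactly one zero
vertex, which is unmarked, and has no redundant zero edges. -/
def IsStandard : Prop :=
  P.IsTrivial ∨
    (P.IsTrimmed ∧ (∃! z, P.IsZeroVertex z) ∧ (∀ z, P.IsZeroVertex z → ¬ P.Marked z) ∧
      ∀ v z, ¬ P.RedundantZeroEdge v z)

/-- The edges from `v` to `w₁` and `w₂` have opposite labels, and their termini have equal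
values. -/
def RedundantPair (v w₁ w₂ : V) : Prop :=
  P.Edge v w₁ ∧ P.Edge v w₂ ∧ P.lab v w₁ = -P.lab v w₂ ∧ P.value w₁ = P.value w₂

/-- The edges from `v` to `w₁` and `w₂` have opposite labels, and the value of `w₁` is twice the
value of `w₂`. -/
def SuperfluousPair (v w₁ w₂ : V) : Prop :=
  P.Edge v w₁ ∧ P.Edge v w₂ ∧ P.lab v w₁ = -P.lab v w₂ ∧ P.value w₁ = 2 * P.value w₂

/-- Reduced circuits: in standard form, distinct vertices have distinct values, and there are no
redundant and no superfluous pairs of edges. -/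
def IsReduced : Prop :=
  P.IsStandard ∧ (∀ v w, P.value v = P.value w ↔ v = w) ∧
    ∀ v w₁ w₂, ¬ P.RedundantPair v w₁ w₂ ∧ ¬ P.SuperfluousPair v w₁ w₂

end PowerCircuit

/-! ### A random access machine with step count

The registers and the cells of finitely many two-dimensional arrays hold integers. A program is a
fixed finite text. The only arithmetic is adding or subtracting `1`, so that in `t` steps no number
can exceed in absolute value the input numbers and the constants of the program by more than `t`:
the unit cost of an operation hides no arithmetic with long numbers. -/

namespace RAM

structure State where
  reg : ℕ → ℤ
  /-- `arr a i j` is the cell with indices `i`, `j` of array number `a`. -/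
  arr : ℕ → ℤ → ℤ → ℤ

/-- Comparisons of the contents of two registers. -/
inductive Test where
  | eq (x y : ℕ)
  | lt (x y : ℕ)

def Test.Holds (s : State) : Test → Prop
  | .eq x y => s.reg x = s.reg y
  | .lt x y => s.reg x < s.reg y

inductive Prog where
  | skip
  /-- register `x` gets the constant `c` -/
  | const (x : ℕ) (c : ℤ)
  /-- register `x` gets the content of register `y` -/
  | copy (x y : ℕ)
  | inc (x : ℕ)
  | dec (x : ℕ)
  /-- register `x` gets the cell of array `a` whose indices are in the registers `i`, `j` -/
  | load (x a i j : ℕ)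
  /-- the cell of array `a` whose indices are in the registers `i`, `j` gets register `x` -/
  | store (a i j x : ℕ)
  | seq (p q : Prog)
  | branch (b : Test) (p q : Prog)
  /-- repeat `p` as long as `b` holds -/
  | loop (b : Test) (p : Prog)

def State.setReg (s : State) (x : ℕ) (c : ℤ) : State :=
  { s with reg := Function.update s.reg x c }

def State.setArr (s : State) (a : ℕ) (i j c : ℤ) : State :=
  { s with arr := fun a' i' j' => if a' = a ∧ i' = i ∧ j' = j then c else s.arr a' i' j' }

/-- `Exec p s s' t`: started in the state `s`, the program `p` halts in the state `s'` after
exactly `t` steps. Each elementary instruction and each evaluation of a test is one step. -/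
inductive Exec : Prog → State → State → ℕ → Prop
  | skip (s) : Exec .skip s s 1
  | const (x c s) : Exec (.const x c) s (s.setReg x c) 1
  | copy (x y s) : Exec (.copy x y) s (s.setReg x (s.reg y)) 1
  | inc (x s) : Exec (.inc x) s (s.setReg x (s.reg x + 1)) 1
  | dec (x s) : Exec (.dec x) s (s.setReg x (s.reg x - 1)) 1
  | load (x a i j s) : Exec (.load x a i j) s (s.setReg x (s.arr a (s.reg i) (s.reg j))) 1
  | store (a i j x s) : Exec (.store a i j x) s (s.setArr a (s.reg i) (s.reg j) (s.reg x)) 1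
  | seq {p q s s' s'' t t'} (hp : Exec p s s' t) (hq : Exec q s' s'' t') :
      Exec (.seq p q) s s'' (t + t')
  | branch_true {b p q s s' t} (hb : b.Holds s) (hp : Exec p s s' t) :
      Exec (.branch b p q) s s' (t + 1)
  | branch_false {b p q s s' t} (hb : ¬ b.Holds s) (hq : Exec q s s' t) :
      Exec (.branch b p q) s s' (t + 1)
  | loop_stop {b p s} (hb : ¬ b.Holds s) : Exec (.loop b p) s s 1
  | loop_step {b p s s' s'' t t'} (hb : b.Holds s) (hp : Exec p s s' t)
      (hl : Exec (.loop b p) s' s'' t') : Exec (.loop b p) s s'' (t + t' + 1)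

/-! ### Circuits in memory -/

/-- The array of the edge labels of a circuit, `0` outside the index range. -/
def labArr {n : ℕ} (P : PowerCircuit (Fin n)) (i j : ℤ) : ℤ :=
  if h : (0 ≤ i ∧ i < n) ∧ (0 ≤ j ∧ j < n) then
    (P.lab ⟨i.toNat, by omega⟩ ⟨j.toNat, by omega⟩ : ℤ)
  else 0

/-- The array of the marks of a circuit (in column `0`), `0` elsewhere. -/
def markArr {n : ℕ} (P : PowerCircuit (Fin n)) (i j : ℤ) : ℤ :=
  if h : (0 ≤ i ∧ i < n) ∧ j = 0 then (P.mark ⟨i.toNat, by omega⟩ : ℤ) else 0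

/-- The memory with one input circuit: register `0` holds the number of vertices, array `0` the edge
labels, array `1` the marks, and everything else is `0`. -/
def input {n : ℕ} (P : PowerCircuit (Fin n)) : State where
  reg x := if x = 0 then n else 0
  arr a := if a = 0 then labArr P else if a = 1 then markArr P else fun _ _ => 0

/-- The memory with two input circuits: the first one as in `input`, the second one in the same way
in register `1` and the arrays `2` and `3`. -/
def inputPair {n m : ℕ} (P : PowerCircuit (Fin n)) (Q : PowerCircuit (Fin m)) : State where
  reg x := if x = 0 then n else if x = 1 then m else 0
  arr a := if a = 0 then labArr P else if a = 1 then markArr P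
    else if a = 2 then labArr Q else if a = 3 then markArr Q else fun _ _ => 0

/-- The memory contains the circuit `Q` in register `0` and the arrays `0` and `1` (as in `input`),
and column `0` of array `2` lists all the vertices of `Q` in the order given by `c`. Other cells and
registers may hold anything. -/
def State.Contains (s : State) {k : ℕ} (Q : PowerCircuit (Fin k)) (c : Equiv.Perm (Fin k)) :
    Prop :=
  s.reg 0 = k ∧ (∀ i j : Fin k, s.arr 0 (i : ℕ) (j : ℕ) = (Q.lab i j : ℤ)) ∧
    (∀ i : Fin k, s.arr 1 (i : ℕ) 0 = (Q.mark i : ℤ)) ∧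
    ∀ i : Fin k, s.arr 2 (i : ℕ) 0 = ((c i : ℕ) : ℤ)

/-- The memory contains a reduced proper circuit equivalent to `P`, together with the list of all
its vertices in increasing order of their values. -/
def State.ContainsReduct (s : State) {n : ℕ} (P : PowerCircuit (Fin n)) : Prop :=
  ∃ (k : ℕ) (Q : PowerCircuit (Fin k)) (c : Equiv.Perm (Fin k)),
    Q.IsReduced ∧ Q.IsProper ∧ Q.eval = P.eval ∧
      (∀ i j : Fin k, i < j → Q.value (c i) < Q.value (c j)) ∧ s.Contains Q c

/-! ### The algorithm `compare` -/

/-- The second part of the algorithm: if the circuit in memory has only one vertex, then output `0`;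
otherwise run through the list of vertices from its end to the first marked vertex met, and output
the sign of that vertex. The output is in register `1`. -/
def readOff : Prog :=
  .seq (.const 1 0) <| .seq (.const 4 0) <| .seq (.const 5 1) <|
    .branch (.eq 0 5) .skip <|
      .seq (.copy 2 0) <|
        .loop (.eq 1 4) <|
          .seq (.dec 2) <| .seq (.load 3 2 2 4) (.load 1 1 3 4)

/-- The algorithm `compare` with the reduction subroutine `reduce`: reduce the circuit, then read
off the sign of the marked vertex of largest value. -/
def compare (reduce : Prog) : Prog := .seq reduce readOff

end RAM

namespace RAM

/-! ### Reasoning about programs -/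

/-! In a proper circuit each vertex `v` that is not a leaf has the value `2 ^ E v` with a natural
number `E v`, and `E v` is the signed sum of the values of its successors. These numbers are far too
large to be written down. Ordering vertices and resolving carries, however, needs differences of
exponents only up to a threshold linear in `n`; beyond it the sign suffices. `Approx` expresses this
saturation.

Sorting. Vertices are treated after their successors. The difference `E v - E u` is a signed sum of
values of vertices already sorted, with coefficients of absolute value at most `2`, so Horner's
scheme evaluates it from the largest value downwards, multiplying by `2 ^ gap` between neighbours.
Once the accumulator is large, further multiplications cannot bring it back, so it is frozen
(`run_mulPow`, `run_walk`). Doubling is done by counting, but its cost is paid for by the growth of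
the accumulator. One comparison thus takes linear time, one insertion quadratic time, and the whole
sort cubic time. An artificial vertex `n` with value `1` is the bottom of the list.

Closing under carries. To bring the exponent sums into digits `-1`, `0`, `1`, powers of `2` must be
available wherever a carry may go. If `L r` bounds what occurs at place `r`, at most `L r / 2` is
carried to the next place. The bounds form geometric series with linear total, so linearly many
additional powers suffice (`Chain.extend`, `Chain.succ`). Each has the form `2 ^ (E b + f)` with a
vertex `b` and a small `f`, hence an exponent that is again an explicit signed sum of chain
elements.

Normalizing. Every exponent, and the value of the circuit, becomes a row of digits; carries make the
digits small (`run_carryRow`), and one downward pass removes opposite digits at adjacent powers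
(`run_fixRow`). In such a row with non-negative value `e`, every occurring exponent is smaller than
`e` (`exponent_lt`). So rows refer only to smaller rows, and the rows reachable from the last one
form a reduced circuit (`NormalMatrix.exists_reduct`), listed by increasing value.

Sign. The non-zero values in a reduced circuit are distinct powers of `2`, so the top marked vertex
outweighs all smaller ones together (`sgn_eq_mark`). Two circuits are compared by applying this to
their disjoint union with the second set of marks negated. -/

@[simp] theorem State.setReg_reg (s : State) (x y : ℕ) (c : ℤ) :
    (s.setReg x c).reg y = if y = x then c else s.reg y := by
  simp [State.setReg, Function.update_apply]

@[simp] theorem State.setReg_arr (s : State) (x : ℕ) (c : ℤ) : (s.setReg x c).arr = s.arr := rfl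

@[simp] theorem State.setArr_reg (s : State) (a : ℕ) (i j c : ℤ) :
    (s.setArr a i j c).reg = s.reg := rfl

theorem State.setArr_arr (s : State) (a : ℕ) (i j c i' j' : ℤ) :
    (s.setArr a i j c).arr a i' j' = if i' = i ∧ j' = j then c else s.arr a i' j' := by
  simp [State.setArr]

@[simp] theorem State.setArr_arr_of_ne (s : State) {a b : ℕ} (h : b ≠ a) (i j c : ℤ) :
    (s.setArr a i j c).arr b = s.arr b := by
  funext i' j'
  simp [State.setArr, h]

@[simp] theorem Test.holds_eq (s : State) (x y : ℕ) :
    (Test.eq x y).Holds s ↔ s.reg x = s.reg y := Iff.rfl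

@[simp] theorem Test.holds_lt (s : State) (x y : ℕ) :
    (Test.lt x y).Holds s ↔ s.reg x < s.reg y := Iff.rfl

/-- The registers that a program may change. -/
def Prog.modReg : Prog → ℕ → Bool
  | .skip, _ => false
  | .const x _, y => x == y
  | .copy x _, y => x == y
  | .inc x, y => x == y
  | .dec x, y => x == y
  | .load x _ _ _, y => x == y
  | .store _ _ _ _, _ => false
  | .seq p q, y => p.modReg y || q.modReg y
  | .branch _ p q, y => p.modReg y || q.modReg y
  | .loop _ p, y => p.modReg y

/-- The arrays that a program may change. -/
def Prog.modArr : Prog → ℕ → Bool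
  | .skip, _ => false
  | .const _ _, _ => false
  | .copy _ _, _ => false
  | .inc _, _ => false
  | .dec _, _ => false
  | .load _ _ _ _, _ => false
  | .store a _ _ _, b => a == b
  | .seq p q, y => p.modArr y || q.modArr y
  | .branch _ p q, y => p.modArr y || q.modArr y
  | .loop _ p, y => p.modArr y

/-- The states `s` and `s'` agree on everything that `p` cannot change. -/
def Frame (p : Prog) (s s' : State) : Prop :=
  (∀ x, p.modReg x = false → s'.reg x = s.reg x) ∧ ∀ a, p.modArr a = false → s'.arr a = s.arr a

theorem Frame.refl (p : Prog) (s : State) : Frame p s s := ⟨fun _ _ => rfl, fun _ _ => rfl⟩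

theorem Frame.trans {p : Prog} {s s' s'' : State} (h : Frame p s s') (h' : Frame p s' s'') :
    Frame p s s'' :=
  ⟨fun x hx => (h'.1 x hx).trans (h.1 x hx), fun a ha => (h'.2 a ha).trans (h.2 a ha)⟩

/-- Since `modReg` and `modArr` compute on the program text, preservation of a given register or
array by a concrete program is afterwards proved by `rfl`. -/
theorem Exec.frame {p : Prog} {s s' : State} {t : ℕ} (h : Exec p s s' t) : Frame p s s' := by
  induction h with
  | skip s => exact Frame.refl _ _
  | const x c s | copy x y s | inc x s | dec x s | load x a i j s =>
    refine ⟨fun z hz => ?_, fun _ _ => rfl⟩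
    have : z ≠ x := by rintro rfl; simp [Prog.modReg] at hz
    simp [this]
  | store a i j x s =>
    refine ⟨fun _ _ => rfl, fun b hb => ?_⟩
    have : b ≠ a := by rintro rfl; simp [Prog.modArr] at hb
    simp [this]
  | seq _ _ h1 h2 =>
    refine ⟨fun x hx => ?_, fun a ha => ?_⟩
    · simp only [Prog.modReg, Bool.or_eq_false_iff] at hx
      rw [h2.1 x hx.2, h1.1 x hx.1]
    · simp only [Prog.modArr, Bool.or_eq_false_iff] at ha
      rw [h2.2 a ha.2, h1.2 a ha.1]
  | branch_true _ _ h =>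
    refine ⟨fun x hx => ?_, fun a ha => ?_⟩
    · simp only [Prog.modReg, Bool.or_eq_false_iff] at hx
      rw [h.1 x hx.1]
    · simp only [Prog.modArr, Bool.or_eq_false_iff] at ha
      rw [h.2 a ha.1]
  | branch_false _ _ h =>
    refine ⟨fun x hx => ?_, fun a ha => ?_⟩
    · simp only [Prog.modReg, Bool.or_eq_false_iff] at hx
      rw [h.1 x hx.2]
    · simp only [Prog.modArr, Bool.or_eq_false_iff] at ha
      rw [h.2 a ha.2]
  | loop_stop _ => exact Frame.refl _ _
  | loop_step _ _ _ h1 h2 =>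
    exact Frame.trans (p := .loop _ _) ⟨h1.1, h1.2⟩ h2

/-- Started in `s`, the program `p` halts after some number `t` of steps in a state `s'` such that
`Q s' t`. -/
def Run (p : Prog) (s : State) (Q : State → ℕ → Prop) : Prop := ∃ s' t, Exec p s s' t ∧ Q s' t

theorem Run.conseq {p : Prog} {s : State} {Q Q' : State → ℕ → Prop} (h : Run p s Q)
    (h' : ∀ s' t, Frame p s s' → Q s' t → Q' s' t) : Run p s Q' := by
  obtain ⟨s', t, he, hq⟩ := h
  exact ⟨s', t, he, h' s' t he.frame hq⟩

-- This and the following equivalences form a weakest-precondition calculus: `simp only` with them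
-- executes straight-line code symbolically.
@[simp] theorem run_skip {s : State} {Q : State → ℕ → Prop} : Run .skip s Q ↔ Q s 1 :=
  ⟨fun ⟨_, _, h, hq⟩ => by cases h; exact hq, fun h => ⟨_, _, .skip s, h⟩⟩

@[simp] theorem run_const {s : State} {Q : State → ℕ → Prop} {x : ℕ} {c : ℤ} :
    Run (.const x c) s Q ↔ Q (s.setReg x c) 1 :=
  ⟨fun ⟨_, _, h, hq⟩ => by cases h; exact hq, fun h => ⟨_, _, .const x c s, h⟩⟩

@[simp] theorem run_copy {s : State} {Q : State → ℕ → Prop} {x y : ℕ} :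
    Run (.copy x y) s Q ↔ Q (s.setReg x (s.reg y)) 1 :=
  ⟨fun ⟨_, _, h, hq⟩ => by cases h; exact hq, fun h => ⟨_, _, .copy x y s, h⟩⟩

@[simp] theorem run_inc {s : State} {Q : State → ℕ → Prop} {x : ℕ} :
    Run (.inc x) s Q ↔ Q (s.setReg x (s.reg x + 1)) 1 :=
  ⟨fun ⟨_, _, h, hq⟩ => by cases h; exact hq, fun h => ⟨_, _, .inc x s, h⟩⟩

@[simp] theorem run_dec {s : State} {Q : State → ℕ → Prop} {x : ℕ} :
    Run (.dec x) s Q ↔ Q (s.setReg x (s.reg x - 1)) 1 :=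
  ⟨fun ⟨_, _, h, hq⟩ => by cases h; exact hq, fun h => ⟨_, _, .dec x s, h⟩⟩

@[simp] theorem run_load {s : State} {Q : State → ℕ → Prop} {x a i j : ℕ} :
    Run (.load x a i j) s Q ↔ Q (s.setReg x (s.arr a (s.reg i) (s.reg j))) 1 :=
  ⟨fun ⟨_, _, h, hq⟩ => by cases h; exact hq, fun h => ⟨_, _, .load x a i j s, h⟩⟩

@[simp] theorem run_store {s : State} {Q : State → ℕ → Prop} {x a i j : ℕ} :
    Run (.store a i j x) s Q ↔ Q (s.setArr a (s.reg i) (s.reg j) (s.reg x)) 1 :=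
  ⟨fun ⟨_, _, h, hq⟩ => by cases h; exact hq, fun h => ⟨_, _, .store a i j x s, h⟩⟩

@[simp] theorem run_seq {s : State} {Q : State → ℕ → Prop} {p q : Prog} :
    Run (.seq p q) s Q ↔ Run p s fun s' t => Run q s' fun s'' t' => Q s'' (t + t') := by
  constructor
  · rintro ⟨_, _, h, hq⟩
    cases h with
    | seq h1 h2 => exact ⟨_, _, h1, _, _, h2, hq⟩
  · rintro ⟨_, _, h1, _, _, h2, hq⟩
    exact ⟨_, _, .seq h1 h2, hq⟩

@[simp] theorem run_branch {s : State} {Q : State → ℕ → Prop} {b : Test} {p q : Prog} :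
    Run (.branch b p q) s Q ↔ (b.Holds s → Run p s fun s' t => Q s' (t + 1)) ∧
      (¬ b.Holds s → Run q s fun s' t => Q s' (t + 1)) := by
  constructor
  · rintro ⟨_, _, h, hq⟩
    cases h with
    | branch_true hb h => exact ⟨fun _ => ⟨_, _, h, hq⟩, fun h' => absurd hb h'⟩
    | branch_false hb h => exact ⟨fun h' => absurd h' hb, fun _ => ⟨_, _, h, hq⟩⟩
  · rintro ⟨h1, h2⟩
    by_cases hb : b.Holds s
    · obtain ⟨_, _, h, hq⟩ := h1 hb
      exact ⟨_, _, .branch_true hb h, hq⟩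
    · obtain ⟨_, _, h, hq⟩ := h2 hb
      exact ⟨_, _, .branch_false hb h, hq⟩

/-- The rule for loops. `I N s` is an invariant together with a bound `N` for the remaining time. -/
theorem Run.loop {b : Test} {p : Prog} {s : State} {Q : State → ℕ → Prop}
    (I : ℕ → State → Prop) (N : ℕ) (h0 : I N s)
    (hstep : ∀ N s', Frame (.loop b p) s s' → I N s' → b.Holds s' →
      Run p s' fun s'' t => ∃ N', I N' s'' ∧ t + 1 + N' ≤ N)
    (hQ : ∀ N' s' t, Frame (.loop b p) s s' → I N' s' → ¬ b.Holds s' → t + N' ≤ N + 1 → Q s' t) :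
    Run (.loop b p) s Q := by
  -- The unspent budget `N'` is returned together with the exit state, which allows amortized
  -- bounds; the additional `1` pays for the failing test.
  suffices H : ∀ N s1, Frame (.loop b p) s s1 → I N s1 → ∃ s' t N', Exec (.loop b p) s1 s' t ∧
      I N' s' ∧ ¬ b.Holds s' ∧ t + N' ≤ N + 1 by
    obtain ⟨s', t, N', he, h1, h2, h3⟩ := H N s (Frame.refl _ _) h0
    exact ⟨s', t, he, hQ N' s' t he.frame h1 h2 h3⟩
  intro N
  induction N using Nat.strong_induction_on with
  | _ N ih =>
    intro s1 hf hI
    by_cases hb : b.Holds s1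
    · obtain ⟨s2, t, he, N1, hI1, ht⟩ := hstep N s1 hf hI hb
      have hf2 : Frame (.loop b p) s s2 := hf.trans ⟨he.frame.1, he.frame.2⟩
      obtain ⟨s3, t3, N3, he3, hI3, hb3, ht3⟩ := ih N1 (by omega) s2 hf2 hI1
      exact ⟨s3, t + t3 + 1, N3, .loop_step hb he he3, hI3, hb3, by omega⟩
    · exact ⟨s1, 1, N, Exec.loop_stop hb, hI, hb, by omega⟩

/-- Run `p` for all values of register `x` from the present one up to (excluding) the content of
register `y`. -/
def forUp (x y : ℕ) (p : Prog) : Prog := .loop (.lt x y) (.seq p (.inc x))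

/-- A round costs `T + 2`: the body, the test and the increment. The invariant is demanded with the
counter already advanced. The side conditions are Boolean equations so that `rfl` proves them for
concrete programs. -/
theorem Run.forUp {x y : ℕ} {p : Prog} {s : State} {Q : State → ℕ → Prop}
    (I : ℕ → State → Prop) (a b T : ℕ) (hx : s.reg x = a) (hy : s.reg y = b) (hab : a ≤ b)
    (hxy : (y == x) = false) (hpx : p.modReg x = false) (hpy : p.modReg y = false) (hI : I a s)
    (hstep : ∀ i s', Frame (forUp x y p) s s' → a ≤ i → i < b → s'.reg x = i → s'.reg y = b →
      I i s' → Run p s' fun s'' t => I (i + 1) (s''.setReg x ((i + 1 : ℕ) : ℤ)) ∧ t ≤ T)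
    (hQ : ∀ s' t, Frame (forUp x y p) s s' → s'.reg x = b → I b s' →
      t ≤ (b - a) * (T + 2) + 1 → Q s' t) :
    Run (forUp x y p) s Q := by
  have hyx : y ≠ x := by simpa using hxy
  refine Run.loop (fun N s' => ∃ i, a ≤ i ∧ i ≤ b ∧ s'.reg x = i ∧ s'.reg y = b ∧ I i s' ∧
    N = (b - i) * (T + 2)) ((b - a) * (T + 2)) ⟨a, le_rfl, hab, hx, hy, hI, rfl⟩ ?_ ?_
  · rintro N s' hf ⟨i, hai, hib, hxi, hyb, hi, rfl⟩ hlt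
    rw [Test.holds_lt, hxi, hyb, Nat.cast_lt] at hlt
    rw [run_seq]
    refine (hstep i s' hf hai hlt hxi hyb hi).conseq ?_
    rintro s2 t fr ⟨hI2, ht⟩
    have h1 : s2.reg x = i := by rw [fr.1 x hpx, hxi]
    have h2 : s2.reg y = b := by rw [fr.1 y hpy, hyb]
    rw [run_inc, h1]
    refine ⟨(b - (i + 1)) * (T + 2), ⟨i + 1, by omega, by omega, by simp, by simp [hyx, h2],
      by simpa using hI2, rfl⟩, ?_⟩
    obtain ⟨e, rfl⟩ : ∃ e, b = i + 1 + e := ⟨b - (i + 1), by omega⟩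
    have e1 : i + 1 + e - i = e + 1 := by omega
    have e2 : i + 1 + e - (i + 1) = e := by omega
    rw [e1, e2, add_mul]
    omega
  · rintro N s' t hf ⟨i, hai, hib, hxi, hyb, hi, rfl⟩ hlt ht
    rw [Test.holds_lt, hxi, hyb, Nat.cast_lt] at hlt
    obtain rfl : i = b := by omega
    exact hQ s' t hf hxi hi (by omega)

/-- Run `p` for all values of register `x` from the present one down to (excluding) the content of
register `y`. -/
def forDown (x y : ℕ) (p : Prog) : Prog := .loop (.lt y x) (.seq p (.dec x))

/-- The body runs with the counter at `i + 1` and has to establish the invariant for `i`; the lower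
bound `a` itself is never visited. -/
theorem Run.forDown {x y : ℕ} {p : Prog} {s : State} {Q : State → ℕ → Prop}
    (I : ℕ → State → Prop) (a b T : ℕ) (hx : s.reg x = b) (hy : s.reg y = a) (hab : a ≤ b)
    (hxy : (y == x) = false) (hpx : p.modReg x = false) (hpy : p.modReg y = false) (hI : I b s)
    (hstep : ∀ i s', Frame (forDown x y p) s s' → a ≤ i → i < b → s'.reg x = (i + 1 : ℕ) →
      s'.reg y = a → I (i + 1) s' → Run p s' fun s'' t => I i (s''.setReg x (i : ℤ)) ∧ t ≤ T)
    (hQ : ∀ s' t, Frame (forDown x y p) s s' → s'.reg x = a → I a s' →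
      t ≤ (b - a) * (T + 2) + 1 → Q s' t) :
    Run (forDown x y p) s Q := by
  have hyx : y ≠ x := by simpa using hxy
  refine Run.loop (fun N s' => ∃ i, a ≤ i ∧ i ≤ b ∧ s'.reg x = i ∧ s'.reg y = a ∧ I i s' ∧
    N = (i - a) * (T + 2)) ((b - a) * (T + 2)) ⟨b, hab, le_rfl, hx, hy, hI, rfl⟩ ?_ ?_
  · rintro N s' hf ⟨i, hai, hib, hxi, hyb, hi, rfl⟩ hlt
    rw [Test.holds_lt, hxi, hyb, Nat.cast_lt] at hlt
    obtain ⟨i, rfl⟩ : ∃ e, i = e + 1 := ⟨i - 1, by omega⟩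
    rw [run_seq]
    refine (hstep i s' hf (by omega) (by omega) hxi hyb hi).conseq ?_
    rintro s2 t fr ⟨hI2, ht⟩
    have h1 : s2.reg x = (i + 1 : ℕ) := by rw [fr.1 x hpx, hxi]
    have h2 : s2.reg y = a := by rw [fr.1 y hpy, hyb]
    rw [run_dec, h1]
    refine ⟨(i - a) * (T + 2), ⟨i, by omega, by omega, by simp, by simp [hyx, h2],
      by simpa using hI2, rfl⟩, ?_⟩
    have e1 : i + 1 - a = (i - a) + 1 := by omega
    rw [e1, add_mul]
    omega
  · rintro N s' t hf ⟨i, hai, hib, hxi, hyb, hi, rfl⟩ hlt ht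
    rw [Test.holds_lt, hxi, hyb, Nat.cast_lt] at hlt
    obtain rfl : i = a := by omega
    exact hQ s' t hf hxi hi (by omega)

/-! ### Addition and subtraction by counting; register `10` holds `0` -/

/-- `x += y`, with the auxiliary register `u`. -/
def addTo (x y u : ℕ) : Prog :=
  .seq (.copy u y) <| .seq (.loop (.lt 10 u) (.seq (.dec u) (.inc x)))
    (.loop (.lt u 10) (.seq (.inc u) (.dec x)))

/-- `x -= y`, with the auxiliary register `u`. -/
def subTo (x y u : ℕ) : Prog :=
  .seq (.copy u y) <| .seq (.loop (.lt 10 u) (.seq (.dec u) (.dec x)))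
    (.loop (.lt u 10) (.seq (.inc u) (.inc x)))

/-- The two loops serve the two signs of the summand, and at most one of them makes rounds, of three
steps each; the copy and the two failing tests give the final `3`. -/
theorem run_addTo {x y u : ℕ} {s : State} (h0 : s.reg 10 = 0) (hxu : x ≠ u) (hx : x ≠ 10)
    (hu : u ≠ 10) : Run (addTo x y u) s fun s' t =>
      s'.reg x = s.reg x + s.reg y ∧ t ≤ 3 * (s.reg y).natAbs + 3 := by
  simp only [addTo, run_seq, run_copy]
  refine Run.loop (fun N s' => s'.reg 10 = 0 ∧ s'.reg x + s'.reg u = s.reg x + s.reg y ∧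
    (0 ≤ s'.reg u → N = 3 * (s'.reg u).natAbs) ∧ (s'.reg u < 0 → N = 0 ∧ s'.reg u = s.reg y) ∧
    (s.reg y ≤ 0 → s'.reg u = s.reg y))
    (3 * (s.reg y).toNat) ?_ ?_ ?_
  · simp [hu.symm, h0, hxu]
    omega
  · rintro N s' - ⟨h1, h2, h3, h4, h5⟩ hb
    simp only [Test.holds_lt, h1] at hb
    simp only [run_seq, run_dec, run_inc, State.setReg_reg, if_neg hu.symm, if_neg hx.symm, h1,
      if_true, if_neg hxu, if_neg hxu.symm]
    refine ⟨_, ⟨trivial, by omega, fun _ => rfl, by omega, by omega⟩, ?_⟩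
    omega
  · rintro N1 s1 t1 - ⟨h1, h2, h3, h4, h5⟩ hb ht
    simp only [Test.holds_lt, h1] at hb
    -- What remains for the second loop and what the first loop has done add up to the absolute
    -- value of the summand.
    have hu0 : (s1.reg u).natAbs + (s.reg y).toNat = (s.reg y).natAbs := by
      rcases le_or_gt (s.reg y) 0 with h | h
      · rw [h5 h]; omega
      · by_cases h' : s1.reg u < 0
        · have := (h4 h').2; omega
        · omega
    refine Run.loop (fun N s' => s'.reg 10 = 0 ∧ s'.reg x + s'.reg u = s.reg x + s.reg y ∧
      s'.reg u ≤ 0 ∧ N = 3 * (s'.reg u).natAbs) (3 * (s1.reg u).natAbs)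
        ⟨h1, h2, by omega, rfl⟩ ?_ ?_
    · rintro N s' - ⟨h1, h2, h3, h4⟩ hb
      simp only [Test.holds_lt, h1] at hb
      simp only [run_seq, run_dec, run_inc, State.setReg_reg, if_neg hu.symm, if_neg hx.symm, h1,
        if_true, if_neg hxu, if_neg hxu.symm]
      refine ⟨_, ⟨trivial, by omega, by omega, rfl⟩, ?_⟩
      omega
    · rintro N2 s2 t2 - ⟨h1', h2', h3', h4'⟩ hb' ht'
      simp only [Test.holds_lt, h1'] at hb'
      constructor <;> omega

theorem run_subTo {x y u : ℕ} {s : State} (h0 : s.reg 10 = 0) (hxu : x ≠ u) (hx : x ≠ 10)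
    (hu : u ≠ 10) : Run (subTo x y u) s fun s' t =>
      s'.reg x = s.reg x - s.reg y ∧ t ≤ 3 * (s.reg y).natAbs + 3 := by
  simp only [subTo, run_seq, run_copy]
  refine Run.loop (fun N s' => s'.reg 10 = 0 ∧ s'.reg x - s'.reg u = s.reg x - s.reg y ∧
    (0 ≤ s'.reg u → N = 3 * (s'.reg u).natAbs) ∧ (s'.reg u < 0 → N = 0 ∧ s'.reg u = s.reg y) ∧
    (s.reg y ≤ 0 → s'.reg u = s.reg y))
    (3 * (s.reg y).toNat) ?_ ?_ ?_
  · simp [hu.symm, h0, hxu]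
    omega
  · rintro N s' - ⟨h1, h2, h3, h4, h5⟩ hb
    simp only [Test.holds_lt, h1] at hb
    simp only [run_seq, run_dec, State.setReg_reg, if_neg hu.symm, if_neg hx.symm, h1,
      if_true, if_neg hxu, if_neg hxu.symm]
    refine ⟨_, ⟨trivial, by omega, fun _ => rfl, by omega, by omega⟩, ?_⟩
    omega
  · rintro N1 s1 t1 - ⟨h1, h2, h3, h4, h5⟩ hb ht
    simp only [Test.holds_lt, h1] at hb
    have hu0 : (s1.reg u).natAbs + (s.reg y).toNat = (s.reg y).natAbs := by
      rcases le_or_gt (s.reg y) 0 with h | h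
      · rw [h5 h]; omega
      · by_cases h' : s1.reg u < 0
        · have := (h4 h').2; omega
        · omega
    refine Run.loop (fun N s' => s'.reg 10 = 0 ∧ s'.reg x - s'.reg u = s.reg x - s.reg y ∧
      s'.reg u ≤ 0 ∧ N = 3 * (s'.reg u).natAbs) (3 * (s1.reg u).natAbs)
        ⟨h1, h2, by omega, rfl⟩ ?_ ?_
    · rintro N s' - ⟨h1, h2, h3, h4⟩ hb
      simp only [Test.holds_lt, h1] at hb
      simp only [run_seq, run_inc, State.setReg_reg, if_neg hu.symm, if_neg hx.symm, h1,
        if_true, if_neg hxu, if_neg hxu.symm]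
      refine ⟨_, ⟨trivial, by omega, by omega, rfl⟩, ?_⟩
      omega
    · rintro N2 s2 t2 - ⟨h1', h2', h3', h4'⟩ hb' ht'
      simp only [Test.holds_lt, h1'] at hb'
      constructor <;> omega

/-! ### Saturated numbers -/

/-- `a` equals `S`, or both are at least `K`, or both are at most `-K`. -/
def Approx (K : ℕ) (a S : ℤ) : Prop :=
  a = S ∨ (K ≤ a ∧ K ≤ S) ∨ (a ≤ -K ∧ S ≤ -K)

theorem Approx.two_mul {K : ℕ} {a S : ℤ} (h : Approx K a S) : Approx K (a + a) (2 * S) := by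
  unfold Approx at *
  omega

theorem Approx.mono {K K' : ℕ} {a S : ℤ} (h : Approx K a S) (hK : K' ≤ K) : Approx K' a S := by
  unfold Approx at *
  omega

theorem Approx.neg {K : ℕ} {a S : ℤ} (h : Approx K a S) : Approx K (-a) (-S) := by
  unfold Approx at *
  omega

/-- An exact addition may push a saturated number back towards `0`, so it is paid for by lowering
the threshold. -/
theorem Approx.add {K d : ℕ} {a S c : ℤ} (h : Approx (K + d) a S) (hc : c.natAbs ≤ d) :
    Approx K (a + c) (S + c) := by
  unfold Approx at *
  omega

/-- Multiplication by `2 ^ e` only moves `S` away from `0`. Hence a number that is already beyond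
the threshold may stay unchanged. -/
theorem Approx.mul_pow_of_le {K : ℕ} {a S : ℤ} (h : Approx K a S) (hK : K ≤ a.natAbs) (e : ℕ) :
    Approx K a (S * 2 ^ e) := by
  have h1 : (1 : ℤ) ≤ 2 ^ e := one_le_pow₀ (by norm_num)
  have h2 : 0 ≤ S → S ≤ S * 2 ^ e := fun h => by nlinarith
  have h3 : S ≤ 0 → S * 2 ^ e ≤ S := fun h => by nlinarith
  unfold Approx at *
  omega

/-- Multiply register `22` by `2` as often as register `28` says, but stop when the absolute value
reaches the number `B`; the registers `12`, `13` hold `B` and `-B`. -/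
def mulPow : Prog :=
  .loop (.lt 10 28) <|
    .branch (.eq 22 10) (.const 28 0) <|
      .branch (.lt 22 12)
        (.branch (.lt 13 22) (.seq (addTo 22 22 30) (.dec 28)) (.const 28 0))
        (.const 28 0)

/-- The loop count `g` may be a saturated version of the true exponent `d`. As `2 ^ G` is at least
`B`, a non-zero number reaches `B` before either count runs out if both are at least `G`. A round
costs at most `3 * |a| + 8 ≤ 12 * |a|` steps and increases `|a|` by `|a|`, so `12 * |a|` serves as a
potential. -/
theorem run_mulPow {s : State} {B G K g d : ℕ} {S : ℤ} (h0 : s.reg 10 = 0) (hB : s.reg 12 = B)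
    (hB' : s.reg 13 = -B) (hg : s.reg 28 = g) (hgd : g = d ∨ (G ≤ g ∧ G ≤ d)) (hG : B ≤ 2 ^ G)
    (hK : 0 < K) (hKB : K ≤ B) (hS : Approx K (s.reg 22) S) :
    Run mulPow s fun s' t => Approx K (s'.reg 22) (S * 2 ^ d) ∧
      (s.reg 22).natAbs ≤ (s'.reg 22).natAbs ∧
      (s'.reg 22).natAbs ≤ max (s.reg 22).natAbs (2 * B) ∧
      t + 12 * (s.reg 22).natAbs ≤ 12 * (s'.reg 22).natAbs + 12 := by
  set M := max (s.reg 22).natAbs (2 * B) with hM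
  have hMB : 2 * B ≤ M := le_max_right _ _
  -- Unless the work is finished, a factor `2 ^ d'` remains. Either the remaining counts agree, or
  -- both are still large enough to carry a non-zero number beyond `2 ^ G`. The extra `10` pays for
  -- a round that merely stops the loop.
  refine Run.loop (fun N s' => (s.reg 22).natAbs ≤ (s'.reg 22).natAbs ∧ (s'.reg 22).natAbs ≤ M ∧
    ((s'.reg 28 = 0 ∧ Approx K (s'.reg 22) (S * 2 ^ d) ∧ N = 12 * (M - (s'.reg 22).natAbs)) ∨
      ∃ (g' d' : ℕ) (S' : ℤ), s'.reg 28 = g' ∧ 0 < g' ∧ S' * 2 ^ d' = S * 2 ^ d ∧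
        Approx K (s'.reg 22) S' ∧ N = 12 * (M - (s'.reg 22).natAbs) + 10 ∧
        (g' = d' ∨ (s'.reg 22 ≠ 0 → 2 ^ G ≤ 2 ^ g' * (s'.reg 22).natAbs ∧
          2 ^ G ≤ 2 ^ d' * (s'.reg 22).natAbs))))
    (if g = 0 then 12 * (M - (s.reg 22).natAbs) else 12 * (M - (s.reg 22).natAbs) + 10) ?_ ?_ ?_
  · refine ⟨le_rfl, le_max_left _ _, ?_⟩
    rcases Nat.eq_zero_or_pos g with rfl | hg0
    · left
      refine ⟨by simpa using hg, ?_, by simp⟩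
      rcases hgd with rfl | ⟨h1, h2⟩
      · simpa using hS
      -- A saturated count `0` forces `G = 0`, hence `B = K = 1`, and then every non-zero number is
      -- already large.
      · obtain rfl : G = 0 := by omega
        obtain rfl : K = 1 := by simp at hG; omega
        by_cases hz : s.reg 22 = 0
        · have : S = 0 := by unfold Approx at hS; omega
          rw [hz, this]; simp [Approx]
        · exact hS.mul_pow_of_le (by omega) d
    · right
      refine ⟨g, d, S, hg, hg0, rfl, hS, by simp [hg0.ne'], ?_⟩
      rcases hgd with h | ⟨h1, h2⟩
      · exact .inl h
      · right
        intro hne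
        have hpos : 0 < (s.reg 22).natAbs := by omega
        exact ⟨(Nat.pow_le_pow_right (by norm_num) h1).trans (Nat.le_mul_of_pos_right _ hpos),
          (Nat.pow_le_pow_right (by norm_num) h2).trans (Nat.le_mul_of_pos_right _ hpos)⟩
  · rintro N s' fr ⟨hle, hM', h⟩ hb
    have h10 : s'.reg 10 = 0 := by rw [fr.1 10 rfl, h0]
    have h12 : s'.reg 12 = B := by rw [fr.1 12 rfl, hB]
    have h13 : s'.reg 13 = -B := by rw [fr.1 13 rfl, hB']
    simp only [Test.holds_lt, h10] at hb
    rcases h with ⟨h, -⟩ | ⟨g', d', S', h28, hg', hSS, hA, hN, hgd'⟩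
    · omega
    simp only [run_branch, Test.holds_eq, Test.holds_lt, h10, h12, h13, run_const, run_seq]
    have large : (B : ℤ) ≤ s'.reg 22 ∨ s'.reg 22 ≤ -B → Approx K (s'.reg 22) (S * 2 ^ d) := by
      intro h
      rw [← hSS]
      exact hA.mul_pow_of_le (by omega) d'
    refine ⟨fun hz => ?_, fun hz => ⟨fun h1 => ⟨fun h2 => ?_, fun h2 => ?_⟩, fun h1 => ?_⟩⟩
    · refine ⟨12 * (M - (s'.reg 22).natAbs), ⟨by simpa using hle, by simpa using hM', .inl ?_⟩, ?_⟩
      · have : S' = 0 := by unfold Approx at hA; omega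
        simp [← hSS, hz, this, Approx]
      · omega
    · refine (run_addTo h10 (by norm_num) (by norm_num) (by norm_num)).conseq ?_
      rintro s2 t fr2 ⟨h22, ht⟩
      have h28' : s2.reg 28 = g' := by rw [fr2.1 28 rfl, h28]
      have hab : (s2.reg 22).natAbs = 2 * (s'.reg 22).natAbs := by omega
      have hA2 : Approx K (s2.reg 22) (2 * S') := by rw [h22]; exact hA.two_mul
      -- The true count cannot be exhausted here: otherwise `2 ^ G ≤ |a| < B ≤ 2 ^ G`.
      have hd' : 0 < d' := by
        rcases hgd' with h | h
        · omega
        · rcases Nat.eq_zero_or_pos d' with rfl | hd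
          · have := (h hz).2
            simp at this
            omega
          · exact hd
      obtain ⟨d1, rfl⟩ : ∃ e, d' = e + 1 := ⟨d' - 1, by omega⟩
      obtain ⟨g1, rfl⟩ : ∃ e, g' = e + 1 := ⟨g' - 1, by omega⟩
      have hSS2 : 2 * S' * 2 ^ d1 = S * 2 ^ d := by rw [← hSS]; ring
      simp only [run_dec, State.setReg_reg, h28']
      refine ⟨if g1 = 0 then 12 * (M - (s2.reg 22).natAbs) else 12 * (M - (s2.reg 22).natAbs) + 10,
        ⟨?_, ?_, ?_⟩, ?_⟩
      · simp; omega
      · simp; omega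
      · rcases Nat.eq_zero_or_pos g1 with rfl | hg1
        · left
          refine ⟨by simp, ?_, by simp⟩
          simp only [show ((22 : ℕ) = 28) = False by simp, if_false]
          rw [← hSS2]
          rcases hgd' with h | h
          · obtain rfl : d1 = 0 := by omega
            simpa using hA2
          · refine hA2.mul_pow_of_le ?_ d1
            have := (h hz).1
            simp at this
            omega
        · right
          refine ⟨g1, d1, 2 * S', by simp, hg1, hSS2, by simpa using hA2, by simp [hg1.ne'], ?_⟩
          rcases hgd' with h | h
          · left; omega
          · right
            intro _
            obtain ⟨e1, e2⟩ := h hz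
            simp only [show ((22 : ℕ) = 28) = False by simp, if_false, hab]
            constructor
            · calc _ ≤ _ := e1
                _ = _ := by ring
            · calc _ ≤ _ := e2
                _ = _ := by ring
      · split_ifs <;> omega
    · exact ⟨12 * (M - (s'.reg 22).natAbs), ⟨by simpa using hle, by simpa using hM',
        .inl ⟨by simp, by simpa using large (by omega), by simp⟩⟩, by omega⟩
    · exact ⟨12 * (M - (s'.reg 22).natAbs), ⟨by simpa using hle, by simpa using hM',
        .inl ⟨by simp, by simpa using large (by omega), by simp⟩⟩, by omega⟩
  · rintro N' s' t fr ⟨hle, hM', h⟩ hb ht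
    have h10 : s'.reg 10 = 0 := by rw [fr.1 10 rfl, h0]
    simp only [Test.holds_lt, h10] at hb
    rcases h with ⟨h, hA, hN⟩ | ⟨g', d', S', h28, hg', -⟩
    · exact ⟨hA, hle, hM', by split_ifs at ht <;> omega⟩
    · omega

/-! ### Comparing exponents by a saturated Horner scheme -/

open Finset

/-- Compare the exponents of the vertices in the registers `20` and `21`: run down the list of
vertices in array `4`, evaluating the difference of the exponents by Horner's scheme, where
array `6` holds the differences of exponents. The result is in register `22`. -/
def walk : Prog :=
  .seq (.const 22 0) <| .seq (.copy 23 14) <|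
    .loop (.lt 10 23) <|
      .seq (.dec 23) <| .seq (.load 24 4 23 10) <| .seq (.load 25 0 20 24) <|
        .seq (addTo 22 25 30) <| .seq (.load 25 0 21 24) <| .seq (subTo 22 25 30) <|
          .branch (.lt 10 23)
            (.seq (.copy 26 23) <| .seq (.dec 26) <| .seq (.load 27 4 26 10) <|
              .seq (.load 28 6 24 27) mulPow)
            .skip

-- The threshold starts at `4 * n + 8` and loses `2` per coefficient; after at most `n + 1`
-- coefficients it is at least `2 * n + 6`, more than the required `n + 5`. The accumulator stays
-- bounded by a linear function, a coefficient moves it by at most `2`, and multiplications are paid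
-- for by its growth, so the total time is linear.
set_option maxHeartbeats 1600000 in
theorem run_walk {s : State} {n q u v : ℕ} {A : ℕ → ℕ → ℤ} {o E : ℕ → ℕ}
    (h10 : s.reg 10 = 0) (h12 : s.reg 12 = (4 * n + 8 : ℕ)) (h13 : s.reg 13 = -(4 * n + 8 : ℕ))
    (h14 : s.reg 14 = q) (h20 : s.reg 20 = v) (h21 : s.reg 21 = u) (hq : q ≤ n + 1)
    (hA : ∀ i j : ℕ, s.arr 0 i j = A i j) (hA1 : ∀ i j, (A i j).natAbs ≤ 1)
    (ho : ∀ i < q, s.arr 4 (i : ℕ) 0 = o i) (hE : ∀ i, i + 1 < q → E (o i) ≤ E (o (i + 1)))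
    (hd : ∀ i, i + 1 < q → Approx (n + 5) (s.arr 6 (o (i + 1)) (o i)) (E (o (i + 1)) - E (o i))) :
    Run walk s fun s' t => Approx (n + 5) (s'.reg 22)
        (∑ i ∈ range q, (A v (o i) - A u (o i)) * 2 ^ (E (o i) - E (o 0))) ∧
      (s'.reg 22).natAbs ≤ 10 * n + 18 ∧ t ≤ 320 * (n + 1) := by
  have hmono : ∀ i j, i ≤ j → j < q → E (o i) ≤ E (o j) := by
    intro i j hij hj
    induction j, hij using Nat.le_induction with
    | base => exact le_rfl
    | succ j hij ih => exact (ih (by omega)).trans (hE j hj)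
  set c : ℕ → ℤ := fun i => A v (o i) - A u (o i) with hc
  -- `T i` is the tail of the sum from `i` on, in units of the power belonging to the next lower
  -- entry. At `i = 0` truncated subtraction makes the unit that of `o 0`, so `T 0` is the whole
  -- sum.
  set T : ℕ → ℤ := fun i => ∑ j ∈ Ico i q, c j * 2 ^ (E (o j) - E (o (i - 1))) with hT
  -- A gap of `n + 5` already takes every non-zero number to the cap, which is why gaps need only be
  -- known up to `n + 5`.
  have hGB : 4 * n + 8 ≤ 2 ^ (n + 5) := by
    have : n + 1 ≤ 2 ^ n := Nat.lt_two_pow_self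
    rw [pow_add]; omega
  simp only [walk, run_seq, run_const, run_copy]
  -- The budget allows `80` steps per round, plus `12` times the distance of the accumulator from
  -- its bound, which is the potential consumed by `run_mulPow`.
  refine Run.loop (fun N s' => ∃ i ≤ q, s'.reg 23 = i ∧
      Approx (4 * n + 8 - 2 * (q - i)) (s'.reg 22) (T i) ∧
      (s'.reg 22).natAbs ≤ 2 * (4 * n + 8) + 2 * (q - i) ∧
      N = 80 * i + 12 * (2 * (4 * n + 8) + 2 * q - (s'.reg 22).natAbs))
    (80 * q + 12 * (2 * (4 * n + 8) + 2 * q)) ?_ ?_ ?_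
  · exact ⟨q, le_rfl, by simp [h14], by simp [hT, Approx], by simp, by simp⟩
  · rintro N s' fr ⟨i, hiq, h23, hap, hbd, rfl⟩ hb
    have e10 : s'.reg 10 = 0 := by rw [fr.1 10 rfl]; simp [h10]
    have e12 : s'.reg 12 = (4 * n + 8 : ℕ) := by rw [fr.1 12 rfl]; simp [h12]
    have e13 : s'.reg 13 = -(4 * n + 8 : ℕ) := by rw [fr.1 13 rfl]; simp [h13]
    have e20 : s'.reg 20 = v := by rw [fr.1 20 rfl]; simp [h20]
    have e21 : s'.reg 21 = u := by rw [fr.1 21 rfl]; simp [h21]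
    have a0 : s'.arr 0 = s.arr 0 := by rw [fr.2 0 rfl]; simp
    have a4 : s'.arr 4 = s.arr 4 := by rw [fr.2 4 rfl]; simp
    have a6 : s'.arr 6 = s.arr 6 := by rw [fr.2 6 rfl]; simp
    simp only [Test.holds_lt, e10, h23, Nat.cast_pos] at hb
    obtain ⟨i, rfl⟩ : ∃ e, i = e + 1 := ⟨i - 1, by omega⟩
    have hi : (s'.reg 23 - 1) = (i : ℤ) := by rw [h23]; simp
    simp only [run_seq, run_dec, run_load, State.setReg_reg, State.setReg_arr, hi, e10, e20,
      a0, a4, reduceIte, Nat.reduceEqDiff, ho i (by omega), hA]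
    refine (run_addTo (by simp [e10]) (by norm_num) (by norm_num) (by norm_num)).conseq ?_
    rintro s2 t2 fr2 ⟨h22, ht2⟩
    have f10 : s2.reg 10 = 0 := by rw [fr2.1 10 rfl]; simp [e10]
    have f12 : s2.reg 12 = (4 * n + 8 : ℕ) := by rw [fr2.1 12 rfl]; simp [e12]
    have f13 : s2.reg 13 = -(4 * n + 8 : ℕ) := by rw [fr2.1 13 rfl]; simp [e13]
    have f21 : s2.reg 21 = u := by rw [fr2.1 21 rfl]; simp [e21]
    have f23 : s2.reg 23 = i := by rw [fr2.1 23 rfl]; simp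
    have f24 : s2.reg 24 = o i := by rw [fr2.1 24 rfl]; simp
    have b0 : s2.arr 0 = s.arr 0 := by rw [fr2.2 0 rfl]; simp [a0]
    have b4 : s2.arr 4 = s.arr 4 := by rw [fr2.2 4 rfl]; simp [a4]
    have b6 : s2.arr 6 = s.arr 6 := by rw [fr2.2 6 rfl]; simp [a6]
    simp only [f21, f24, b0, hA]
    simp only [State.setReg_reg, reduceIte, Nat.reduceEqDiff] at h22 ht2
    refine (run_subTo (by simp [f10]) (by norm_num) (by norm_num) (by norm_num)).conseq ?_
    rintro s3 t3 fr3 ⟨h22', ht3⟩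
    have g10 : s3.reg 10 = 0 := by rw [fr3.1 10 rfl]; simp [f10]
    have g12 : s3.reg 12 = (4 * n + 8 : ℕ) := by rw [fr3.1 12 rfl]; simp [f12]
    have g13 : s3.reg 13 = -(4 * n + 8 : ℕ) := by rw [fr3.1 13 rfl]; simp [f13]
    have g23 : s3.reg 23 = i := by rw [fr3.1 23 rfl]; simp [f23]
    have g24 : s3.reg 24 = o i := by rw [fr3.1 24 rfl]; simp [f24]
    have c4 : s3.arr 4 = s.arr 4 := by rw [fr3.2 4 rfl]; simp [b4]
    have c6 : s3.arr 6 = s.arr 6 := by rw [fr3.2 6 rfl]; simp [b6]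
    simp only [State.setReg_reg, reduceIte, Nat.reduceEqDiff] at h22' ht3
    have d1 := hA1 v (o i)
    have d2 := hA1 u (o i)
    have h22c : s3.reg 22 = s'.reg 22 + c i := by rw [h22', h22, hc]; ring
    have hci : (c i).natAbs ≤ 2 := by
      simp only [hc]
      clear * - d1 d2
      omega
    have n1 : (s3.reg 22).natAbs ≤ (s'.reg 22).natAbs + 2 := by
      rw [h22c]; clear * - hci; omega
    have n2 : (s'.reg 22).natAbs ≤ (s3.reg 22).natAbs + 2 := by
      rw [h22c]; clear * - hci; omega
    have ht2' : t2 ≤ 6 := by clear * - ht2 d1; omega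
    have ht3' : t3 ≤ 6 := by clear * - ht3 d2; omega
    clear ht2 ht3 h22 h22'
    have hap3 : Approx (4 * n + 8 - 2 * (q - i)) (s3.reg 22) (T (i + 1) + c i) := by
      rw [h22c]
      have : 4 * n + 8 - 2 * (q - (i + 1)) = 4 * n + 8 - 2 * (q - i) + 2 := by omega
      rw [this] at hap
      exact hap.add hci
    simp only [run_branch, Test.holds_lt, g10, g23, Nat.cast_pos, run_skip]
    refine ⟨fun hi0 => ?_, fun hi0 => ?_⟩
    · obtain ⟨i, rfl⟩ : ∃ e, i = e + 1 := ⟨i - 1, by omega⟩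
      have hi' : ((i + 1 : ℕ) : ℤ) - 1 = (i : ℤ) := by simp
      simp only [run_copy, run_seq, run_dec, run_load, State.setReg_reg, State.setReg_arr, reduceIte,
        Nat.reduceEqDiff, g23, g24, g10, hi', c4, c6, ho i (by omega)]
      have hdi := hd i (by omega)
      have hEi := hE i (by omega)
      -- The stored gap is non-negative, because the exponents increase along the list and
      -- saturation preserves signs.
      obtain ⟨g, hg⟩ : ∃ g : ℕ, s.arr 6 (o (i + 1)) (o i) = g := by
        refine ⟨(s.arr 6 (o (i + 1)) (o i)).toNat, ?_⟩
        unfold Approx at hdi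
        omega
      rw [hg] at hdi
      refine (run_mulPow (B := 4 * n + 8) (G := n + 5) (K := 4 * n + 8 - 2 * (q - (i + 1))) (g := g)
        (d := E (o (i + 1)) - E (o i))
        (S := T (i + 1 + 1) + c (i + 1)) (by simp [g10]) (by simp [g12]) (by simp [g13])
        (by simp [hg]) (by unfold Approx at hdi; omega) hGB (by omega) (by omega)
        (by simpa using hap3)).conseq ?_
      rintro s4 t4 fr4 ⟨r1, r2, r3, r4⟩
      have k23 : s4.reg 23 = (i + 1 : ℕ) := by
        rw [fr4.1 23 rfl]
        simp only [State.setReg_reg, Nat.reduceEqDiff, if_false, g23]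
      simp only [State.setReg_reg, reduceIte, Nat.reduceEqDiff] at r2 r3 r4
      refine ⟨_, ⟨i + 1, by omega, k23, ?_, ?_, rfl⟩, ?_⟩
      -- This is the Horner recursion: a tail is the next tail plus one coefficient, multiplied by
      -- the power of `2` for the gap.
      · convert r1 using 1
        have e : Ico (i + 1) q = insert (i + 1) (Ico (i + 1 + 1) q) := by
          rw [← Finset.insert_Ico_add_one_left_eq_Ico (by omega)]
        simp only [hT]
        rw [e, sum_insert (by simp), add_mul, sum_mul, add_comm]
        congr 1
        refine sum_congr rfl fun j hj => ?_
        rw [mem_Ico] at hj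
        have := hmono (i + 1) j (by omega) hj.2
        rw [mul_assoc, ← pow_add]
        congr 2
        simp only [Nat.add_sub_cancel]
        omega
      · clear * - r3 n1 hbd hiq
        omega
      · clear * - r2 r3 r4 n1 n2 hbd ht2' ht3' hiq
        generalize (s4.reg 22).natAbs = x4 at *
        generalize (s3.reg 22).natAbs = x3 at *
        generalize (s'.reg 22).natAbs = x at *
        omega
    · obtain rfl : i = 0 := by omega
      refine ⟨_, ⟨0, by omega, by simp, ?_, ?_, rfl⟩, ?_⟩
      · convert hap3 using 1
        have e : Ico 0 q = insert 0 (Ico (0 + 1) q) := by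
          rw [← Finset.insert_Ico_add_one_left_eq_Ico (by omega)]
        simp only [hT]
        rw [e, sum_insert (by simp), add_comm]
        simp
      · clear * - n1 hbd hiq
        omega
      · clear * - n1 n2 hbd ht2' ht3' hiq
        generalize (s3.reg 22).natAbs = x3 at *
        generalize (s'.reg 22).natAbs = x at *
        omega
  · rintro N' s' t fr ⟨i, hiq, h23, hap, hbd, rfl⟩ hb ht
    have e10 : s'.reg 10 = 0 := by rw [fr.1 10 rfl]; simp [h10]
    simp only [Test.holds_lt, e10, h23, Nat.cast_pos] at hb
    obtain rfl : i = 0 := by omega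
    refine ⟨?_, by omega, by omega⟩
    have := hap.mono (K' := n + 5) (by omega)
    rw [range_eq_Ico]
    exact this

/-! ### Insertion into the sorted list of vertices -/

/-- The first `q` values of `o` list the elements of `S`, each of them once. -/
def Enumerates (q : ℕ) (o : ℕ → ℕ) (S : Finset ℕ) : Prop :=
  ∀ f : ℕ → ℤ, ∑ i ∈ range q, f (o i) = ∑ w ∈ S, f w

/-- Stating the enumeration through sums gives the reindexing of exponent sums for free; membership,
surjectivity and the length come back by testing with indicator functions and the constant `1`. -/
theorem Enumerates.mem {q : ℕ} {o : ℕ → ℕ} {S : Finset ℕ} (h : Enumerates q o S) {i : ℕ}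
    (hi : i < q) : o i ∈ S := by
  classical
  have h1 := h fun w => if w ∈ S then 0 else 1
  rw [Finset.sum_eq_zero (s := S) (fun w hw => by simp [hw]),
    Finset.sum_eq_zero_iff_of_nonneg (fun j _ => by split_ifs <;> simp)] at h1
  simpa using h1 i (mem_range.2 hi)

theorem Enumerates.exists_eq {q : ℕ} {o : ℕ → ℕ} {S : Finset ℕ} (h : Enumerates q o S) {w : ℕ}
    (hw : w ∈ S) : ∃ i < q, o i = w := by
  by_contra! hc
  have h1 := h fun x => if x = w then 1 else 0
  rw [Finset.sum_eq_zero (s := range q) (fun i hi => by simp [hc i (mem_range.1 hi)])] at h1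
  simp [hw] at h1

theorem Enumerates.card {q : ℕ} {o : ℕ → ℕ} {S : Finset ℕ} (h : Enumerates q o S) :
    q = S.card := by
  have := h fun _ => 1
  simpa using this

theorem Enumerates.inj {q : ℕ} {o : ℕ → ℕ} {S : Finset ℕ} (h : Enumerates q o S) {i j : ℕ}
    (hi : i < q) (hj : j < q) (hij : o i = o j) : i = j := by
  have h1 : Set.SurjOn o (range q) S := fun w hw => by
    obtain ⟨i, hi, rfl⟩ := h.exists_eq hw
    exact ⟨i, by simpa using hi, rfl⟩
  have := Finset.injOn_of_surjOn_of_card_le o (fun i hi => h.mem (by simpa using hi)) h1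
    (by simp [← h.card])
  exact this (by simpa using hi) (by simpa using hj) hij

theorem Enumerates.insert {q : ℕ} {o : ℕ → ℕ} {S : Finset ℕ} (h : Enumerates q o S) {v p : ℕ}
    (hv : v ∉ S) (hp : p ≤ q) :
    Enumerates (q + 1) (fun j => if j < p then o j else if j = p then v else o (j - 1))
      (insert v S) := by
  intro f
  rw [sum_insert hv, ← h f]
  obtain ⟨r, rfl⟩ := Nat.exists_eq_add_of_le hp
  rw [show p + r + 1 = p + (1 + r) by ring, sum_range_add, sum_range_add, sum_range_add]
  have e1 : ∀ x ∈ range p, f (if x < p then o x else if x = p then v else o (x - 1)) = f (o x) :=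
    fun x hx => by rw [if_pos (mem_range.1 hx)]
  rw [sum_congr rfl e1]
  have e2 : ∀ x ∈ range r, f (if p + (1 + x) < p then o (p + (1 + x)) else
      if p + (1 + x) = p then v else o (p + (1 + x) - 1)) = f (o (p + x)) := fun x _ => by
    rw [if_neg (by omega), if_neg (by omega)]
    congr 2
    omega
  rw [sum_congr rfl e2]
  simp
  ring

/-- The memory holds the elements of `S` in array `4`, sorted by the exponents `E`, and the
differences of the exponents in array `6`. -/
structure Sorted (n : ℕ) (E : ℕ → ℕ) (S : Finset ℕ) (q : ℕ) (o : ℕ → ℕ) (s : State) : Prop where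
  reg : s.reg 14 = q
  enum : Enumerates q o S
  sub : S ⊆ range (n + 1)
  list : ∀ i < q, s.arr 4 (i : ℕ) 0 = o i
  mono : ∀ i, i + 1 < q → E (o i) ≤ E (o (i + 1))
  pos : 0 < q
  zero : E (o 0) = 0
  zero' : o 0 = n
  dif : ∀ x ∈ S, ∀ y ∈ S, Approx (n + 5) (s.arr 6 x y) (E x - E y)

theorem Sorted.le {n : ℕ} {E : ℕ → ℕ} {S : Finset ℕ} {q : ℕ} {o : ℕ → ℕ} {s : State}
    (h : Sorted n E S q o s) : q ≤ n + 1 := by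
  rw [h.enum.card]
  simpa using card_le_card h.sub

/-- Registers with constant contents. -/
structure Consts (n : ℕ) (s : State) : Prop where
  h0 : s.reg 0 = n
  h10 : s.reg 10 = 0
  h11 : s.reg 11 = 1
  h12 : s.reg 12 = (4 * n + 8 : ℕ)
  h13 : s.reg 13 = -(4 * n + 8 : ℕ)

theorem Consts.of_frame {n : ℕ} {p : Prog} {s s' : State} (h : Consts n s) (fr : Frame p s s')
    (hp : (p.modReg 0 || p.modReg 10 || p.modReg 11 || p.modReg 12 || p.modReg 13) = false) :
    Consts n s' := by
  simp only [Bool.or_eq_false_iff] at hp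
  obtain ⟨⟨⟨⟨h0, h1⟩, h2⟩, h3⟩, h4⟩ := hp
  exact ⟨by rw [fr.1 _ h0, h.h0], by rw [fr.1 _ h1, h.h10], by rw [fr.1 _ h2, h.h11],
    by rw [fr.1 _ h3, h.h12], by rw [fr.1 _ h4, h.h13]⟩

/-- Compute the differences of the exponents of the vertex in register `20` and the listed ones. -/
def allDiffs : Prog :=
  .seq (.const 31 0) <| forUp 31 14 <|
    .seq (.load 21 4 31 10) <| .seq walk <| .seq (.store 6 20 21 22) <|
      .seq (.const 29 0) <| .seq (subTo 29 22 30) (.store 6 21 20 29)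

/-- Insert the vertex in register `20` into the sorted list. -/
def insertVertex : Prog :=
  .seq allDiffs <| .seq (.store 6 20 20 10) <| .seq (.copy 31 14) <| .seq (.copy 32 31) <|
    .seq (.dec 32) <| .seq (.load 21 4 32 10) <| .seq (.load 22 6 20 21) <|
      .seq
        (.loop (.lt 22 10) <|
          .seq (.store 4 31 10 21) <| .seq (.dec 31) <| .seq (.dec 32) <|
            .seq (.load 21 4 32 10) (.load 22 6 20 21)) <|
        .seq (.store 4 31 10 20) (.inc 14)

/-- The successors that matter are in the list, so both exponents are sums over `S` and their
difference is the sum that `walk` evaluates, with unit `2 ^ E (o 0) = 1`. New entries have `v` as an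
index, whereas `walk` reads only entries between members of `S`; hence writing does not disturb
later rounds. -/
theorem run_allDiffs {s : State} {n q v : ℕ} {A : ℕ → ℕ → ℤ} {o E : ℕ → ℕ} {S : Finset ℕ}
    (hc : Consts n s) (hs : Sorted n E S q o s) (h20 : s.reg 20 = v)
    (hA : ∀ i j : ℕ, s.arr 0 i j = A i j) (hA1 : ∀ i j, (A i j).natAbs ≤ 1) (hv : v ∉ S)
    (hE : ∀ u ∈ insert v S, (E u : ℤ) = ∑ w ∈ S, A u w * 2 ^ E w) :
    Run allDiffs s fun s' t => (∀ x ∈ S, ∀ y ∈ S, s'.arr 6 x y = s.arr 6 x y) ∧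
      (∀ x ∈ S, Approx (n + 5) (s'.arr 6 v x) (E v - E x) ∧
        Approx (n + 5) (s'.arr 6 x v) (E x - E v)) ∧ t ≤ 500 * (n + 1) ^ 2 := by
  have hq := hs.le
  simp only [allDiffs, run_seq, run_const]
  refine Run.forUp (fun i s' => (∀ x ∈ S, ∀ y ∈ S, s'.arr 6 x y = s.arr 6 x y) ∧
      ∀ j < i, Approx (n + 5) (s'.arr 6 v (o j)) (E v - E (o j)) ∧
        Approx (n + 5) (s'.arr 6 (o j) v) (E (o j) - E v))
    0 q (320 * (n + 1) + 30 * n + 70) (by simp) (by simp [hs.reg]) (by omega) rfl rfl rfl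
    (by simp) ?_ ?_
  · rintro i s' fr - hi h31 h14 ⟨h1, h2⟩
    have hc' : Consts n s' := by
      refine Consts.of_frame (s := s.setReg 31 0) ?_ fr rfl
      constructor <;> simp [hc.h0, hc.h10, hc.h11, hc.h12, hc.h13]
    have e20 : s'.reg 20 = v := by rw [fr.1 20 rfl]; simp [h20]
    have a0 : s'.arr 0 = s.arr 0 := by rw [fr.2 0 rfl]; simp
    have a4 : s'.arr 4 = s.arr 4 := by rw [fr.2 4 rfl]; simp
    simp only [run_seq, run_load, hc'.h10, h31, a4, hs.list i hi]
    refine (run_walk (n := n) (q := q) (u := o i) (v := v) (A := A) (o := o) (E := E)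
      (by simp [hc'.h10]) (by simp [hc'.h12]) (by simp [hc'.h13])
      (by simp [h14]) (by simp [e20]) (by simp) hs.le (by simpa [a0] using hA) hA1
      (by simpa [a4] using hs.list) hs.mono ?_).conseq ?_
    · intro j hj
      rw [State.setReg_arr, h1 _ (hs.enum.mem hj) _ (hs.enum.mem (by omega))]
      exact hs.dif _ (hs.enum.mem hj) _ (hs.enum.mem (by omega))
    · rintro s2 t2 fr2 ⟨r1, r2, r3⟩
      have f10 : s2.reg 10 = 0 := by rw [fr2.1 10 rfl]; simp [hc'.h10]
      have f20 : s2.reg 20 = v := by rw [fr2.1 20 rfl]; simp [e20]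
      have f21 : s2.reg 21 = o i := by rw [fr2.1 21 rfl]; simp
      have b6 : s2.arr 6 = s'.arr 6 := by rw [fr2.2 6 rfl]; simp
      have hval : Approx (n + 5) (s2.reg 22) (E v - E (o i)) := by
        convert r1 using 1
        rw [hE v (by simp), hE (o i) (by simp [hs.enum.mem hi]), ← hs.enum, ← hs.enum,
          ← sum_sub_distrib]
        refine sum_congr rfl fun j _ => ?_
        rw [hs.zero, Nat.sub_zero]
        ring
      simp only [run_store, run_const, f20, f21]
      refine (run_subTo (by simp [f10]) (by norm_num) (by norm_num) (by norm_num)).conseq ?_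
      rintro s3 t3 fr3 ⟨h29, ht3⟩
      have g20 : s3.reg 20 = v := by rw [fr3.1 20 rfl]; simp [f20]
      have g21 : s3.reg 21 = o i := by rw [fr3.1 21 rfl]; simp [f21]
      have c6 : s3.arr 6 = (s2.setArr 6 v (o i) (s2.reg 22)).arr 6 := by rw [fr3.2 6 rfl]; simp
      simp at h29 ht3
      have hmem := hs.enum.mem hi
      have hov : o i ≠ v := fun h => hv (h ▸ hmem)
      simp only [g20, g21, State.setReg_arr, State.setArr_arr, c6, b6, h29, Nat.cast_inj]
      refine ⟨⟨fun x hx y hy => ?_, fun j hj => ⟨?_, ?_⟩⟩, by omega⟩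
      · have hxv : x ≠ v := fun h => hv (h ▸ hx)
        have hyv : y ≠ v := fun h => hv (h ▸ hy)
        simp [hxv, hyv, h1 x hx y hy]
      · by_cases hj' : o j = o i
        · simp [hov.symm, hj', hval]
        · simp [hov.symm, hj', (h2 j (by
            rcases Nat.lt_succ_iff_lt_or_eq.1 hj with h | h
            · exact h
            · exact absurd (by rw [h]) hj')).1]
      · by_cases hj' : o j = o i
        · have := hval.neg
          rw [neg_sub] at this
          simp [hj', this]
        · have hjq : j < i := by
            rcases Nat.lt_succ_iff_lt_or_eq.1 hj with h | h
            · exact h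
            · exact absurd (by rw [h]) hj'
          have hojv : o j ≠ v := fun h => hv (h ▸ hs.enum.mem (hjq.trans hi))
          simp [hj', hojv, (h2 j hjq).2]
  · rintro s' t fr h31 ⟨h1, h2⟩ ht
    refine ⟨h1, fun x hx => ?_, ?_⟩
    · obtain ⟨i, hi, rfl⟩ := hs.enum.exists_eq hx
      exact h2 i hi
    · have : (q - 0) * (320 * (n + 1) + 30 * n + 70 + 2) ≤
          (n + 1) * (320 * (n + 1) + 30 * n + 70 + 2) := Nat.mul_le_mul (by omega) le_rfl
      nlinarith

/-- This is one step of insertion sort. Comparisons are correct although the differences are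
saturated, since saturation at a positive threshold preserves the sign. -/
theorem run_insertVertex {s : State} {n q v : ℕ} {A : ℕ → ℕ → ℤ} {o E : ℕ → ℕ} {S : Finset ℕ}
    (hc : Consts n s) (hs : Sorted n E S q o s) (h20 : s.reg 20 = v) (hvn : v < n)
    (hA : ∀ i j : ℕ, s.arr 0 i j = A i j) (hA1 : ∀ i j, (A i j).natAbs ≤ 1) (hv : v ∉ S)
    (hE : ∀ u ∈ insert v S, (E u : ℤ) = ∑ w ∈ S, A u w * 2 ^ E w) :
    Run insertVertex s fun s' t => (∃ o', Sorted n E (insert v S) (q + 1) o' s') ∧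
      t ≤ 520 * (n + 1) ^ 2 := by
  have hq := hs.le
  simp only [insertVertex, run_seq]
  refine (run_allDiffs hc hs h20 hA hA1 hv hE).conseq ?_
  rintro s1 t1 fr ⟨r1, r2, ht1⟩
  have hc1 : Consts n s1 := hc.of_frame fr rfl
  have e14 : s1.reg 14 = q := by rw [fr.1 14 rfl, hs.reg]
  have e20 : s1.reg 20 = v := by rw [fr.1 20 rfl, h20]
  have a4 : s1.arr 4 = s.arr 4 := by rw [fr.2 4 rfl]
  have hp := hs.pos
  obtain ⟨p, rfl⟩ : ∃ p, q = p + 1 := ⟨q - 1, by omega⟩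
  have hp1 : s1.reg 14 - 1 = (p : ℤ) := by rw [e14]; simp
  simp only [run_store, run_copy, run_dec, run_load, State.setReg_reg, State.setArr_reg,
    State.setReg_arr, e20, hc1.h10, reduceIte, Nat.reduceEqDiff, hp1]
  rw [State.setArr_arr_of_ne _ (by norm_num), a4, hs.list p (by omega)]
  set d := (s1.setArr 6 v v 0).arr 6 with hd
  have hdv : ∀ i < p + 1, d v (o i) = s1.arr 6 v (o i) := by
    intro i hi
    have : o i ≠ v := fun h => hv (h ▸ hs.enum.mem hi)
    rw [hd, State.setArr_arr]
    simp [this]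
  have hdv2 : ∀ i < p + 1, Approx (n + 5) (d v (o i)) (E v - E (o i)) := fun i hi => by
    rw [hdv i hi]; exact (r2 _ (hs.enum.mem hi)).1
  -- Cell `i + 1` is the hole; the entries above it have been moved up by one place and have
  -- exponents larger than `E v`.
  refine Run.loop (fun N s' => ∃ i ≤ p, s'.reg 31 = (i + 1 : ℕ) ∧ s'.reg 32 = i ∧
      s'.reg 21 = o i ∧ s'.reg 22 = d v (o i) ∧ N = 10 * i ∧
      (∀ j < i + 1, s'.arr 4 (j : ℕ) 0 = o j) ∧
      (∀ j, i + 1 < j → j ≤ p + 1 → s'.arr 4 (j : ℕ) 0 = o (j - 1)) ∧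
      ∀ j, i < j → j < p + 1 → E v < E (o j))
    (10 * p) ?_ ?_ ?_
  · refine ⟨p, le_rfl, by simp [e14], by simp, by simp, by simp, rfl, fun j hj => ?_, by omega,
      by omega⟩
    simp [a4, hs.list j hj]
  · rintro N s' fr' ⟨i, hip, h31, h32, h21, h22, rfl, l1, l2, l3⟩ hb
    have g10 : s'.reg 10 = 0 := by rw [fr'.1 10 rfl]; simp [hc1.h10]
    have g20 : s'.reg 20 = v := by rw [fr'.1 20 rfl]; simp [e20]
    have c6 : s'.arr 6 = d := by rw [fr'.2 6 rfl]; simp [hd]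
    rw [Test.holds_lt, h22, g10] at hb
    have hlt : E v < E (o i) := by
      have := hdv2 i (by omega)
      unfold Approx at this
      omega
    -- The bottom entry has exponent `0` and acts as a sentinel.
    have hi0 : i ≠ 0 := by
      rintro rfl
      rw [hs.zero] at hlt
      omega
    obtain ⟨i, rfl⟩ : ∃ p, i = p + 1 := ⟨i - 1, by omega⟩
    have e1 : ((i + 1 + 1 : ℕ) : ℤ) - 1 = (i + 1 : ℕ) := by simp
    have e2 : ((i + 1 : ℕ) : ℤ) - 1 = (i : ℕ) := by simp
    simp only [run_seq, run_store, run_dec, run_load, State.setReg_reg, State.setArr_reg,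
      State.setReg_arr, h31, h32, g10, h21, g20, reduceIte, Nat.reduceEqDiff, e1, e2,
      State.setArr_arr_of_ne _ (show (6 : ℕ) ≠ 4 by norm_num), c6]
    have hl : (s'.setArr 4 ((i + 1 + 1 : ℕ) : ℤ) 0 (o (i + 1))).arr 4 i 0 = o i := by
      rw [State.setArr_arr, if_neg (by omega), l1 i (by omega)]
    rw [hl]
    refine ⟨_, ⟨i, by omega, rfl, rfl, rfl, rfl, rfl, fun j hj => ?_, fun j hj hj2 => ?_,
      fun j hj hj2 => ?_⟩, by omega⟩
    · rw [State.setArr_arr, if_neg (by omega), l1 j (by omega)]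
    · rw [State.setArr_arr]
      rcases Nat.lt_or_ge (i + 1 + 1) j with h | h
      · rw [if_neg (by omega), l2 j h hj2]
      · obtain rfl : j = i + 1 + 1 := by omega
        simp
    · rcases Nat.lt_or_ge (i + 1) j with h | h
      · exact l3 j h hj2
      · obtain rfl : j = i + 1 := by omega
        exact hlt
  · rintro N s' t fr' ⟨i, hip, h31, h32, h21, h22, rfl, l1, l2, l3⟩ hb ht
    have g10 : s'.reg 10 = 0 := by rw [fr'.1 10 rfl]; simp [hc1.h10]
    have g20 : s'.reg 20 = v := by rw [fr'.1 20 rfl]; simp [e20]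
    have g14 : s'.reg 14 = (p + 1 : ℕ) := by rw [fr'.1 14 rfl]; simp [e14]
    have c6 : s'.arr 6 = d := by rw [fr'.2 6 rfl]; simp [hd]
    rw [Test.holds_lt, h22, g10] at hb
    have hle : E (o i) ≤ E v := by
      have := hdv2 i (by omega)
      unfold Approx at this
      omega
    simp only [run_inc, h31, g10, g20, State.setArr_reg, g14]
    have hsq : n + 1 ≤ (n + 1) ^ 2 := Nat.le_self_pow (by norm_num) _
    refine ⟨⟨_, ⟨by simp, hs.enum.insert (p := i + 1) hv (by omega), ?_, fun j hj => ?_,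
      fun j hj => ?_, by omega, ?_, ?_, fun x hx y hy => ?_⟩⟩, by
      clear * - hsq ht ht1 hip hq
      generalize (n + 1) ^ 2 = m at *
      omega⟩
    · intro x hx
      rcases mem_insert.1 hx with rfl | h
      · simp; omega
      · exact hs.sub h
    · rw [State.setReg_arr, State.setArr_arr]
      rcases lt_trichotomy j (i + 1) with h | h | h
      · rw [if_neg (by omega), if_pos h, l1 j h]
      · simp [h]
      · rw [if_neg (by omega), if_neg (by omega), if_neg (by omega), l2 j h (by omega)]
    · rcases lt_trichotomy (j + 1) (i + 1) with h | h | h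
      · rw [if_pos (by omega), if_pos h]
        exact hs.mono j (by omega)
      · obtain rfl : j = i := by omega
        simpa using hle
      · rw [if_neg (by omega : ¬ j + 1 < i + 1), if_neg (by omega : ¬ j + 1 = i + 1),
          if_neg (by omega : ¬ j < i + 1)]
        by_cases hj2 : j = i + 1
        · rw [if_pos hj2]
          exact (l3 _ (by omega) (by omega)).le
        · rw [if_neg hj2]
          have := hs.mono (j - 1) (by omega)
          rwa [show j - 1 + 1 = j by omega] at this
    · simpa using hs.zero
    · simpa using hs.zero'
    · rw [State.setReg_arr, State.setArr_arr_of_ne _ (by norm_num), c6]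
      rcases mem_insert.1 hx with hxv | hxS <;> rcases mem_insert.1 hy with hyv | hyS
      · subst hxv; subst hyv
        rw [hd, State.setArr_arr]
        simp [Approx]
      · have : y ≠ v := fun h => hv (h ▸ hyS)
        rw [hd, State.setArr_arr, if_neg (by omega), hxv]
        exact (r2 y hyS).1
      · have : x ≠ v := fun h => hv (h ▸ hxS)
        rw [hd, State.setArr_arr, if_neg (by omega), hyv]
        exact (r2 x hxS).2
      · have : y ≠ v := fun h => hv (h ▸ hyS)
        rw [hd, State.setArr_arr, if_neg (by omega), r1 x hxS y hyS]
        exact hs.dif x hxS y hyS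

/-! ### Circuits as integer matrices, and sorting in topological order -/

open Classical in
/-- The value of a vertex in terms of the exponents `E` of the non-zero vertices. -/
noncomputable def val (nd : ℕ → Prop) (E : ℕ → ℕ) (w : ℕ) : ℤ := if nd w then 2 ^ E w else 0

/-- `A` is the matrix of edge labels of a circuit with vertices `0, …, n - 1`, extended by a
vertex `n` of value `1`; `nd v` says that `v` has a non-zero value, and this value is `2 ^ E v`. -/
structure Circ (n : ℕ) (A : ℕ → ℕ → ℤ) (nd : ℕ → Prop) (E : ℕ → ℕ) : Prop where
  abs : ∀ i j, (A i j).natAbs ≤ 1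
  supp : ∀ i j, A i j ≠ 0 → i < n ∧ j < n
  nd_iff : ∀ v < n, nd v ↔ ∃ w < n, A v w ≠ 0
  nd_last : nd n
  E_last : E n = 0
  exp : ∀ v < n, nd v → (E v : ℤ) = ∑ w ∈ range n, A v w * val nd E w
  wf : ∃ ρ : ℕ → ℕ, ∀ v w, A v w ≠ 0 → ρ w < ρ v

/-- All successors of `v` are in `D`, but `v` is not. -/
def Ready (A : ℕ → ℕ → ℤ) (D : Finset ℕ) (v : ℕ) : Prop := v ∉ D ∧ ∀ w, A v w ≠ 0 → w ∈ D

/-- Register `20` gets a vertex that is not done, but all of whose successors are. -/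
def findReady : Prog :=
  .seq (.const 40 0) <| forUp 40 0 <|
    .seq (.load 41 7 40 10) <| .seq (.const 42 0) <|
      .seq
        (forUp 42 0 <|
          .seq (.load 43 0 40 42) <|
            .branch (.eq 43 10) .skip <|
              .seq (.load 44 7 42 10) (.branch (.eq 44 10) (.const 41 1) .skip)) <|
        .branch (.eq 41 10) (.copy 20 40) .skip

/-- Register `41` gets `1` if the vertex in register `20` has a successor, and `0` otherwise. -/
def testLeaf : Prog :=
  .seq (.const 41 0) <| .seq (.const 42 0) <| forUp 42 0 <|
    .seq (.load 43 0 20 42) (.branch (.eq 43 10) .skip (.const 41 1))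

/-- Sort the vertices by their exponents. -/
def sortVertices : Prog :=
  .seq (.store 4 10 10 0) <| .seq (.const 14 1) <| .seq (.store 6 0 0 10) <| .seq (.const 45 0) <|
    forUp 45 0 <|
      .seq findReady <| .seq testLeaf <|
        .seq (.branch (.eq 41 10) .skip insertVertex) (.store 7 20 10 11)

/-- Register `41` begins as the "done" flag of the candidate and is set to `1` at any unfinished
successor, so it ends as `0` exactly for a ready vertex. Scanning the matrix is quadratic, which is
affordable once per vertex. -/
theorem run_findReady {s : State} {n : ℕ} {A : ℕ → ℕ → ℤ} {nd : ℕ → Prop} {E : ℕ → ℕ}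
    {D : Finset ℕ} (hc : Consts n s) (hA : ∀ i j : ℕ, s.arr 0 i j = A i j) (hC : Circ n A nd E)
    (hD : ∀ w < n, s.arr 7 (w : ℕ) 0 = if w ∈ D then 1 else 0) (hDn : D.card < n) :
    Run findReady s fun s' t => (∃ v < n, Ready A D v ∧ s'.reg 20 = v) ∧
      t ≤ 20 * (n + 1) ^ 2 := by
  simp only [findReady, run_seq, run_const]
  refine Run.forUp (fun i s' => (∃ v < i, Ready A D v) → ∃ v < n, Ready A D v ∧ s'.reg 20 = v)
    0 n (8 * n + 8) (by simp) (by simp [hc.h0]) (by omega) rfl rfl rfl (by simp) ?_ ?_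
  · rintro i s' fr - hi h40 h0 hI
    have hc' : Consts n s' := by
      refine Consts.of_frame (s := s.setReg 40 0) ?_ fr rfl
      constructor <;> simp [hc.h0, hc.h10, hc.h11, hc.h12, hc.h13]
    have a0 : s'.arr 0 = s.arr 0 := by rw [fr.2 0 rfl]; simp
    have a7 : s'.arr 7 = s.arr 7 := by rw [fr.2 7 rfl]; simp
    simp only [run_seq, run_load, run_const, hc'.h10, h40, a7, hD i hi]
    refine Run.forUp (fun w s2 => (s2.reg 41 = 0 ↔ i ∉ D ∧ ∀ w' < w, A i w' ≠ 0 → w' ∈ D))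
      0 n 5 (by simp) (by simp [hc'.h0]) (by omega) rfl rfl rfl ?_ ?_ ?_
    · simp
    · rintro w s2 fr2 - hw h42 h0' hiff
      have f10 : s2.reg 10 = 0 := by rw [fr2.1 10 rfl]; simp [hc'.h10]
      have f40 : s2.reg 40 = i := by rw [fr2.1 40 rfl]; simp [h40]
      have b0 : s2.arr 0 = s.arr 0 := by rw [fr2.2 0 rfl]; simp [a0]
      have b7 : s2.arr 7 = s.arr 7 := by rw [fr2.2 7 rfl]; simp [a7]
      have key : (∀ w' < w + 1, A i w' ≠ 0 → w' ∈ D) ↔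
          (∀ w' < w, A i w' ≠ 0 → w' ∈ D) ∧ (A i w ≠ 0 → w ∈ D) := by
        constructor
        · exact fun h => ⟨fun w' hw' => h w' (by omega), h w (by omega)⟩
        · rintro ⟨h1, h2⟩ w' hw'
          rcases Nat.lt_succ_iff_lt_or_eq.1 hw' with h | rfl
          · exact h1 w' h
          · exact h2
      simp only [run_seq, run_load, run_branch, Test.holds_eq, State.setReg_reg, State.setReg_arr,
        f10, h42, f40, b0, b7, hA, run_skip, run_const, reduceIte, Nat.reduceEqDiff, hD w hw, key]
      by_cases h1 : A i w = 0 <;> by_cases h2 : w ∈ D <;> simp [h1, h2, hiff]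
    · rintro s2 t2 fr2 h42 hiff ht
      have f10 : s2.reg 10 = 0 := by rw [fr2.1 10 rfl]; simp [hc'.h10]
      have f40 : s2.reg 40 = i := by rw [fr2.1 40 rfl]; simp [h40]
      have f20 : s2.reg 20 = s'.reg 20 := by rw [fr2.1 20 rfl]; simp
      have hr : s2.reg 41 = 0 ↔ Ready A D i :=
        hiff.trans (and_congr_right fun _ => ⟨fun h w hw => h w (hC.supp _ _ hw).2 hw,
          fun h w _ => h w⟩)
      simp only [run_branch, Test.holds_eq, run_copy, run_skip, f10, f40, State.setReg_reg, hr,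
        reduceIte, Nat.reduceEqDiff, f20]
      refine ⟨fun h => ⟨fun _ => ⟨i, hi, h, rfl⟩, by omega⟩, fun h => ⟨?_, by omega⟩⟩
      rintro ⟨v, hv, hrv⟩
      rcases Nat.lt_succ_iff_lt_or_eq.1 hv with h' | rfl
      · exact hI ⟨v, h', hrv⟩
      · exact absurd hrv h
  · rintro s' t fr - hI ht
    refine ⟨hI ?_, ?_⟩
    -- An unfinished vertex of minimal rank is ready, as its successors have smaller rank.
    · obtain ⟨ρ, hρ⟩ := hC.wf
      have hne : (range n \ D).Nonempty := by
        rw [sdiff_nonempty]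
        intro h
        have := card_le_card h
        rw [card_range] at this
        omega
      obtain ⟨v, hv, hmin⟩ := exists_min_image _ ρ hne
      rw [mem_sdiff, mem_range] at hv
      refine ⟨v, hv.1, hv.2, fun w hw => ?_⟩
      by_contra hwD
      have := hmin w (by simp [hwD, (hC.supp _ _ hw).2])
      have := hρ _ _ hw
      omega
    · have e : (n - 0) * (8 * n + 8 + 2) + 1 ≤ 18 * (n + 1) ^ 2 := by
        rw [Nat.sub_zero]; nlinarith
      nlinarith

theorem run_testLeaf {s : State} {n v : ℕ} {A : ℕ → ℕ → ℤ} (hc : Consts n s)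
    (hA : ∀ i j : ℕ, s.arr 0 i j = A i j) (hv : s.reg 20 = v) :
    Run testLeaf s fun s' t => (s'.reg 41 = 0 ↔ ¬ ∃ w < n, A v w ≠ 0) ∧ t ≤ 6 * n + 3 := by
  simp only [testLeaf, run_seq, run_const]
  refine Run.forUp (fun i s' => (s'.reg 41 = 0 ↔ ¬ ∃ w < i, A v w ≠ 0)) 0 n 3 (by simp)
    (by simp [hc.h0]) (by omega) rfl rfl rfl (by simp) ?_ ?_
  · rintro i s' fr - hi h42 h0 hI
    have f10 : s'.reg 10 = 0 := by rw [fr.1 10 rfl]; simp [hc.h10]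
    have f20 : s'.reg 20 = v := by rw [fr.1 20 rfl]; simp [hv]
    have b0 : s'.arr 0 = s.arr 0 := by rw [fr.2 0 rfl]; simp
    have key : (∃ w < i + 1, A v w ≠ 0) ↔ (∃ w < i, A v w ≠ 0) ∨ A v i ≠ 0 := by
      constructor
      · rintro ⟨w, h1, h2⟩
        rcases Nat.lt_succ_iff_lt_or_eq.1 h1 with h | rfl
        · exact .inl ⟨w, h, h2⟩
        · exact .inr h2
      · rintro (⟨w, h1, h2⟩ | h)
        · exact ⟨w, by omega, h2⟩
        · exact ⟨i, by omega, h⟩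
    simp only [run_seq, run_load, run_branch, Test.holds_eq, State.setReg_reg, f10, f20, h42,
      b0, hA, run_skip, run_const, reduceIte, Nat.reduceEqDiff, key]
    by_cases h1 : A v i = 0 <;> simp [h1]
    simpa using hI
  · rintro s' t fr - hI ht
    exact ⟨hI, by omega⟩

open Classical in
/-- The vertices in `D` with a non-zero value, and the additional vertex `n`. -/
noncomputable def nodes (n : ℕ) (nd : ℕ → Prop) (D : Finset ℕ) : Finset ℕ := insert n (D.filter nd)

/-- Leaves contribute `0` and no edge goes to the artificial vertex `n`, so an exponent sum over all
vertices may be taken over the listed ones, each with a genuine power of `2`. -/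
theorem Circ.sum_eq {n : ℕ} {A : ℕ → ℕ → ℤ} {nd : ℕ → Prop} {E : ℕ → ℕ} (hC : Circ n A nd E)
    {D : Finset ℕ} (hD : D ⊆ range n) {u : ℕ} (hu : ∀ w, A u w ≠ 0 → w ∈ D) :
    ∑ w ∈ range n, A u w * val nd E w = ∑ w ∈ nodes n nd D, A u w * 2 ^ E w := by
  classical
  have h0 : A u n = 0 := by
    by_contra h
    exact absurd (hC.supp _ _ h).2 (lt_irrefl _)
  have hn : n ∉ D.filter nd := fun h => by simpa using hD (mem_filter.1 h).1
  rw [nodes, sum_insert hn, h0, zero_mul, zero_add]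
  have : ∀ w ∈ D.filter nd, A u w * 2 ^ E w = A u w * val nd E w := fun w hw => by
    rw [val, if_pos (mem_filter.1 hw).2]
  rw [sum_congr rfl this]
  symm
  refine sum_subset ((filter_subset _ _).trans hD) fun w _ hw => ?_
  by_cases h : A u w = 0
  · rw [h, zero_mul]
  · have : ¬ nd w := fun hn => hw (mem_filter.2 ⟨hu w h, hn⟩)
    rw [val, if_neg this, mul_zero]

/-- Each of the `n` rounds completes one vertex in quadratic time. The set `D` of completed vertices
is closed under successors, which makes the exponents of listed vertices expressible through the
list. -/
theorem run_sortVertices {s : State} {n : ℕ} {A : ℕ → ℕ → ℤ} {nd : ℕ → Prop} {E : ℕ → ℕ}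
    (hc : Consts n s) (hA : ∀ i j : ℕ, s.arr 0 i j = A i j) (hC : Circ n A nd E)
    (h7 : ∀ i : ℕ, s.arr 7 i 0 = 0) :
    Run sortVertices s fun s' t =>
      (∃ q o, Sorted n E (nodes n nd (range n)) q o s') ∧ t ≤ 600 * (n + 1) ^ 3 := by
  classical
  simp only [sortVertices, run_seq, run_const, run_store]
  refine Run.forUp (fun r s' => ∃ D ⊆ range n, D.card = r ∧
      (∀ w < n, s'.arr 7 (w : ℕ) 0 = if w ∈ D then 1 else 0) ∧
      (∀ v ∈ D, ∀ w, A v w ≠ 0 → w ∈ D) ∧ ∃ q o, Sorted n E (nodes n nd D) q o s')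
    0 n (570 * (n + 1) ^ 2) (by simp) (by simp [hc.h0]) (by omega) rfl rfl rfl ?_ ?_ ?_
  · refine ⟨∅, by simp, rfl, fun w _ => ?_, by simp, 1, fun _ => n, ?_⟩
    · simpa [State.setArr] using h7 w
    · refine ⟨by simp, fun f => by simp [nodes], by simp [nodes], fun i hi => ?_, fun i hi => ?_,
        by omega, hC.E_last, rfl, ?_⟩
      · obtain rfl : i = 0 := by omega
        simp [State.setArr, hc.h10, hc.h0]
      · omega
      · simp [nodes, State.setArr, hc.h10, hc.h0, Approx]
  · rintro r s1 fr - hr h45 h0 ⟨D, hDn, hDr, hD7, hDc, q, o, hs⟩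
    have hc1 : Consts n s1 := by
      refine Consts.of_frame (s := (((s.setArr 4 (s.reg 10) (s.reg 10) (s.reg 0)).setReg 14 1).setArr
        6 (s.reg 0) (s.reg 0) (s.reg 10)).setReg 45 0) ?_ fr rfl
      constructor <;> simp [hc.h0, hc.h10, hc.h11, hc.h12, hc.h13]
    have a0 : s1.arr 0 = s.arr 0 := by rw [fr.2 0 rfl]; simp
    simp only [run_seq]
    refine (run_findReady hc1 (by simpa [a0] using hA) hC hD7 (by omega)).conseq ?_
    rintro s2 t2 fr2 ⟨⟨v, hv, ⟨hvD, hvr⟩, h20⟩, ht2⟩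
    have hc2 := hc1.of_frame fr2 rfl
    have b0 : s2.arr 0 = s.arr 0 := by rw [fr2.2 0 rfl, a0]
    refine (run_testLeaf hc2 (by simpa [b0] using hA) h20).conseq ?_
    rintro s3 t3 fr3 ⟨h41, ht3⟩
    have hc3 := hc2.of_frame fr3 rfl
    have c0 : s3.arr 0 = s.arr 0 := by rw [fr3.2 0 rfl, b0]
    have c4 : s3.arr 4 = s1.arr 4 := by rw [fr3.2 4 rfl, fr2.2 4 rfl]
    have c6 : s3.arr 6 = s1.arr 6 := by rw [fr3.2 6 rfl, fr2.2 6 rfl]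
    have c7 : s3.arr 7 = s1.arr 7 := by rw [fr3.2 7 rfl, fr2.2 7 rfl]
    have g14 : s3.reg 14 = s1.reg 14 := by rw [fr3.1 14 rfl, fr2.1 14 rfl]
    have g20 : s3.reg 20 = v := by rw [fr3.1 20 rfl, h20]
    have hs3 : Sorted n E (nodes n nd D) q o s3 := ⟨by rw [g14, hs.reg], hs.enum, hs.sub,
      by rw [c4]; exact hs.list, hs.mono, hs.pos, hs.zero, hs.zero', by rw [c6]; exact hs.dif⟩
    have h41' : s3.reg 41 = 0 ↔ ¬ nd v := h41.trans (not_congr (hC.nd_iff v hv).symm)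
    have hsub : insert v D ⊆ range n := insert_subset (mem_range.2 hv) hDn
    have hcl : ∀ u ∈ insert v D, ∀ w, A u w ≠ 0 → w ∈ D := fun u hu => by
      rcases mem_insert.1 hu with rfl | h
      · exact hvr
      · exact hDc u h
    have fin : ∀ (s4 : State) (t4 : ℕ), Consts n s4 → s4.reg 20 = v → s4.arr 7 = s1.arr 7 →
        (∃ q o, Sorted n E (nodes n nd (insert v D)) q o s4) → t4 ≤ 521 * (n + 1) ^ 2 →
        Run (.store 7 20 10 11) s4 fun s'' t' => (∃ D ⊆ range n, D.card = r + 1 ∧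
          (∀ w < n, (s''.setReg 45 ((r + 1 : ℕ) : ℤ)).arr 7 (w : ℕ) 0 = if w ∈ D then 1 else 0) ∧
          (∀ v ∈ D, ∀ w, A v w ≠ 0 → w ∈ D) ∧
          ∃ q o, Sorted n E (nodes n nd D) q o (s''.setReg 45 ((r + 1 : ℕ) : ℤ))) ∧
          t2 + (t3 + (t4 + t')) ≤ 570 * (n + 1) ^ 2 := by
      rintro s4 t4 hc4 k20 k7 ⟨q', o', hs4⟩ ht4
      rw [run_store, k20, hc4.h10, hc4.h11]
      refine ⟨⟨insert v D, hsub, by rw [card_insert_of_notMem hvD, hDr], fun w hw => ?_,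
        fun u hu w hw => mem_insert_of_mem (hcl u hu w hw), q', o', ?_⟩, ?_⟩
      · rw [State.setReg_arr, State.setArr_arr, k7, hD7 w hw]
        by_cases hwv : w = v <;> simp [hwv]
      · refine ⟨by simpa using hs4.reg, hs4.enum, hs4.sub, ?_, hs4.mono, hs4.pos, hs4.zero,
          hs4.zero', ?_⟩
        · simpa using hs4.list
        · simpa using hs4.dif
      · have hsq : n + 1 ≤ (n + 1) ^ 2 := Nat.le_self_pow (by norm_num) _
        clear * - hsq ht2 ht3 ht4
        generalize (n + 1) ^ 2 = m at *
        omega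
    simp only [run_branch, Test.holds_eq, hc3.h10, h41', run_skip]
    have hsq : 1 ≤ (n + 1) ^ 2 := Nat.one_le_pow _ _ (by omega)
    refine ⟨fun hnd => fin s3 _ hc3 g20 c7 ⟨q, o, ?_⟩ (by omega), fun hnd => ?_⟩
    -- A leaf has no exponent: it becomes done without entering the list.
    · have : nodes n nd (insert v D) = nodes n nd D := by
        rw [nodes, filter_insert, if_neg hnd, nodes]
      rwa [this]
    · rw [not_not] at hnd
      have hN : nodes n nd (insert v D) = insert v (nodes n nd D) := by
        rw [nodes, filter_insert, if_pos hnd, nodes, insert_comm]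
      refine (run_insertVertex hc3 hs3 g20 hv (by simpa [c0] using hA) hC.abs ?_ ?_).conseq ?_
      · simp only [nodes, mem_insert, mem_filter, not_or, not_and]
        exact ⟨by omega, fun h => absurd h hvD⟩
      · rw [← hN]
        intro u hu
        rcases mem_insert.1 hu with rfl | h
        -- The artificial vertex has an empty row, and the empty sum is its exponent `0`.
        · have hz : ∀ w, A u w = 0 := fun w => by
            by_contra h
            exact absurd (hC.supp _ _ h).1 (lt_irrefl _)
          simp [hC.E_last, hz]
        · obtain ⟨h1, h2⟩ := mem_filter.1 h
          rw [hC.exp u (mem_range.1 (hsub h1)) h2, hC.sum_eq hDn (hcl u h1)]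
      · rintro s4 t4 fr4 ⟨⟨o', hs4⟩, ht4⟩
        refine fin s4 _ (hc3.of_frame fr4 rfl) (by rw [fr4.1 20 rfl, g20]) (by rw [fr4.2 7 rfl, c7])
          ⟨q + 1, o', by rwa [hN]⟩ (by omega)
  · rintro s' t fr - ⟨D, hDn, hDr, -, -, hs⟩ ht
    have : D = range n := eq_of_subset_of_card_le hDn (by simp [hDr])
    subst this
    refine ⟨hs, ?_⟩
    have e : (n - 0) * (570 * (n + 1) ^ 2 + 2) ≤ (n + 1) * (572 * (n + 1) ^ 2) := by
      have hsq : 1 ≤ (n + 1) ^ 2 := Nat.one_le_pow _ _ (by omega)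
      exact Nat.mul_le_mul (by omega) (by omega)
    have e2 : (n + 1) * (572 * (n + 1) ^ 2) = 572 * (n + 1) ^ 3 := by ring
    have hsq : 1 ≤ (n + 1) ^ 3 := Nat.one_le_pow _ _ (by omega)
    omega

/-! ### The chain of powers of two, closed under carries -/

/-- Halve register `50`, rounding down. -/
def halve : Prog :=
  .seq (.const 51 0) <|
    .seq (.loop (.lt 11 50) (.seq (.dec 50) <| .seq (.dec 50) (.inc 51))) (.copy 50 51)

theorem run_halve {s : State} {L : ℕ} (h11 : s.reg 11 = 1) (hL : s.reg 50 = L) :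
    Run halve s fun s' t => s'.reg 50 = (L / 2 : ℕ) ∧ t ≤ 4 * L + 3 := by
  simp only [halve, run_seq, run_const]
  refine Run.loop (fun N s' => ∃ a b : ℕ, s'.reg 50 = a ∧ s'.reg 51 = b ∧ a + 2 * b = L ∧ N = 4 * a)
    (4 * L) ⟨L, 0, by simp [hL], by simp, by simp, rfl⟩ ?_ ?_
  · rintro N s' fr ⟨a, b, ha, hb, hab, rfl⟩ h
    rw [Test.holds_lt, fr.1 11 rfl, ha] at h
    simp only [run_seq, run_dec, run_inc, State.setReg_reg, reduceIte, Nat.reduceEqDiff, ha, hb]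
    simp only [State.setReg_reg, h11, Nat.reduceEqDiff, reduceIte] at h
    exact ⟨_, ⟨a - 2, b + 1, by omega, by omega, by omega, rfl⟩, by omega⟩
  · rintro N s' t fr ⟨a, b, ha, hb, hab, rfl⟩ h ht
    rw [Test.holds_lt, fr.1 11 rfl, ha] at h
    simp only [State.setReg_reg, h11, Nat.reduceEqDiff, reduceIte] at h
    simp only [run_copy, State.setReg_reg, reduceIte, hb]
    exact ⟨by omega, by omega⟩

/-- Write the data of the chain element with index in register `15` to the memory. -/
def storeElement : Prog :=
  .seq (.store 9 15 10 52) <| .seq (.store 10 15 10 53) (.store 11 15 10 54)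

/-- Append the vertex in register `24` to the chain of powers of `2`, together with all the
intermediate powers of `2` that a carry may reach. -/
def closeGap : Prog :=
  .loop (.lt 10 28) <| .seq halve <| .seq (.inc 15) <|
    .seq
      (.branch (.eq 28 11)
        (.seq (.const 54 1) <| .seq (.copy 52 24) <| .seq (.const 53 0) (.const 28 0)) <|
        .branch (.eq 50 10)
          (.seq (.const 54 0) <| .seq (.copy 52 24) <| .seq (.const 53 0) (.const 28 0))
          (.seq (.const 54 1) <| .seq (.inc 53) (.dec 28)))
      storeElement

/-- Append the powers of `2` that a carry out of the last chain element may reach. -/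
def closeEnd : Prog :=
  .loop (.lt 11 50) <| .seq halve <| .seq (.inc 15) <| .seq (.const 54 1) <| .seq (.inc 53)
    storeElement

/-- Compute the chain of powers of `2` that are values of vertices or can be reached by carries. -/
def closeChain : Prog :=
  .seq (.const 15 1) <| .seq (.copy 50 12) <| .seq (.copy 52 0) <| .seq (.const 53 0) <|
    .seq (.const 54 0) <| .seq storeElement <| .seq (.store 8 0 10 15) <| .seq (.const 31 1) <|
      .seq
        (forUp 31 14 <|
          .seq (.load 24 4 31 10) <| .seq (.copy 32 31) <| .seq (.dec 32) <|
            .seq (.load 27 4 32 10) <| .seq (.load 28 6 24 27) <| .seq closeGap <|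
              .seq (.inc 50) (.store 8 24 10 15))
        closeEnd

/-- The chain of powers of `2` under construction: there are `t` elements, the `r`-th of them is
`2 ^ F r`, and `L r` bounds the numbers that occur there in additions. The vertices `o j` with
`j < i` have been taken care of, and `pos` assigns to them their places in the chain. -/
structure Chain (n : ℕ) (E : ℕ → ℕ) (S : Finset ℕ) (o : ℕ → ℕ) (i t : ℕ) (F L pos : ℕ → ℕ)
    (s : State) : Prop where
  one_le : 1 ≤ t
  F_one : F 1 = 0
  F_lt : ∀ r, 1 ≤ r → r < t → F r < F (r + 1)
  base : ∀ r, 1 ≤ r → r ≤ t → ∃ b ∈ S, ∃ f : ℕ, s.arr 9 (r : ℕ) 0 = b ∧ s.arr 10 (r : ℕ) 0 = f ∧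
    E b + f = F r ∧ 2 ^ f * L r ≤ 10 * n + 16
  adj : ∀ r, 1 ≤ r → r < t →
    s.arr 11 ((r + 1 : ℕ) : ℤ) 0 = if F (r + 1) = F r + 1 then 1 else 0
  L_step : ∀ r, 1 ≤ r → r < t →
    (∑ j ∈ Ico 1 i, if pos (o j) = r + 1 then 1 else 0) + L r / 2 ≤ L (r + 1)
  L_one : (∑ j ∈ Ico 1 i, if pos (o j) = 1 then 1 else 0) + (4 * n + 8) ≤ L 1
  L_two : ∀ r, 1 ≤ r → r < t → 2 ≤ L r → F (r + 1) = F r + 1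
  L_pos : ∀ r, 1 ≤ r → r < t → 1 ≤ L r
  L_sum : ∑ r ∈ Icc 1 t, L r + L t ≤ 2 * (4 * n + 8 + (i - 1))
  pos_mem : ∀ j < i, 1 ≤ pos (o j) ∧ pos (o j) ≤ t ∧ F (pos (o j)) = E (o j)

section Chain

variable {n : ℕ} {E o : ℕ → ℕ} {S : Finset ℕ} {i t : ℕ} {F L pos : ℕ → ℕ} {s : State}

theorem Chain.congr {s' : State} (h : Chain n E S o i t F L pos s) (h9 : s'.arr 9 = s.arr 9)
    (h10 : s'.arr 10 = s.arr 10) (h11 : s'.arr 11 = s.arr 11) : Chain n E S o i t F L pos s' :=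
  { h with
    base := by rw [h9, h10]; exact h.base
    adj := by rw [h11]; exact h.adj }

theorem Chain.L_le (h : Chain n E S o i t F L pos s) : L t ≤ 4 * n + 8 + (i - 1) := by
  have h1 := h.L_sum
  have h2 : L t ≤ ∑ r ∈ Icc 1 t, L r :=
    single_le_sum (f := L) (fun _ _ => Nat.zero_le _) (mem_Icc.2 ⟨h.one_le, le_rfl⟩)
  omega

/-- The new place must have room for a carry from the previous one, hence `L t / 2`. The linear
bound survives because the last term counts twice in `L_sum`: the old second copy of `L t` pays for
both copies of `L t / 2`. -/
theorem Chain.extend {s' : State} (h : Chain n E S o i t F L pos s) (hL : 1 ≤ L t) {x b f : ℕ}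
    (hx : F t < x) (hb : b ∈ S) (hf : E b + f = x) (hLf : 2 ^ f * (L t / 2) ≤ 10 * n + 16)
    (hadj : 2 ≤ L t → x = F t + 1)
    (h9 : ∀ r : ℕ, s'.arr 9 r 0 = if r = t + 1 then (b : ℤ) else s.arr 9 r 0)
    (h10 : ∀ r : ℕ, s'.arr 10 r 0 = if r = t + 1 then (f : ℤ) else s.arr 10 r 0)
    (h11 : ∀ r : ℕ, s'.arr 11 r 0 =
      if r = t + 1 then (if x = F t + 1 then 1 else 0) else s.arr 11 r 0) :
    Chain n E S o i (t + 1) (Function.update F (t + 1) x) (Function.update L (t + 1) (L t / 2))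
      pos s' := by
  have ht := h.one_le
  have uF : ∀ r ≤ t, Function.update F (t + 1) x r = F r := fun r hr => by
    rw [Function.update_of_ne (by omega)]
  have uL : ∀ r ≤ t, Function.update L (t + 1) (L t / 2) r = L r := fun r hr => by
    rw [Function.update_of_ne (by omega)]
  have uF' : Function.update F (t + 1) x (t + 1) = x := Function.update_self ..
  have uL' : Function.update L (t + 1) (L t / 2) (t + 1) = L t / 2 := Function.update_self ..
  constructor
  · omega
  · rw [uF 1 ht, h.F_one]
  · intro r h1 hr
    rcases Nat.lt_succ_iff_lt_or_eq.1 hr with hr | rfl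
    · rw [uF _ hr.le, uF _ hr]; exact h.F_lt r h1 hr
    · rw [uF', uF _ le_rfl]; exact hx
  · intro r h1 hr
    rcases Nat.le_succ_iff.1 hr with hr | rfl
    · rw [h9, h10, if_neg (by omega), if_neg (by omega), uF _ hr, uL _ hr]; exact h.base r h1 hr
    · rw [h9, h10, if_pos rfl, if_pos rfl, uF', uL']; exact ⟨b, hb, f, rfl, rfl, hf, hLf⟩
  · intro r h1 hr
    rcases Nat.lt_succ_iff_lt_or_eq.1 hr with hr | rfl
    · rw [h11, if_neg (by omega), uF _ hr.le, uF _ hr]; exact h.adj r h1 hr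
    · rw [h11, if_pos rfl, uF', uF _ le_rfl]
  · intro r h1 hr
    rcases Nat.lt_succ_iff_lt_or_eq.1 hr with hr | rfl
    · rw [uL _ hr.le, uL _ hr]; exact h.L_step r h1 hr
    · rw [uL', uL _ le_rfl]
      -- No vertex handled so far can sit at the place just created.
      have : (∑ j ∈ Ico 1 i, if pos (o j) = r + 1 then 1 else 0) = 0 := by
        refine sum_eq_zero fun j hj => ?_
        have := (h.pos_mem j (mem_Ico.1 hj).2).2.1
        rw [if_neg (by omega)]
      omega
  · rw [uL 1 ht]; exact h.L_one
  · intro r h1 hr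
    rcases Nat.lt_succ_iff_lt_or_eq.1 hr with hr | rfl
    · rw [uF _ hr.le, uF _ hr, uL _ hr.le]; exact h.L_two r h1 hr
    · rw [uF', uF _ le_rfl, uL _ le_rfl]; exact hadj
  · intro r h1 hr
    rcases Nat.lt_succ_iff_lt_or_eq.1 hr with hr | rfl
    · rw [uL _ hr.le]; exact h.L_pos r h1 hr
    · rw [uL _ le_rfl]; exact hL
  · have e : ∑ r ∈ Icc 1 t, Function.update L (t + 1) (L t / 2) r = ∑ r ∈ Icc 1 t, L r :=
      sum_congr rfl fun r hr => uL r (mem_Icc.1 hr).2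
    rw [sum_Icc_succ_top (by omega), uL', e]
    have := h.L_sum
    omega
  · intro j hj
    obtain ⟨p1, p2, p3⟩ := h.pos_mem j hj
    exact ⟨p1, by omega, by rw [uF _ p2, p3]⟩

/-- A vertex at the last place can add `1` in absolute value to the coefficient there. This raises
the left side of `L_sum` by `2`, as it does the right side. The offset of that place must be `0`, so
that the invariant on `2 ^ f * L` is not endangered by the increase. -/
theorem Chain.succ {s' : State} (h : Chain n E S o i t F L pos s) (h9 : s'.arr 9 = s.arr 9)
    (h10 : s'.arr 10 = s.arr 10) (h11 : s'.arr 11 = s.arr 11) (hi : 1 ≤ i) (hin : i ≤ n)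
    (hF : F t = E (o i)) (ho : ∀ j < i, o j ≠ o i) (h0 : s.arr 10 t 0 = 0) :
    Chain n E S o (i + 1) t F (Function.update L t (L t + 1)) (Function.update pos (o i) t) s' := by
  have ht := h.one_le
  have uL : ∀ r < t, Function.update L t (L t + 1) r = L r := fun r hr => by
    rw [Function.update_of_ne (by omega)]
  have uL' : Function.update L t (L t + 1) t = L t + 1 := Function.update_self ..
  have hcount : ∀ r, (∑ j ∈ Ico 1 (i + 1), if Function.update pos (o i) t (o j) = r then 1 else 0)
      = (∑ j ∈ Ico 1 i, if pos (o j) = r then 1 else 0) + if t = r then 1 else 0 := by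
    intro r
    rw [sum_Ico_succ_top hi, Function.update_self]
    congr 1
    refine sum_congr rfl fun j hj => ?_
    rw [Function.update_of_ne (ho j (mem_Ico.1 hj).2)]
  have hsum : ∑ r ∈ Icc 1 t, Function.update L t (L t + 1) r = ∑ r ∈ Icc 1 t, L r + 1 := by
    obtain ⟨t, rfl⟩ : ∃ t', t = t' + 1 := ⟨t - 1, by omega⟩
    rw [sum_Icc_succ_top (by omega), sum_Icc_succ_top (by omega), uL',
      sum_congr rfl fun r hr => uL r (by have := (mem_Icc.1 hr).2; omega)]
    ring
  have hs := h.L_sum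
  have hle := h.L_le
  constructor
  · exact ht
  · exact h.F_one
  · exact h.F_lt
  · intro r h1 hr
    rw [h9, h10]
    obtain ⟨b, hb, f, e1, e2, e3, e4⟩ := h.base r h1 hr
    refine ⟨b, hb, f, e1, e2, e3, ?_⟩
    rcases hr.lt_or_eq with hr | rfl
    · rwa [uL r hr]
    · obtain rfl : f = 0 := by
        rw [h0] at e2
        exact_mod_cast e2.symm
      rw [uL']
      omega
  · rw [h11]; exact h.adj
  · intro r h1 hr
    rw [hcount, uL r hr]
    have := h.L_step r h1 hr
    rcases Nat.lt_or_ge (r + 1) t with h' | h'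
    · rw [uL _ h', if_neg (by omega)]; omega
    · obtain rfl : t = r + 1 := by omega
      rw [uL', if_pos rfl]; omega
  · rw [hcount]
    have := h.L_one
    rcases Nat.lt_or_ge 1 t with h' | h'
    · rw [uL _ h', if_neg (by omega)]; omega
    · obtain rfl : t = 1 := by omega
      rw [uL', if_pos rfl]; omega
  · intro r h1 hr
    rw [uL r hr]; exact h.L_two r h1 hr
  · intro r h1 hr
    rw [uL r hr]; exact h.L_pos r h1 hr
  · rw [hsum, uL']; omega
  · intro j hj
    rcases Nat.lt_succ_iff_lt_or_eq.1 hj with hj | rfl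
    · rw [Function.update_of_ne (ho j hj)]; exact h.pos_mem j hj
    · rw [Function.update_self]; exact ⟨ht, le_rfl, hF⟩

theorem run_storeElement {b f t : ℕ} {e : ℤ} (hz : s.reg 10 = 0) (ht : s.reg 15 = t)
    (hb : s.reg 52 = b) (hf : s.reg 53 = f) (he : s.reg 54 = e) :
    Run storeElement s fun s' T => T = 3 ∧ s'.reg = s.reg ∧
      (∀ r : ℕ, s'.arr 9 r 0 = if r = t then (b : ℤ) else s.arr 9 r 0) ∧
      (∀ r : ℕ, s'.arr 10 r 0 = if r = t then (f : ℤ) else s.arr 10 r 0) ∧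
      ∀ r : ℕ, s'.arr 11 r 0 = if r = t then e else s.arr 11 r 0 := by
  simp [storeElement, hz, ht, hb, hf, he, State.setArr_arr]

/-- Consecutive powers are added until either the exponent of `y` is reached or the carry bound has
been halved to `0`; in the latter case nothing can be carried across the rest of the gap, and it may
be skipped. Halving by counting costs a multiple of `L t`, and the costs form a geometric series. -/
theorem run_closeGap {y g : ℕ} (h : Chain n E S o i t F L pos s) (hi : i ≤ n + 1)
    (hz : s.reg 10 = 0) (hone : s.reg 11 = 1) (hy : s.reg 24 = y) (hyS : y ∈ S) (hg : s.reg 28 = g)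
    (h15 : s.reg 15 = t) (h50 : s.reg 50 = L t) {b : ℕ} (hb : b ∈ S) (h52 : s.reg 52 = b)
    (h53 : s.reg 53 = 0) (hbF : E b = F t) (ht0 : s.arr 10 t 0 = 0) (hLt : 1 ≤ L t)
    (hle : F t ≤ E y) (hgd : Approx (n + 5) g (E y - F t)) :
    Run closeGap s fun s' T => (∃ t' F' L', Chain n E S o i t' F' L' pos s' ∧ s'.reg 15 = t' ∧
      s'.reg 50 = L' t' ∧ (∃ b ∈ S, s'.reg 52 = b ∧ E b = F' t') ∧ s'.reg 53 = 0 ∧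
      s'.arr 10 t' 0 = 0 ∧ F' t' = E y) ∧ T ≤ 60 * (5 * n + 8) + 1 := by
  have hLn := h.L_le
  have hpow : 10 * n + 16 < 2 ^ (n + 5) := by
    have : n + 1 ≤ 2 ^ n := Nat.lt_two_pow_self
    rw [pow_add]; omega
  refine Run.loop (fun N s' => ∃ (t : ℕ) (F L : ℕ → ℕ) (b f : ℕ), Chain n E S o i t F L pos s' ∧
    s'.reg 15 = t ∧ s'.reg 50 = L t ∧ b ∈ S ∧ s'.reg 52 = b ∧ s'.reg 53 = f ∧ E b + f = F t ∧
    2 ^ f * L t ≤ 10 * n + 16 ∧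
    ((s'.reg 28 = 0 ∧ F t = E y ∧ f = 0 ∧ s'.arr 10 t 0 = 0) ∨
      ∃ g : ℕ, s'.reg 28 = g ∧ 0 < g ∧ 1 ≤ L t ∧ F t < E y ∧
        (F t + g = E y ∨ (2 * L t < 2 ^ g ∧ 2 * L t < 2 ^ (E y - F t))) ∧ 60 * L t ≤ N))
    (60 * L t) ?_ ?_ ?_
  · refine ⟨t, F, L, b, 0, h, h15, h50, hb, h52, by simp [h53], by simp [hbF], by omega, ?_⟩
    rcases Nat.eq_zero_or_pos g with rfl | hg0
    · left
      refine ⟨by simpa using hg, ?_, rfl, ht0⟩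
      unfold Approx at hgd
      omega
    · right
      refine ⟨g, hg, hg0, hLt, by unfold Approx at hgd; omega, ?_, le_rfl⟩
      -- If the stored gap is not exact, it and the true gap are at least `n + 5`, and `2 * L t < 2
      -- ^ (n + 5)`: the carry bound dies out before either count does.
      by_cases hge : F t + g = E y
      · exact .inl hge
      · have h1 : n + 5 ≤ g ∧ n + 5 ≤ E y - F t := by unfold Approx at hgd; omega
        have h2 := Nat.pow_le_pow_right (n := 2) (by norm_num) h1.1
        have h3 := Nat.pow_le_pow_right (n := 2) (by norm_num) h1.2
        right
        omega
  · rintro N s' fr ⟨t, F, L, b, f, hch, h15, h50, hb, h52, h53, hbf, hfL, hcase⟩ hlt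
    have e10 : s'.reg 10 = 0 := by rw [fr.1 10 rfl, hz]
    have e11 : s'.reg 11 = 1 := by rw [fr.1 11 rfl, hone]
    have e24 : s'.reg 24 = y := by rw [fr.1 24 rfl, hy]
    rw [Test.holds_lt, e10] at hlt
    rcases hcase with ⟨h28, -⟩ | ⟨g, h28, hg0, hL1, hFy, hg, hN⟩
    · omega
    rw [run_seq]
    refine (run_halve e11 h50).conseq ?_
    rintro s2 t2 fr2 ⟨k50, ht2⟩
    have k10 : s2.reg 10 = 0 := by rw [fr2.1 10 rfl, e10]
    have k11 : s2.reg 11 = 1 := by rw [fr2.1 11 rfl, e11]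
    have k15 : s2.reg 15 = t := by rw [fr2.1 15 rfl, h15]
    have k24 : s2.reg 24 = y := by rw [fr2.1 24 rfl, e24]
    have k28 : s2.reg 28 = g := by rw [fr2.1 28 rfl, h28]
    have k52 : s2.reg 52 = b := by rw [fr2.1 52 rfl, h52]
    have k53 : s2.reg 53 = f := by rw [fr2.1 53 rfl, h53]
    have a9 : s2.arr 9 = s'.arr 9 := fr2.2 9 rfl
    have a10 : s2.arr 10 = s'.arr 10 := fr2.2 10 rfl
    have a11 : s2.arr 11 = s'.arr 11 := fr2.2 11 rfl
    have uF : ∀ x, Function.update F (t + 1) x (t + 1) = x := fun x => Function.update_self ..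
    have uL : Function.update L (t + 1) (L t / 2) (t + 1) = L t / 2 := Function.update_self ..
    have hLt := hch.L_le
    -- the two branches that end at the vertex
    have final : ∀ (e : ℤ), e = (if E y = F t + 1 then 1 else 0) → (2 ≤ L t → E y = F t + 1) →
        ∀ s3 : State, s3.arr = s2.arr → s3.reg 10 = 0 → s3.reg 15 = (t + 1 : ℕ) →
        s3.reg 50 = (L t / 2 : ℕ) → s3.reg 52 = y → s3.reg 53 = (0 : ℕ) → s3.reg 54 = e →
        s3.reg 28 = 0 → ∀ T, T ≤ 9 → Run storeElement s3 fun s'' t' => ∃ N', (∃ (t : ℕ)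
          (F L : ℕ → ℕ) (b f : ℕ), Chain n E S o i t F L pos s'' ∧
          s''.reg 15 = t ∧ s''.reg 50 = L t ∧ b ∈ S ∧ s''.reg 52 = b ∧ s''.reg 53 = f ∧
          E b + f = F t ∧ 2 ^ f * L t ≤ 10 * n + 16 ∧
          ((s''.reg 28 = 0 ∧ F t = E y ∧ f = 0 ∧ s''.arr 10 t 0 = 0) ∨
            ∃ g : ℕ, s''.reg 28 = g ∧ 0 < g ∧ 1 ≤ L t ∧ F t < E y ∧
              (F t + g = E y ∨ (2 * L t < 2 ^ g ∧ 2 * L t < 2 ^ (E y - F t))) ∧ 60 * L t ≤ N')) ∧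
          t2 + (1 + (T + t')) + 1 + N' ≤ N := by
      intro e he hadj s3 har m10 m15 m50 m52 m53 m54 m28 T hT
      refine (run_storeElement m10 m15 m52 m53 m54).conseq ?_
      rintro s4 t4 - ⟨rfl, hreg, q9, q10, q11⟩
      refine ⟨0, ⟨t + 1, _, _, y, 0, hch.extend (f := 0) hL1 hFy hyS (add_zero _) (by omega) hadj ?_ ?_ ?_,
        by rw [hreg, m15], by rw [hreg, m50, uL], hyS, by rw [hreg, m52], by rw [hreg, m53],
        by rw [uF, add_zero], by rw [uL]; omega, .inl ⟨by rw [hreg, m28], by rw [uF], rfl, ?_⟩⟩, ?_⟩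
      · intro r; rw [q9, har, a9]
      · intro r; rw [q10, har, a10]
      · intro r; rw [q11, har, a11, he]
      · rw [q10]; simp
      · omega
    simp only [run_seq, run_inc, run_branch, run_const, run_copy, run_dec, Test.holds_eq,
      State.setReg_reg, reduceIte, Nat.reduceEqDiff, k10, k11, k15, k24, k28, k50, k53]
    have hg1 : ((g : ℤ) = 1) ↔ g = 1 := by omega
    have hL0 : (((L t / 2 : ℕ) : ℤ) = 0) ↔ L t / 2 = 0 := by omega
    rw [hg1, hL0]
    refine ⟨?_, fun hgne => ⟨?_, fun hLne => ?_⟩⟩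
    · rintro rfl
      have hEy : E y = F t + 1 := by
        rcases hg with hg | ⟨hg, -⟩ <;> omega
      refine final 1 (by simp [hEy]) (fun _ => hEy) _ ?_ ?_ ?_ ?_ ?_ ?_ ?_ ?_ _ ?_ <;>
        simp [k10, k50]
    · intro hL0
      have hEy : E y ≠ F t + 1 := by
        rcases hg with hg | ⟨-, hg⟩
        · omega
        · intro he
          rw [he] at hg
          simp at hg
          omega
      refine final 0 (by simp [hEy]) (by omega) _ ?_ ?_ ?_ ?_ ?_ ?_ ?_ ?_ _ ?_ <;>
        simp [k10, k50]
    · have hL2 : 2 ≤ L t := by omega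
      have hFy2 : F t + 1 < E y := by
        rcases hg with hg | ⟨-, hg⟩
        · omega
        · by_contra hcon
          obtain hE : E y - F t = 1 := by omega
          rw [hE] at hg
          omega
      obtain ⟨g, rfl⟩ : ∃ g', g = g' + 1 := ⟨g - 1, by omega⟩
      refine (run_storeElement (b := b) (f := f + 1) (t := t + 1) (e := 1) (by simp [k10])
        (by simp) (by simp [k52]) (by simp) (by simp)).conseq ?_
      rintro s4 t4 - ⟨rfl, hreg, q9, q10, q11⟩
      -- The offset grows by one exactly when the carry bound is halved, so `2 ^ f * L` never grows.
      -- This is what keeps the offsets small.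
      have hfL' : 2 ^ (f + 1) * (L t / 2) ≤ 10 * n + 16 := by
        refine le_trans ?_ hfL
        rw [pow_succ, mul_assoc]
        exact Nat.mul_le_mul_left _ (by omega)
      refine ⟨60 * (L t / 2), ⟨t + 1, _, _, b, f + 1, hch.extend hL1 (Nat.lt_succ_self _) hb
        (by omega) hfL' (fun _ => rfl) ?_ ?_ ?_, by rw [hreg]; simp, by rw [hreg, uL]; simp [k50], hb,
        by rw [hreg]; simp [k52], by rw [hreg]; simp, by rw [uF]; omega, by rwa [uL],
        .inr ⟨g, by rw [hreg]; simp, by omega, by rw [uL]; omega, by rw [uF]; omega, ?_,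
          by rw [uL]⟩⟩, ?_⟩
      · intro r; rw [q9]; simp [a9]
      · intro r; rw [q10]; simp [a10]
      · intro r; rw [q11]; simp [a11]
      · rw [uF, uL]
        rcases hg with hg | ⟨hg, hg'⟩
        · left; omega
        · right
          obtain ⟨d, hd⟩ : ∃ d, E y - F t = d + 1 := ⟨E y - F t - 1, by omega⟩
          have hd' : E y - (F t + 1) = d := by omega
          rw [hd, pow_succ] at hg'
          rw [pow_succ] at hg
          rw [hd']
          omega
      · omega
  · rintro N s' T fr ⟨t, F, L, b, f, hch, h15, h50, hb, h52, h53, hbf, hfL, hcase⟩ hlt ht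
    have e10 : s'.reg 10 = 0 := by rw [fr.1 10 rfl, hz]
    rw [Test.holds_lt, e10] at hlt
    rcases hcase with ⟨h28, hF, rfl, h10⟩ | ⟨g, h28, hg0, -⟩
    · exact ⟨⟨t, F, L, hch, h15, h50, ⟨b, hb, h52, hbf⟩, h53, h10, hF⟩, by omega⟩
    · omega

/-- The chain ends with bound `1`: a coefficient of absolute value at most `1` is already a digit,
so nothing is carried out of the last place. -/
theorem run_closeEnd (h : Chain n E S o i t F L pos s) (hi : i ≤ n + 1)
    (hz : s.reg 10 = 0) (hone : s.reg 11 = 1)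
    (h15 : s.reg 15 = t) (h50 : s.reg 50 = L t) {b : ℕ} (hb : b ∈ S) (h52 : s.reg 52 = b)
    (h53 : s.reg 53 = 0) (hbF : E b = F t) (hLt : 1 ≤ L t) :
    Run closeEnd s fun s' T => (∃ t' F' L', Chain n E S o i t' F' L' pos s' ∧ s'.reg 15 = t' ∧
      L' t' = 1) ∧ T ≤ 60 * (5 * n + 8) + 1 := by
  have hLn := h.L_le
  refine Run.loop (fun N s' => ∃ (t : ℕ) (F L : ℕ → ℕ) (b f : ℕ), Chain n E S o i t F L pos s' ∧
    s'.reg 15 = t ∧ s'.reg 50 = L t ∧ b ∈ S ∧ s'.reg 52 = b ∧ s'.reg 53 = f ∧ E b + f = F t ∧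
    2 ^ f * L t ≤ 10 * n + 16 ∧ 1 ≤ L t ∧ 60 * L t ≤ N)
    (60 * L t) ?_ ?_ ?_
  · exact ⟨t, F, L, b, 0, h, h15, h50, hb, h52, by simp [h53], by simp [hbF], by omega, hLt, le_rfl⟩
  · rintro N s' fr ⟨t, F, L, b, f, hch, h15, h50, hb, h52, h53, hbf, hfL, hL1, hN⟩ hlt
    have e10 : s'.reg 10 = 0 := by rw [fr.1 10 rfl, hz]
    have e11 : s'.reg 11 = 1 := by rw [fr.1 11 rfl, hone]
    rw [Test.holds_lt, e11, h50] at hlt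
    rw [run_seq]
    refine (run_halve e11 h50).conseq ?_
    rintro s2 t2 fr2 ⟨k50, ht2⟩
    have k10 : s2.reg 10 = 0 := by rw [fr2.1 10 rfl, e10]
    have k15 : s2.reg 15 = t := by rw [fr2.1 15 rfl, h15]
    have k52 : s2.reg 52 = b := by rw [fr2.1 52 rfl, h52]
    have k53 : s2.reg 53 = f := by rw [fr2.1 53 rfl, h53]
    have a9 : s2.arr 9 = s'.arr 9 := fr2.2 9 rfl
    have a10 : s2.arr 10 = s'.arr 10 := fr2.2 10 rfl
    have a11 : s2.arr 11 = s'.arr 11 := fr2.2 11 rfl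
    have uF : ∀ x, Function.update F (t + 1) x (t + 1) = x := fun x => Function.update_self ..
    have uL : Function.update L (t + 1) (L t / 2) (t + 1) = L t / 2 := Function.update_self ..
    simp only [run_seq, run_inc, run_const, State.setReg_reg, reduceIte, Nat.reduceEqDiff, k15, k53]
    have hL2 : 2 ≤ L t := by omega
    refine (run_storeElement (b := b) (f := f + 1) (t := t + 1) (e := 1) (by simp [k10])
      (by simp) (by simp [k52]) (by simp) (by simp)).conseq ?_
    rintro s4 t4 - ⟨rfl, hreg, q9, q10, q11⟩
    have hfL' : 2 ^ (f + 1) * (L t / 2) ≤ 10 * n + 16 := by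
      refine le_trans ?_ hfL
      rw [pow_succ, mul_assoc]
      exact Nat.mul_le_mul_left _ (by omega)
    refine ⟨60 * (L t / 2), ⟨t + 1, _, _, b, f + 1, hch.extend hL1 (Nat.lt_succ_self _) hb
      (by omega) hfL' (fun _ => rfl) ?_ ?_ ?_, by rw [hreg]; simp, by rw [hreg, uL]; simp [k50], hb,
      by rw [hreg]; simp [k52], by rw [hreg]; simp, by rw [uF]; omega, by rwa [uL], by rw [uL]; omega,
      by rw [uL]⟩, ?_⟩
    · intro r; rw [q9]; simp [a9]
    · intro r; rw [q10]; simp [a10]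
    · intro r; rw [q11]; simp [a11]
    · omega
  · rintro N s' T fr ⟨t, F, L, b, f, hch, h15, h50, hb, h52, h53, hbf, hfL, hL1, hN⟩ hlt ht
    have e11 : s'.reg 11 = 1 := by rw [fr.1 11 rfl, hone]
    rw [Test.holds_lt, e11, h50] at hlt
    exact ⟨⟨t, F, L, hch, h15, by omega⟩, by omega⟩

end Chain

/-- The memory holds a finished chain of `k` powers of `2`; the `r`-th one is `2 ^ F r`. It contains
the values of all vertices, `pos w` being the place of the value of `w`. The numbers `L r` bound what
occurs at place `r` when a sum of values of vertices is normalized. -/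
structure Closed (n : ℕ) (nd : ℕ → Prop) (E : ℕ → ℕ) (k : ℕ) (F L pos : ℕ → ℕ) (s : State) :
    Prop where
  reg : s.reg 15 = k
  one_le : 1 ≤ k
  le : k ≤ 10 * n + 16
  F_one : F 1 = 0
  F_lt : ∀ r, 1 ≤ r → r < k → F r < F (r + 1)
  base : ∀ r, 1 ≤ r → r ≤ k → ∃ b ≤ n, nd b ∧ ∃ f : ℕ, s.arr 9 (r : ℕ) 0 = b ∧
    s.arr 10 (r : ℕ) 0 = f ∧ E b + f = F r ∧ f ≤ 4 * n + 8
  adj : ∀ r, 1 ≤ r → r < k →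
    s.arr 11 ((r + 1 : ℕ) : ℤ) 0 = if F (r + 1) = F r + 1 then 1 else 0
  L_step : ∀ r, 1 ≤ r → r < k → #{w ∈ range n | pos w = r + 1} + L r / 2 ≤ L (r + 1)
  L_one : #{w ∈ range n | pos w = 1} + (4 * n + 8) ≤ L 1
  L_two : ∀ r, 1 ≤ r → r ≤ k → 2 ≤ L r → r < k ∧ F (r + 1) = F r + 1
  L_le : ∀ r, 1 ≤ r → r ≤ k → L r ≤ 10 * n + 16
  pos_eq : ∀ w : ℕ, s.arr 8 w 0 = pos w
  pos_mem : ∀ w < n, nd w → 1 ≤ pos w ∧ pos w ≤ k ∧ F (pos w) = E w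
  pos_zero : ∀ w < n, ¬ nd w → pos w = 0

/-- The capacity `4 * n + 8` reserved at the first place is meant for the offset `f`, which will be
added there as `f` copies of `2 ^ 0`. There are at most `n` gaps, each closed in linear time. -/
theorem run_closeChain {s : State} {n q : ℕ} {nd : ℕ → Prop} {E o : ℕ → ℕ} (hc : Consts n s)
    (hs : Sorted n E (nodes n nd (range n)) q o s) (hnd : nd n) (h8 : ∀ i : ℕ, s.arr 8 i 0 = 0) :
    Run closeChain s fun s' t => (∃ k F L pos, Closed n nd E k F L pos s') ∧
      t ≤ 1000 * (n + 1) ^ 2 := by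
  classical
  set S := nodes n nd (range n) with hS
  have hnS : n ∈ S := by rw [hS, nodes]; simp
  have hq := hs.le
  have hz' : o 0 = n := hs.zero'
  have hEn : E n = 0 := by rw [← hz', hs.zero]
  have hq0 := hs.pos
  simp only [closeChain, run_seq, run_const, run_copy, State.setReg_reg, reduceIte,
    Nat.reduceEqDiff]
  refine (run_storeElement (b := n) (f := 0) (t := 1) (e := 0) (by simp [hc.h10]) (by simp)
    (by simp [hc.h0]) (by simp) (by simp)).conseq ?_
  rintro s1 t1 fr1 ⟨rfl, hreg, q9, q10, q11⟩
  have hc1 : Consts n s1 := by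
    constructor <;> rw [hreg] <;> simp [hc.h0, hc.h10, hc.h11, hc.h12, hc.h13]
  have r14 : s1.reg 14 = q := by rw [hreg]; simp [hs.reg]
  have r15 : s1.reg 15 = 1 := by rw [hreg]; simp
  have r50 : s1.reg 50 = (4 * n + 8 : ℕ) := by rw [hreg]; simp [hc.h12]
  have r52 : s1.reg 52 = n := by rw [hreg]; simp [hc.h0]
  have r53 : s1.reg 53 = 0 := by rw [hreg]; simp
  have a8 : s1.arr 8 = s.arr 8 := by rw [fr1.2 8 rfl]; simp
  have a4 : s1.arr 4 = s.arr 4 := by rw [fr1.2 4 rfl]; simp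
  have a6 : s1.arr 6 = s.arr 6 := by rw [fr1.2 6 rfl]; simp
  simp only [run_store, hc1.h0, hc1.h10, r15]
  refine Run.forUp (fun i s' => ∃ t F L pos, Chain n E S o i t F L pos s' ∧ s'.reg 15 = t ∧
      s'.reg 50 = L t ∧ (∃ b ∈ S, s'.reg 52 = b ∧ E b = F t) ∧ s'.reg 53 = 0 ∧
      s'.arr 10 t 0 = 0 ∧ 1 ≤ L t ∧ F t = E (o (i - 1)) ∧ (∀ w : ℕ, s'.arr 8 w 0 = pos w) ∧
      ∀ w ∉ S, pos w = 0)
    1 q (60 * (5 * n + 8) + 10) (by simp) (by simp [r14]) (by omega) rfl rfl rfl ?_ ?_ ?_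
  · refine ⟨1, fun _ => 0, fun _ => 4 * n + 8, fun w => if w = n then 1 else 0, ?_, by simp [r15],
      by simp [r50], ⟨n, hnS, by simp [r52], hEn⟩, by simp [r53], ?_, by simp, ?_, ?_, ?_⟩
    · constructor
      · omega
      · rfl
      · intros; omega
      · intro r h1 h2
        obtain rfl : r = 1 := by omega
        refine ⟨n, hnS, 0, ?_, ?_, hEn, by omega⟩
        · have := q9 1
          simpa using this
        · have := q10 1
          simpa using this
      · intros; omega
      · intros; omega
      · simp
      · intros; omega
      · intros; omega
      · simp; omega
      · intro j hj
        obtain rfl : j = 0 := by omega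
        simp [hz', hEn]
    · have := q10 1
      simpa using this
    · simp [hz', hEn]
    · intro w
      simp only [State.setReg_arr, State.setArr_arr, a8, h8 w]
      by_cases hw : w = n <;> simp [hw]
    · intro w hw
      have : w ≠ n := fun h => hw (h ▸ hnS)
      simp [this]
  · rintro i s2 fr2 h1i hiq h31 h14 ⟨t, F, L, pos, hch, k15, k50, ⟨b, hb, k52, hbF⟩, k53, k10, hL, hF,
      hpos, hpos0⟩
    have hc2 : Consts n s2 := by
      refine Consts.of_frame (s := (s1.setArr 8 n 0 1).setReg 31 1) ?_ fr2 rfl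
      constructor <;> simp [hc1.h0, hc1.h10, hc1.h11, hc1.h12, hc1.h13]
    have b4 : s2.arr 4 = s.arr 4 := by rw [fr2.2 4 rfl]; simp [a4]
    have b6 : s2.arr 6 = s.arr 6 := by rw [fr2.2 6 rfl]; simp [a6]
    have hi1 : (i : ℤ) - 1 = ((i - 1 : ℕ) : ℤ) := by omega
    simp only [run_seq, run_load, run_copy, run_dec, State.setReg_reg, State.setReg_arr, reduceIte,
      Nat.reduceEqDiff, hc2.h10, h31, b4, b6, hi1, hs.list i hiq, hs.list (i - 1) (by omega)]
    have hdif := hs.dif (o i) (hs.enum.mem hiq) (o (i - 1)) (hs.enum.mem (by omega))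
    have hmono := hs.mono (i - 1) (by omega)
    rw [show i - 1 + 1 = i by omega] at hmono
    obtain ⟨g, hg⟩ : ∃ g : ℕ, s.arr 6 (o i) (o (i - 1)) = g := by
      refine ⟨(s.arr 6 (o i) (o (i - 1))).toNat, ?_⟩
      unfold Approx at hdif
      omega
    rw [hg, ← hF] at hdif
    rw [← hF] at hmono
    refine (run_closeGap (y := o i) (g := g) (b := b) (hch.congr (by simp) (by simp) (by simp))
      (by omega) (by simp [hc2.h10]) (by simp [hc2.h11]) (by simp) (hs.enum.mem hiq) (by simp [hg])
      (by simp [k15]) (by simp [k50]) hb (by simp [k52]) (by simp [k53]) hbF (by simpa using k10) hL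
      hmono hdif).conseq ?_
    rintro s3 t3 fr3 ⟨⟨t', F', L', hch', m15, m50, ⟨b', hb', m52, hbF'⟩, m53, m10, hF'⟩, ht3⟩
    have n10 : s3.reg 10 = 0 := by rw [fr3.1 10 rfl]; simp [hc2.h10]
    have n24 : s3.reg 24 = o i := by rw [fr3.1 24 rfl]; simp
    have c8 : s3.arr 8 = s2.arr 8 := by rw [fr3.2 8 rfl]; simp
    simp only [run_inc, run_store, State.setReg_reg, reduceIte, Nat.reduceEqDiff, n10, n24, m15]
    refine ⟨⟨t', F', Function.update L' t' (L' t' + 1), Function.update pos (o i) t',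
      hch'.succ (by simp) (by simp) (by simp) h1i (by omega) hF' ?_ m10, by simp [m15],
      by simp [m50], ⟨b', hb', by simp [m52], hbF'⟩, by simp [m53], by simpa using m10, by simp,
      by simpa using hF', ?_, ?_⟩, by omega⟩
    · intro j hj he
      have := hs.enum.inj (hj.trans hiq) hiq he
      omega
    · intro w
      simp only [State.setReg_arr, State.setArr_arr, c8, hpos w]
      by_cases hw : w = o i <;> simp [hw]
    · intro w hw
      rw [Function.update_of_ne, hpos0 w hw]
      rintro rfl
      exact hw (hs.enum.mem hiq)
  · rintro s2 t2 fr2 h31 ⟨t, F, L, pos, hch, k15, k50, ⟨b, hb, k52, hbF⟩, k53, k10, hL, hF, hpos,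
      hpos0⟩ ht2
    have n10 : s2.reg 10 = 0 := by rw [fr2.1 10 rfl]; simp [hc1.h10]
    have n11 : s2.reg 11 = 1 := by rw [fr2.1 11 rfl]; simp [hc1.h11]
    refine (run_closeEnd hch hq n10 n11 k15 k50 hb k52 k53 hbF hL).conseq ?_
    rintro s3 t3 fr3 ⟨⟨k, F', L', h3, m15, hLk⟩, ht3⟩
    -- The artificial vertex is omitted on both sides: it is `o 0` on the left and outside `range n`
    -- on the right. Leaves have place `0` and are not counted.
    have hcount : ∀ r, 1 ≤ r → (∑ j ∈ Ico 1 q, if pos (o j) = r then 1 else 0) =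
        #{w ∈ range n | pos w = r} := by
      intro r hr
      have e1 := hs.enum fun w => if pos w = r then 1 else 0
      have e2 : ∑ i ∈ range q, (if pos (o i) = r then (1 : ℤ) else 0) =
          (if pos (o 0) = r then 1 else 0) + ∑ i ∈ Ico 1 q, if pos (o i) = r then 1 else 0 := by
        rw [range_eq_Ico, sum_eq_sum_Ico_succ_bot hq0]
      rw [e2, hS, nodes, sum_insert (by simp), hz', add_right_inj] at e1
      have e3 : (((∑ j ∈ Ico 1 q, if pos (o j) = r then 1 else 0 : ℕ)) : ℤ) =
          ((#{w ∈ range n | pos w = r} : ℕ) : ℤ) := by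
        push_cast
        rw [e1, card_filter, sum_filter]
        push_cast
        refine sum_congr rfl fun w hw => ?_
        split_ifs with h1 h2 h2 <;> try rfl
        exfalso
        have := hpos0 w (by
          rw [hS, nodes, mem_insert, mem_filter, not_or]
          exact ⟨by have := mem_range.1 hw; omega, fun h => h1 h.2⟩)
        omega
      exact_mod_cast e3
    have hpow : 10 * n + 16 < 2 ^ (n + 5) := by
      have : n + 1 ≤ 2 ^ n := Nat.lt_two_pow_self
      rw [pow_add]; omega
    have hLpos : ∀ r, 1 ≤ r → r ≤ k → 1 ≤ L' r := fun r h1 h2 => by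
      rcases h2.lt_or_eq with h | rfl
      · exact h3.L_pos r h1 h
      · exact hLk.ge
    have hsum := h3.L_sum
    refine ⟨⟨k, F', L', pos, ?_⟩, ?_⟩
    · constructor
      · exact m15
      · exact h3.one_le
      -- All bounds `L' r` are positive, so the length of the chain is at most their sum.
      · have : ∑ r ∈ Icc 1 k, 1 ≤ ∑ r ∈ Icc 1 k, L' r :=
          sum_le_sum fun r hr => hLpos r (mem_Icc.1 hr).1 (mem_Icc.1 hr).2
        simp at this
        omega
      · exact h3.F_one
      · exact h3.F_lt
      · intro r h1 h2
        obtain ⟨b, hb, f, e1, e2, e3, e4⟩ := h3.base r h1 h2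
        have hb' : b ≤ n ∧ nd b := by
          rw [hS, nodes, mem_insert, mem_filter, mem_range] at hb
          rcases hb with rfl | ⟨h, h'⟩
          · exact ⟨le_rfl, hnd⟩
          · exact ⟨h.le, h'⟩
        refine ⟨b, hb'.1, hb'.2, f, e1, e2, e3, ?_⟩
        -- `2 ^ f ≤ 2 ^ f * L' r ≤ 10 * n + 16 < 2 ^ (n + 5)` leaves no room for a large offset.
        by_contra hf
        have h5 : 2 ^ (n + 5) ≤ 2 ^ f := Nat.pow_le_pow_right (by norm_num) (by omega)
        have h6 := Nat.mul_le_mul_left (2 ^ f) (hLpos r h1 h2)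
        omega
      · exact h3.adj
      · intro r h1 h2
        rw [← hcount _ (by omega)]
        exact h3.L_step r h1 h2
      · rw [← hcount _ le_rfl]
        exact h3.L_one
      · intro r h1 h2 hL2
        rcases h2.lt_or_eq with h | rfl
        · exact ⟨h, h3.L_two r h1 h hL2⟩
        · omega
      · intro r h1 h2
        have : L' r ≤ ∑ r ∈ Icc 1 k, L' r :=
          single_le_sum (f := L') (fun _ _ => Nat.zero_le _) (mem_Icc.2 ⟨h1, h2⟩)
        omega
      · intro w
        rw [fr3.2 8 rfl, hpos w]
      · intro w hw hnw
        obtain ⟨j, hj, rfl⟩ := hs.enum.exists_eq (w := w) (by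
          rw [hS, nodes, mem_insert, mem_filter, mem_range]
          exact .inr ⟨hw, hnw⟩)
        exact h3.pos_mem j hj
      · intro w hw hnw
        refine hpos0 w ?_
        rw [hS, nodes, mem_insert, mem_filter, not_or]
        exact ⟨by omega, fun h => hnw h.2⟩
    · have e : (q - 1) * (60 * (5 * n + 8) + 10 + 2) ≤ n * (60 * (5 * n + 8) + 10 + 2) :=
        Nat.mul_le_mul_right _ (by omega)
      clear * - e ht2 ht3
      nlinarith

/-! ### Normalizing the exponent sums -/

/-- Reduce register `63` to a digit `-1`, `0` or `1`, with a carry that is added to register `66`. -/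
def splitDigit : Prog :=
  .seq (.loop (.lt 11 63) (.seq (.dec 63) <| .seq (.dec 63) (.inc 66)))
    (.loop (.lt 63 18) (.seq (.inc 63) <| .seq (.inc 63) (.dec 66)))

/-- The carry is at most half of the number in absolute value; the term `L r / 2` in the chain
bounds reflects exactly this. -/
theorem run_splitDigit {s : State} (h11 : s.reg 11 = 1) (h18 : s.reg 18 = -1) :
    Run splitDigit s fun s' t => (∃ h : ℤ, s'.reg 63 = s.reg 63 - 2 * h ∧
      s'.reg 66 = s.reg 66 + h ∧ 2 * h.natAbs ≤ (s.reg 63).natAbs ∧ (s'.reg 63).natAbs ≤ 1) ∧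
      t ≤ 4 * (s.reg 63).natAbs + 2 := by
  simp only [splitDigit, run_seq]
  refine Run.loop (fun N s' => ∃ h : ℤ, s'.reg 63 = s.reg 63 - 2 * h ∧ s'.reg 66 = s.reg 66 + h ∧
    0 ≤ h ∧ (0 < h → 0 ≤ s.reg 63 - 2 * h) ∧ N = 4 * (s'.reg 63).toNat)
    (4 * (s.reg 63).toNat) ⟨0, by simp, by simp, le_rfl, by simp, rfl⟩ ?_ ?_
  · rintro N s' fr ⟨h, h1, h2, h3, h4, rfl⟩ hb
    rw [Test.holds_lt, fr.1 11 rfl, h11] at hb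
    simp only [run_seq, run_dec, run_inc, State.setReg_reg, reduceIte, Nat.reduceEqDiff, h2]
    exact ⟨_, ⟨h + 1, by omega, by omega, by omega, by omega, rfl⟩, by omega⟩
  · rintro N s1 t1 fr ⟨h, h1, h2, h3, h4, rfl⟩ hb ht
    rw [Test.holds_lt, fr.1 11 rfl, h11] at hb
    refine Run.loop (fun N s' => ∃ h : ℤ, s'.reg 63 = s.reg 63 - 2 * h ∧
      s'.reg 66 = s.reg 66 + h ∧ 2 * h.natAbs ≤ (s.reg 63).natAbs ∧ s'.reg 63 ≤ 1 ∧
      (s'.reg 63 < 0 → h ≤ 0) ∧ N = 4 * (- s'.reg 63).toNat)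
      (4 * (- s1.reg 63).toNat) ⟨h, h1, h2, by omega, by omega, by omega, rfl⟩ ?_ ?_
    · rintro N s' fr' ⟨h, h1, h2, h3, h4, h5, rfl⟩ hb
      rw [Test.holds_lt, fr'.1 18 rfl, fr.1 18 rfl, h18] at hb
      simp only [run_seq, run_dec, run_inc, State.setReg_reg, reduceIte, Nat.reduceEqDiff, h2]
      exact ⟨_, ⟨h - 1, by omega, by omega, by omega, by omega, by omega, rfl⟩, by omega⟩
    · rintro N s2 t2 fr' ⟨h, h1, h2, h3, h4, h5, rfl⟩ hb ht'
      rw [Test.holds_lt, fr'.1 18 rfl, fr.1 18 rfl, h18] at hb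
      exact ⟨⟨h, h1, h2, h3, by omega⟩, by omega⟩

/-- The value of a row of coefficients. -/
def rowSum (k : ℕ) (F : ℕ → ℕ) (c : ℕ → ℤ) : ℤ := ∑ r ∈ Icc 1 k, c r * 2 ^ F r

theorem rowSum_congr {k : ℕ} {F : ℕ → ℕ} {c c' : ℕ → ℤ} (h : ∀ r, 1 ≤ r → r ≤ k → c r = c' r) :
    rowSum k F c = rowSum k F c' :=
  sum_congr rfl fun r hr => by rw [h r (mem_Icc.1 hr).1 (mem_Icc.1 hr).2]

/-- At adjacent exponents, two units of one place are one unit of the next. Adjacency is required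
only for a non-zero carry. -/
theorem rowSum_carry {k : ℕ} {F : ℕ → ℕ} {c c' : ℕ → ℤ} {i : ℕ} {h : ℤ}
    (hi : c' i = c i - 2 * h) (hi' : c' (i + 1) = c (i + 1) + h)
    (hne : ∀ r, r ≠ i → r ≠ i + 1 → c' r = c r)
    (hF : h ≠ 0 → 1 ≤ i ∧ i < k ∧ F (i + 1) = F i + 1) : rowSum k F c' = rowSum k F c := by
  by_cases h0 : h = 0
  · subst h0
    refine rowSum_congr fun r _ _ => ?_
    by_cases h1 : r = i
    · rw [h1, hi]; ring
    · by_cases h2 : r = i + 1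
      · rw [h2, hi']; ring
      · exact hne r h1 h2
  · obtain ⟨h1, h2, h3⟩ := hF h0
    have hc : ∀ r ∈ Icc 1 k, c' r * 2 ^ F r = c r * 2 ^ F r +
        ((if r = i then -2 * h * 2 ^ F i else 0) + if r = i + 1 then h * 2 ^ F (i + 1) else 0) := by
      intro r _
      by_cases e1 : r = i
      · subst e1
        rw [hi]; simp; ring
      · by_cases e2 : r = i + 1
        · subst e2
          rw [hi']; simp; ring
        · rw [hne r e1 e2]; simp [e1, e2]
    rw [rowSum, sum_congr rfl hc, sum_add_distrib, sum_add_distrib, sum_ite_eq', sum_ite_eq',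
      if_pos (mem_Icc.2 ⟨h1, h2.le⟩), if_pos (mem_Icc.2 ⟨by omega, h2⟩), h3, rowSum, pow_succ]
    ring

/-- Registers used in the computation of rows. -/
structure RowRegs (n k r : ℕ) (s : State) : Prop where
  consts : Consts n s
  h15 : s.reg 15 = k
  h16 : s.reg 16 = (k + 1 : ℕ)
  h18 : s.reg 18 = -1
  h60 : s.reg 60 = r

theorem RowRegs.of_frame {n k r : ℕ} {p : Prog} {s s' : State} (h : RowRegs n k r s)
    (fr : Frame p s s')
    (hp : (p.modReg 0 || p.modReg 10 || p.modReg 11 || p.modReg 12 || p.modReg 13) = false)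
    (hp' : (p.modReg 15 || p.modReg 16 || p.modReg 18 || p.modReg 60) = false) :
    RowRegs n k r s' := by
  simp only [Bool.or_eq_false_iff] at hp'
  obtain ⟨⟨⟨h0, h1⟩, h2⟩, h3⟩ := hp'
  exact ⟨h.consts.of_frame fr (by simpa using hp), by rw [fr.1 _ h0, h.h15],
    by rw [fr.1 _ h1, h.h16], by rw [fr.1 _ h2, h.h18], by rw [fr.1 _ h3, h.h60]⟩

theorem RowRegs.setReg {n k r x : ℕ} {s : State} {c : ℤ} (h : RowRegs n k r s) (hx : 18 < x)
    (hx' : x ≠ 60) : RowRegs n k r (s.setReg x c) := by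
  obtain ⟨⟨h1, h2, h3, h4, h5⟩, h6, h7, h8, h9⟩ := h
  refine ⟨⟨?_, ?_, ?_, ?_, ?_⟩, ?_, ?_, ?_, ?_⟩ <;> rw [State.setReg_reg, if_neg (by omega)] <;>
    assumption

/-- Collect the coefficients of the row in register `60`. -/
def buildRow : Prog :=
  .seq (.load 61 9 60 10) <| .seq (.load 62 10 60 10) <| .seq (.store 5 60 11 62) <|
    .seq (.const 42 0) <| forUp 42 0 <|
      .seq (.load 43 0 61 42) <| .seq (.load 44 8 42 10) <| .seq (.load 63 5 60 44) <|
        .seq (addTo 63 43 30) (.store 5 60 44 63)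

/-- Row `r` starts as `f` plus the exponent sum of its base vertex, collected by places. Edges to
leaves go to column `0`, which does not enter `rowSum` and is overwritten by the flag later. -/
theorem run_buildRow {s : State} {n k r b f : ℕ} {A : ℕ → ℕ → ℤ} {pos : ℕ → ℕ}
    (hr : RowRegs n k r s) (hA : ∀ i j : ℕ, s.arr 0 i j = A i j) (hA1 : ∀ i j, (A i j).natAbs ≤ 1)
    (hpos : ∀ w : ℕ, s.arr 8 w 0 = pos w) (hb : s.arr 9 r 0 = b) (hf : s.arr 10 r 0 = f)
    (h0 : ∀ j : ℕ, s.arr 5 r j = 0) :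
    Run buildRow s fun s' t => (∀ i : ℕ, i ≠ r → ∀ j : ℕ, s'.arr 5 i j = s.arr 5 i j) ∧
      (∀ j : ℕ, s'.arr 5 r j = (if j = 1 then (f : ℤ) else 0) +
        ∑ w ∈ range n with pos w = j, A b w) ∧ t ≤ 20 * (n + 1) := by
  have h10 := hr.consts.h10
  have h11 := hr.consts.h11
  have h60 := hr.h60
  simp only [buildRow, run_seq, run_load, run_store, run_const, State.setReg_reg, State.setReg_arr,
    reduceIte, Nat.reduceEqDiff, h10, h11, h60, hb, hf]
  refine Run.forUp (fun i s' => (∀ i : ℕ, i ≠ r → ∀ j : ℕ, s'.arr 5 i j = s.arr 5 i j) ∧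
      ∀ j : ℕ, s'.arr 5 r j = (if j = 1 then (f : ℤ) else 0) + ∑ w ∈ range i with pos w = j, A b w)
    0 n 10 (by simp) (by simp [hr.consts.h0]) (by omega) rfl rfl rfl ?_ ?_ ?_
  · simp only [State.setReg_arr, State.setArr_arr]
    refine ⟨fun i hi j => by simp [hi], fun j => ?_⟩
    by_cases hj : j = 1
    · simp [hj]
    · simp [hj, h0 j]
  · rintro i s1 fr - hi h42 hreg ⟨i1, i2⟩
    have e10 : s1.reg 10 = 0 := by rw [fr.1 10 rfl]; simp [h10]
    have e60 : s1.reg 60 = r := by rw [fr.1 60 rfl]; simp [h60]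
    have e61 : s1.reg 61 = b := by rw [fr.1 61 rfl]; simp
    have a0 : s1.arr 0 = s.arr 0 := by rw [fr.2 0 rfl]; simp
    have a8 : s1.arr 8 = s.arr 8 := by rw [fr.2 8 rfl]; simp
    simp only [run_seq, run_load, State.setReg_reg, State.setReg_arr, reduceIte, Nat.reduceEqDiff,
      e10, e60, e61, h42, a0, a8, hA, hpos]
    refine (run_addTo (by simp [e10]) (by norm_num) (by norm_num) (by norm_num)).conseq ?_
    rintro s2 t2 fr2 ⟨h63, ht2⟩
    have f60 : s2.reg 60 = r := by rw [fr2.1 60 rfl]; simp [e60]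
    have f44 : s2.reg 44 = pos i := by rw [fr2.1 44 rfl]; simp
    have b5 : s2.arr 5 = s1.arr 5 := by rw [fr2.2 5 rfl]; simp
    simp only [State.setReg_reg, reduceIte, Nat.reduceEqDiff, i2] at h63 ht2
    simp only [run_store, f60, f44, h63, State.setArr_arr, b5]
    have := hA1 b i
    refine ⟨⟨fun i' hi' j => ?_, fun j => ?_⟩, by omega⟩
    · simp [hi', i1 i' hi' j]
    · rw [range_add_one, filter_insert]
      by_cases hj : pos i = j
      · subst hj
        rw [if_pos rfl, sum_insert (by simp)]
        simp
        ring
      · rw [if_neg hj]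
        have hj' : ¬ j = pos i := fun h => hj h.symm
        simp [hj', i2 j]
  · rintro s1 t1 fr - ⟨i1, i2⟩ ht
    exact ⟨i1, i2, by omega⟩

/-- Normalize the coefficients of the row in register `60` to digits `-1`, `0`, `1`. -/
def carryRow : Prog :=
  .seq (.const 64 1) <| forUp 64 16 <|
    .seq (.copy 65 64) <| .seq (.inc 65) <| .seq (.load 63 5 60 64) <| .seq (.load 66 5 60 65) <|
      .seq splitDigit <| .seq (.store 5 60 64 63) (.store 5 60 65 66)

/-- By induction the number at place `i`, with the incoming carry, is at most `L i` in absolute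
value. A non-zero carry therefore needs `2 ≤ L i`, and then `hL_two` provides an adjacent next
place; in particular nothing is lost beyond place `k`. -/
theorem run_carryRow {s : State} {n k r : ℕ} {F L : ℕ → ℕ} (hr : RowRegs n k r s)
    (hL_one : 1 ≤ k → (s.arr 5 r 1).natAbs ≤ L 1)
    (hL_step : ∀ i, 1 ≤ i → i < k → (s.arr 5 r ((i + 1 : ℕ) : ℤ)).natAbs + L i / 2 ≤ L (i + 1))
    (hL_two : ∀ i, 1 ≤ i → i ≤ k → 2 ≤ L i → i < k ∧ F (i + 1) = F i + 1)
    (hL_le : ∀ i, 1 ≤ i → i ≤ k → L i ≤ 10 * n + 16) (hk : k ≤ 10 * n + 16) :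
    Run carryRow s fun s' t => (∀ i : ℕ, i ≠ r → ∀ j : ℕ, s'.arr 5 i j = s.arr 5 i j) ∧
      (∀ j : ℕ, 1 ≤ j → j ≤ k → (s'.arr 5 r j).natAbs ≤ 1) ∧
      rowSum k F (fun j => s'.arr 5 r j) = rowSum k F (fun j => s.arr 5 r j) ∧
      t ≤ 1600 * (n + 1) ^ 2 := by
  simp only [carryRow, run_seq, run_const]
  refine Run.forUp (fun i s' => (∀ i : ℕ, i ≠ r → ∀ j : ℕ, s'.arr 5 i j = s.arr 5 i j) ∧
      (∀ j : ℕ, 1 ≤ j → j < i → (s'.arr 5 r j).natAbs ≤ 1) ∧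
      (i ≤ k → (s'.arr 5 r i).natAbs ≤ L i) ∧ (∀ j : ℕ, i < j → s'.arr 5 r j = s.arr 5 r j) ∧
      rowSum k F (fun j => s'.arr 5 r j) = rowSum k F (fun j => s.arr 5 r j))
    1 (k + 1) (4 * (10 * n + 16) + 8) (by simp) (by simp [hr.h16]) (by omega) rfl rfl rfl ?_ ?_ ?_
  · refine ⟨fun i _ j => rfl, by intros; omega, ?_, fun j _ => rfl, rfl⟩
    simpa using hL_one
  · rintro i s1 fr h1i hik h64 h16 ⟨i1, i2, i3, i4, i5⟩
    have hr1 : RowRegs n k r s1 := (hr.setReg (by norm_num) (by norm_num)).of_frame fr rfl rfl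
    have h10 := hr1.consts.h10
    have h11 := hr1.consts.h11
    have h18 := hr1.h18
    have h60 := hr1.h60
    have hi1 : (i : ℤ) + 1 = ((i + 1 : ℕ) : ℤ) := by simp
    simp only [run_seq, run_copy, run_inc, run_load, State.setReg_reg, State.setReg_arr, reduceIte,
      Nat.reduceEqDiff, h60, h64, hi1]
    refine (run_splitDigit (by simp [h11]) (by simp [h18])).conseq ?_
    rintro s2 t2 fr2 ⟨⟨h, e1, e2, e3, e4⟩, ht2⟩
    have g60 : s2.reg 60 = r := by rw [fr2.1 60 rfl]; simp [h60]
    have g64 : s2.reg 64 = i := by rw [fr2.1 64 rfl]; simp [h64]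
    have g65 : s2.reg 65 = (i + 1 : ℕ) := by rw [fr2.1 65 rfl]; simp
    have b5 : s2.arr 5 = s1.arr 5 := by rw [fr2.2 5 rfl]; simp
    simp only [State.setReg_reg, reduceIte, Nat.reduceEqDiff] at e1 e2 e3 ht2
    simp only [run_store, State.setArr_reg, g60, g64, g65, e2]
    have hb := i3 (by omega)
    have hLi := hL_le i h1i (by omega)
    have hval : ∀ j : ℕ, ((s2.setArr 5 r i (s2.reg 63)).setArr 5 r ((i + 1 : ℕ) : ℤ)
        (s1.arr 5 r ((i + 1 : ℕ) : ℤ) + h)).arr 5 r j = if j = i + 1 then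
          s1.arr 5 r ((i + 1 : ℕ) : ℤ) + h else if j = i then s2.reg 63 else s1.arr 5 r j := by
      intro j
      simp only [State.setArr_arr, Nat.cast_inj, true_and, b5]
    refine ⟨⟨fun i' hi' j => ?_, fun j h1 h2 => ?_, fun hk' => ?_, fun j hj => ?_, ?_⟩, by omega⟩
    · simp only [State.setArr_arr, Nat.cast_inj, hi', false_and, if_false, b5]
      exact i1 i' hi' j
    · rw [hval, if_neg (by omega)]
      split_ifs with hji
      · exact e4
      · exact i2 j h1 (by omega)
    · rw [hval, if_pos rfl, i4 _ (by omega)]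
      have := hL_step i h1i (by omega)
      omega
    · rw [hval, if_neg (by omega), if_neg (by omega)]
      exact i4 j (by omega)
    · rw [← i5]
      refine rowSum_carry (i := i) (h := h) ?_ ?_ ?_ ?_
      · rw [hval, if_neg (by omega), if_pos rfl, e1]
      · rw [hval, if_pos rfl]
      · intro j hj hj'
        rw [hval, if_neg hj', if_neg hj]
      · intro hne
        have := hL_two i h1i (by omega) (by omega)
        exact ⟨h1i, this.1, this.2⟩
  · rintro s1 t1 fr - ⟨i1, i2, i3, i4, i5⟩ ht
    refine ⟨i1, fun j h1 h2 => i2 j h1 (by omega), i5, ?_⟩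
    have e : (k + 1 - 1) * (4 * (10 * n + 16) + 8 + 2) ≤
        (10 * n + 16) * (4 * (10 * n + 16) + 8 + 2) := Nat.mul_le_mul_right _ (by omega)
    clear * - e ht
    nlinarith

/-- Remove pairs of opposite digits in adjacent places of the row in register `60`. -/
def fixRow : Prog :=
  .seq (.copy 64 15) <| forDown 64 11 <|
    .seq (.load 67 11 64 10) <| .seq (.copy 65 64) <| .seq (.dec 65) <| .seq (.load 63 5 60 64) <|
      .seq (.load 66 5 60 65) <|
        .branch (.eq 67 11)
          (.seq (.copy 68 63) <| .seq (addTo 68 66 30) <|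
            .branch (.eq 68 10)
              (.branch (.eq 63 66) .skip (.seq (.store 5 60 65 63) (.store 5 60 64 10)))
              .skip)
          .skip

/-- Digits `x` and `-x` at adjacent exponents `e + 1` and `e` may be replaced by `0` and `x`, since
`2x - x = x`. In a downward pass the upper digit of a treated pair becomes `0`, so the pairs above
stay good and a single pass suffices. -/
theorem run_fixRow {s : State} {n k r : ℕ} {F : ℕ → ℕ} (hr : RowRegs n k r s) (hk1 : 1 ≤ k)
    (hadj : ∀ i, 1 ≤ i → i < k →
      s.arr 11 ((i + 1 : ℕ) : ℤ) 0 = if F (i + 1) = F i + 1 then 1 else 0)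
    (hdig : ∀ j : ℕ, 1 ≤ j → j ≤ k → (s.arr 5 r j).natAbs ≤ 1) (hk : k ≤ 10 * n + 16) :
    Run fixRow s fun s' t => (∀ i : ℕ, i ≠ r → ∀ j : ℕ, s'.arr 5 i j = s.arr 5 i j) ∧
      (∀ j : ℕ, 1 ≤ j → j ≤ k → (s'.arr 5 r j).natAbs ≤ 1) ∧
      (∀ j : ℕ, 1 ≤ j → j < k → F (j + 1) = F j + 1 →
        s'.arr 5 r ((j + 1 : ℕ) : ℤ) = - s'.arr 5 r j → s'.arr 5 r j = 0) ∧
      rowSum k F (fun j => s'.arr 5 r j) = rowSum k F (fun j => s.arr 5 r j) ∧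
      t ≤ 500 * (n + 1) := by
  simp only [fixRow, run_seq, run_copy]
  refine Run.forDown (fun i s' => (∀ i : ℕ, i ≠ r → ∀ j : ℕ, s'.arr 5 i j = s.arr 5 i j) ∧
      (∀ j : ℕ, 1 ≤ j → j ≤ k → (s'.arr 5 r j).natAbs ≤ 1) ∧
      (∀ j : ℕ, i ≤ j → j < k → F (j + 1) = F j + 1 →
        s'.arr 5 r ((j + 1 : ℕ) : ℤ) = - s'.arr 5 r j → s'.arr 5 r j = 0) ∧
      rowSum k F (fun j => s'.arr 5 r j) = rowSum k F (fun j => s.arr 5 r j))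
    1 k 22 (by simp [hr.h15]) (by simp [hr.consts.h11]) hk1 rfl rfl rfl ?_ ?_ ?_
  · exact ⟨fun i _ j => rfl, hdig, by intros; omega, rfl⟩
  · rintro i s1 fr h1i hik h64 - ⟨i1, i2, i3, i4⟩
    have hr1 : RowRegs n k r s1 := (hr.setReg (by norm_num) (by norm_num)).of_frame fr rfl rfl
    have h10 := hr1.consts.h10
    have h11 := hr1.consts.h11
    have h60 := hr1.h60
    have a11 : s1.arr 11 = s.arr 11 := by rw [fr.2 11 rfl]; simp
    have hi1 : ((i + 1 : ℕ) : ℤ) - 1 = i := by simp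
    have d1 := i2 i h1i hik.le
    have d2 := i2 (i + 1) (by omega) hik
    have keep : (F (i + 1) = F i + 1 → s1.arr 5 r ((i + 1 : ℕ) : ℤ) = - s1.arr 5 r i →
        s1.arr 5 r i = 0) → ∀ j : ℕ, i ≤ j → j < k → F (j + 1) = F j + 1 →
        s1.arr 5 r ((j + 1 : ℕ) : ℤ) = - s1.arr 5 r j → s1.arr 5 r j = 0 := by
      intro h j hj
      rcases hj.lt_or_eq with hj | rfl
      · exact i3 j hj
      · exact fun _ => h
    simp only [run_seq, run_copy, run_dec, run_load, run_branch, Test.holds_eq, State.setReg_reg,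
      State.setReg_arr, reduceIte, Nat.reduceEqDiff, h10, h11, h60, h64, hi1, a11, hadj i h1i hik,
      run_skip]
    refine ⟨fun had => ?_, fun had => ⟨⟨i1, i2, keep fun hF => ?_, i4⟩, by norm_num⟩⟩
    · have hF : F (i + 1) = F i + 1 := by
        by_contra hne
        simp [hne] at had
      refine (run_addTo (by simp [h10]) (by norm_num) (by norm_num) (by norm_num)).conseq ?_
      rintro s2 t2 fr2 ⟨e68, ht2⟩
      have g10 : s2.reg 10 = 0 := by rw [fr2.1 10 rfl]; simp [h10]
      have g60 : s2.reg 60 = r := by rw [fr2.1 60 rfl]; simp [h60]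
      have g64 : s2.reg 64 = (i + 1 : ℕ) := by rw [fr2.1 64 rfl]; simp [h64]
      have g65 : s2.reg 65 = i := by rw [fr2.1 65 rfl]; simp
      have g63 : s2.reg 63 = s1.arr 5 r ((i + 1 : ℕ) : ℤ) := by rw [fr2.1 63 rfl]; simp
      have g66 : s2.reg 66 = s1.arr 5 r i := by rw [fr2.1 66 rfl]; simp
      have b5 : s2.arr 5 = s1.arr 5 := by rw [fr2.2 5 rfl]; simp
      simp only [State.setReg_reg, reduceIte, Nat.reduceEqDiff] at e68 ht2
      simp only [run_store, State.setArr_reg, g10, g60, g64, g65, g63, g66, e68]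
      refine ⟨fun hs => ⟨fun he => ⟨⟨?_, ?_, ?_, ?_⟩, by omega⟩, fun hne => ?_⟩, fun hs =>
        ⟨⟨?_, ?_, ?_, ?_⟩, by omega⟩⟩
      · simpa [b5] using i1
      · simpa [b5] using i2
      · simp only [b5]
        -- Equal digits with sum `0` are both `0`, so there is nothing to repair.
        exact keep fun _ _ => by omega
      · simpa [b5] using i4
      · have hval : ∀ j : ℕ, ((s2.setArr 5 r i (s1.arr 5 r ((i + 1 : ℕ) : ℤ))).setArr 5 r
            ((i + 1 : ℕ) : ℤ) 0).arr 5 r j = if j = i + 1 then 0 else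
              if j = i then s1.arr 5 r ((i + 1 : ℕ) : ℤ) else s1.arr 5 r j := by
          intro j
          simp only [State.setArr_arr, Nat.cast_inj, true_and, b5]
        refine ⟨⟨fun i' hi' j => ?_, fun j h1 h2 => ?_, fun j h1 h2 hFj => ?_, ?_⟩, by omega⟩
        · simp only [State.setArr_arr, Nat.cast_inj, hi', false_and, if_false, b5]
          exact i1 i' hi' j
        · rw [hval]
          split_ifs
          · simp
          · exact d2
          · exact i2 j h1 h2
        · rw [hval, hval]
          by_cases hj : j = i
          · subst hj
            rw [if_pos rfl, if_neg (by omega), if_pos rfl]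
            omega
          · by_cases hj' : j = i + 1
            · subst hj'
              intro _
              rw [if_pos rfl]
            · rw [if_neg (by omega), if_neg (by omega), if_neg (by omega), if_neg (by omega)]
              exact i3 j (by omega) h2 hFj
        · rw [← i4]
          -- The replacement is a carry of minus the upper digit.
          refine rowSum_carry (i := i) (h := - s1.arr 5 r ((i + 1 : ℕ) : ℤ)) ?_ ?_ ?_
            (fun _ => ⟨h1i, hik, hF⟩)
          · rw [hval, if_neg (by omega), if_pos rfl]
            omega
          · rw [hval, if_pos rfl]
            omega
          · intro j hj hj'
            rw [hval, if_neg hj', if_neg hj]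
      · simpa [b5] using i1
      · simpa [b5] using i2
      · simp only [b5]
        exact keep fun _ _ => by omega
      · simpa [b5] using i4
    · simp [hF] at had
  · rintro s1 t1 fr - ⟨i1, i2, i3, i4⟩ ht
    exact ⟨i1, i2, i3, i4, by omega⟩

/-- Column `0` of the row in register `60` tells whether the row is zero. -/
def flagRow : Prog :=
  .seq (.const 63 1) <| .seq (.const 64 1) <|
    .seq (forUp 64 16 <| .seq (.load 66 5 60 64) (.branch (.eq 66 10) .skip (.const 63 0)))
      (.store 5 60 10 63)

open Classical in
theorem run_flagRow {s : State} {n k r : ℕ} (hr : RowRegs n k r s) (hk : k ≤ 10 * n + 16) :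
    Run flagRow s fun s' t => (∀ i : ℕ, i ≠ r → ∀ j : ℕ, s'.arr 5 i j = s.arr 5 i j) ∧
      (∀ j : ℕ, 1 ≤ j → s'.arr 5 r j = s.arr 5 r j) ∧
      s'.arr 5 r 0 = (if ∀ j : ℕ, 1 ≤ j → j ≤ k → s.arr 5 r j = 0 then 1 else 0) ∧
      t ≤ 100 * (n + 1) := by
  simp only [flagRow, run_seq, run_const]
  refine Run.forUp (fun i s' => s'.reg 63 =
    if ∀ j : ℕ, 1 ≤ j → j < i → s.arr 5 r j = 0 then 1 else 0)
    1 (k + 1) 3 (by simp) (by simp [hr.h16]) (by omega) rfl rfl rfl ?_ ?_ ?_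
  · have : ∀ j : ℕ, 1 ≤ j → j < 1 → s.arr 5 r j = 0 := by intros; omega
    rw [if_pos this]
    simp
  · rintro i s1 fr h1i hik h64 h16 hI
    have hr1 : RowRegs n k r s1 := ((hr.setReg (by norm_num) (by norm_num)).setReg (by norm_num)
      (by norm_num)).of_frame fr rfl rfl
    have a5 : s1.arr 5 = s.arr 5 := by rw [fr.2 5 rfl]; simp
    simp only [run_seq, run_load, run_branch, Test.holds_eq, State.setReg_reg, reduceIte,
      Nat.reduceEqDiff, hr1.h60, hr1.consts.h10, h64, a5, run_skip, run_const, hI]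
    have key : (∀ j : ℕ, 1 ≤ j → j < i + 1 → s.arr 5 r j = 0) ↔
        (∀ j : ℕ, 1 ≤ j → j < i → s.arr 5 r j = 0) ∧ s.arr 5 r i = 0 := by
      constructor
      · exact fun h => ⟨fun j h1 h2 => h j h1 (by omega), h i h1i (by omega)⟩
      · rintro ⟨h, h'⟩ j h1 h2
        rcases Nat.lt_succ_iff_lt_or_eq.1 h2 with h3 | rfl
        · exact h j h1 h3
        · exact h'
    simp only [key]
    exact ⟨fun hz => ⟨by simp [hz], by norm_num⟩, fun hz => ⟨by simp [hz], by norm_num⟩⟩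
  · rintro s1 t1 fr - hI ht
    have hr1 : RowRegs n k r s1 := ((hr.setReg (by norm_num) (by norm_num)).setReg (by norm_num)
      (by norm_num)).of_frame fr rfl rfl
    have a5 : s1.arr 5 = s.arr 5 := by rw [fr.2 5 rfl]; simp
    simp only [run_store, State.setArr_arr, hr1.h60, hr1.consts.h10, hI, a5, Nat.cast_inj]
    refine ⟨fun i hi j => by simp [hi], fun j hj => ?_, ?_, by omega⟩
    · rw [if_neg (by omega)]
    · simp only [and_self, reduceIte, Nat.lt_succ_iff]

/-- Row `r` of the matrix, for `1 ≤ r ≤ k`, expresses the exponent `F r` as a reduced signed sum of the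
powers of `2` with exponents `F 1, …, F k`, and row `k + 1` does this for the number `N`. Zero rows
are flagged in column `0`. -/
structure NormalMatrix (k : ℕ) (F : ℕ → ℕ) (N : ℤ) (D : ℕ → ℕ → ℤ) : Prop where
  zero : ∀ j, D 0 j = 0
  digit : ∀ r, 1 ≤ r → r ≤ k + 1 → ∀ j, 1 ≤ j → j ≤ k → (D r j).natAbs ≤ 1
  opp : ∀ r, 1 ≤ r → r ≤ k + 1 → ∀ j, 1 ≤ j → j < k → F (j + 1) = F j + 1 →
    D r (j + 1) = - D r j → D r j = 0
  sum : ∀ r, 1 ≤ r → r ≤ k → rowSum k F (D r) = F r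
  sum_last : rowSum k F (D (k + 1)) = N
  flag_eq_one : ∀ r, 1 ≤ r → r ≤ k + 1 → (∀ j, 1 ≤ j → j ≤ k → D r j = 0) → D r 0 = 1
  flag_eq_zero : ∀ r, 1 ≤ r → r ≤ k + 1 → ∀ j, 1 ≤ j → j ≤ k → D r j ≠ 0 → D r 0 = 0

/-- Copy the marks to row `n + 1` of array `0`, as if they were the edges leaving a vertex `n + 1`. -/
def prepareRows : Prog :=
  .seq (.copy 17 0) <| .seq (.inc 17) <| .seq (.const 18 (-1)) <| .seq (.const 31 0) <|
    .seq (forUp 31 0 (.seq (.load 43 1 31 10) (.store 0 17 31 43))) <|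
      .seq (.copy 16 15) <| .seq (.inc 16) <| .seq (.copy 19 16) <| .seq (.inc 19) <|
        .seq (.store 9 16 10 17) (.store 10 16 10 10)

/-- Compute all rows of the matrix of exponents. -/
def allRows : Prog :=
  .seq prepareRows <| .seq (.const 60 1) <|
    forUp 60 19 (.seq buildRow <| .seq carryRow <| .seq fixRow flagRow)

/-- The sum is regrouped by places: vertices at place `w` with non-zero value find their own power
there, and `f` stands at place `1`, whose power is `2 ^ 0`. -/
theorem rowSum_build {n k f : ℕ} {nd : ℕ → Prop} {E F pos : ℕ → ℕ} {a : ℕ → ℤ} (hk : 1 ≤ k)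
    (hF : F 1 = 0) (h1 : ∀ w < n, nd w → 1 ≤ pos w ∧ pos w ≤ k ∧ F (pos w) = E w)
    (h0 : ∀ w < n, ¬ nd w → pos w = 0) :
    rowSum k F (fun j => (if j = 1 then (f : ℤ) else 0) + ∑ w ∈ range n with pos w = j, a w) =
      f + ∑ w ∈ range n, a w * val nd E w := by
  simp only [rowSum, add_mul, sum_add_distrib]
  congr 1
  · simp only [ite_mul, zero_mul]
    rw [sum_ite_eq' (Icc 1 k) 1 fun j => (f : ℤ) * 2 ^ F j]
    simp [hk, hF]
  · simp only [sum_filter, sum_mul]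
    rw [sum_comm]
    refine sum_congr rfl fun w hw => ?_
    simp only [ite_mul, zero_mul]
    rw [sum_ite_eq (Icc 1 k) (pos w) fun j => a w * 2 ^ F j]
    rw [mem_range] at hw
    by_cases hn : nd w
    · obtain ⟨p1, p2, p3⟩ := h1 w hw hn
      rw [if_pos (mem_Icc.2 ⟨p1, p2⟩), p3, val, if_pos hn]
    · rw [if_neg (by simp [h0 w hw hn]), val, if_neg hn, mul_zero]

theorem natAbs_sum_le_card {S : Finset ℕ} {a : ℕ → ℤ} (h : ∀ w, (a w).natAbs ≤ 1) :
    (∑ w ∈ S, a w).natAbs ≤ #S := by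
  have h1 : |∑ w ∈ S, a w| ≤ ∑ w ∈ S, |a w| := abs_sum_le_sum_abs _ _
  have h2 : ∑ w ∈ S, |a w| ≤ ∑ w ∈ S, 1 := sum_le_sum fun w _ => by
    have := h w
    rw [Int.abs_eq_natAbs]
    omega
  rw [Int.abs_eq_natAbs] at h1
  simp at h2
  omega

/-- The offset and the edges to vertices at place `1` fit under `L 1` because `L_one` reserves `4 *
n + 8` in addition to one unit per vertex. The carry pass is quadratic, the other passes are linear.
-/
theorem run_row {s : State} {n k r b f : ℕ} {A : ℕ → ℕ → ℤ} {nd : ℕ → Prop} {E F L pos : ℕ → ℕ}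
    (hr : RowRegs n k r s) (hC : Closed n nd E k F L pos s)
    (hA : ∀ i j : ℕ, s.arr 0 i j = A i j) (hA1 : ∀ i j, (A i j).natAbs ≤ 1)
    (hb : s.arr 9 r 0 = b) (hf : s.arr 10 r 0 = f) (hfn : f ≤ 4 * n + 8)
    (h0 : ∀ j : ℕ, s.arr 5 r j = 0) :
    Run (.seq buildRow <| .seq carryRow <| .seq fixRow flagRow) s fun s' t =>
      (∀ i : ℕ, i ≠ r → ∀ j : ℕ, s'.arr 5 i j = s.arr 5 i j) ∧
      (∀ j : ℕ, 1 ≤ j → j ≤ k → (s'.arr 5 r j).natAbs ≤ 1) ∧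
      (∀ j : ℕ, 1 ≤ j → j < k → F (j + 1) = F j + 1 →
        s'.arr 5 r ((j + 1 : ℕ) : ℤ) = - s'.arr 5 r j → s'.arr 5 r j = 0) ∧
      rowSum k F (fun j => s'.arr 5 r j) = f + ∑ w ∈ range n, A b w * val nd E w ∧
      ((∀ j : ℕ, 1 ≤ j → j ≤ k → s'.arr 5 r j = 0) → s'.arr 5 r 0 = 1) ∧
      (∀ j : ℕ, 1 ≤ j → j ≤ k → s'.arr 5 r j ≠ 0 → s'.arr 5 r 0 = 0) ∧
      t ≤ 2300 * (n + 1) ^ 2 := by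
  simp only [run_seq]
  refine (run_buildRow hr hA hA1 hC.pos_eq hb hf h0).conseq ?_
  rintro s1 t1 fr1 ⟨o1, c1, ht1⟩
  have hr1 := hr.of_frame fr1 rfl rfl
  have hcard : ∀ j, (∑ w ∈ range n with pos w = j, A b w).natAbs ≤ #{w ∈ range n | pos w = j} :=
    fun j => natAbs_sum_le_card (hA1 b)
  refine (run_carryRow (F := F) (L := L) hr1 ?_ ?_ hC.L_two hC.L_le hC.le).conseq ?_
  · intro _
    have e := c1 1
    rw [if_pos rfl, Nat.cast_one] at e
    have := hcard 1
    have := hC.L_one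
    omega
  · intro i h1 h2
    rw [c1, if_neg (by omega)]
    have := hcard (i + 1)
    have := hC.L_step i h1 h2
    omega
  rintro s2 t2 fr2 ⟨o2, c2, v2, ht2⟩
  have hr2 := hr1.of_frame fr2 rfl rfl
  refine (run_fixRow (F := F) hr2 hC.one_le ?_ c2 hC.le).conseq ?_
  · rw [fr2.2 11 rfl, fr1.2 11 rfl]
    exact hC.adj
  rintro s3 t3 fr3 ⟨o3, c3, p3, v3, ht3⟩
  have hr3 := hr2.of_frame fr3 rfl rfl
  refine (run_flagRow hr3 hC.le).conseq ?_
  rintro s4 t4 fr4 ⟨o4, e4, z4, ht4⟩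
  refine ⟨fun i hi j => by rw [o4 i hi, o3 i hi, o2 i hi, o1 i hi], fun j h1 h2 => ?_,
    fun j h1 h2 => ?_, ?_, fun h => ?_, fun j h1 h2 hne => ?_, ?_⟩
  · rw [e4 j h1]; exact c3 j h1 h2
  · rw [e4 j h1, e4 (j + 1) (by omega)]; exact p3 j h1 h2
  · rw [rowSum_congr fun j h1 _ => e4 j h1, v3, v2, rowSum_congr fun j _ _ => c1 j]
    exact rowSum_build hC.one_le hC.F_one hC.pos_mem hC.pos_zero
  · rw [z4, if_pos]
    intro j h1 h2
    rw [← e4 j h1]; exact h j h1 h2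
  · rw [z4, if_neg]
    intro h
    rw [e4 j h1] at hne
    exact hne (h j h1 h2)
  · have hsq : n + 1 ≤ (n + 1) ^ 2 := Nat.le_self_pow (by norm_num) _
    clear * - hsq ht1 ht2 ht3 ht4
    generalize (n + 1) ^ 2 = m at *
    omega

theorem run_prepareRows {s : State} {n k : ℕ} {mk : ℕ → ℤ} (hc : Consts n s) (h15 : s.reg 15 = k)
    (hmk : ∀ w : ℕ, s.arr 1 w 0 = mk w) (h0 : ∀ j : ℕ, s.arr 0 ((n + 1 : ℕ) : ℤ) j = 0) :
    Run prepareRows s fun s' t => (∀ i : ℕ, i ≠ n + 1 → ∀ j : ℕ, s'.arr 0 i j = s.arr 0 i j) ∧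
      (∀ j < n, s'.arr 0 ((n + 1 : ℕ) : ℤ) (j : ℕ) = mk j) ∧
      (∀ j, n ≤ j → s'.arr 0 ((n + 1 : ℕ) : ℤ) (j : ℕ) = 0) ∧
      s'.reg 18 = -1 ∧ s'.reg 16 = (k + 1 : ℕ) ∧ s'.reg 19 = (k + 2 : ℕ) ∧
      (∀ r : ℕ, s'.arr 9 r 0 = if r = k + 1 then ((n + 1 : ℕ) : ℤ) else s.arr 9 r 0) ∧
      (∀ r : ℕ, s'.arr 10 r 0 = if r = k + 1 then 0 else s.arr 10 r 0) ∧ t ≤ 20 * (n + 1) := by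
  have hn1 : (n : ℤ) + 1 = ((n + 1 : ℕ) : ℤ) := by simp
  simp only [prepareRows, run_seq, run_copy, run_inc, run_const, State.setReg_reg, reduceIte,
    hc.h0, hn1]
  refine Run.forUp (fun i s' => (∀ i : ℕ, i ≠ n + 1 → ∀ j : ℕ, s'.arr 0 i j = s.arr 0 i j) ∧
      (∀ j < i, s'.arr 0 ((n + 1 : ℕ) : ℤ) (j : ℕ) = mk j) ∧
      (∀ j, i ≤ j → s'.arr 0 ((n + 1 : ℕ) : ℤ) (j : ℕ) = 0))
    0 n 2 (by simp) (by simp [hc.h0]) (by omega) rfl rfl rfl ?_ ?_ ?_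
  · exact ⟨fun _ _ _ => rfl, by intros; omega, fun j _ => h0 j⟩
  · rintro i s1 fr - hi h31 hreg ⟨i1, i2, i3⟩
    have e10 : s1.reg 10 = 0 := by rw [fr.1 10 rfl]; simp [hc.h10]
    have e17 : s1.reg 17 = (n + 1 : ℕ) := by rw [fr.1 17 rfl]; simp
    have a1 : s1.arr 1 = s.arr 1 := by rw [fr.2 1 rfl]; simp
    simp only [run_seq, run_load, run_store, State.setReg_reg, State.setReg_arr, reduceIte,
      Nat.reduceEqDiff, e10, e17, h31, a1, hmk, State.setArr_arr, Nat.cast_inj, true_and]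
    refine ⟨⟨fun i' hi' j => ?_, fun j hj => ?_, fun j hj => ?_⟩, by omega⟩
    · simp only [hi', false_and, if_false, i1 i' hi' j]
    · by_cases hji : j = i
      · simp [hji]
      · rw [if_neg hji, i2 j (by omega)]
    · rw [if_neg (by omega), i3 j (by omega)]
  · rintro s1 t1 fr - ⟨i1, i2, i3⟩ ht
    have e10 : s1.reg 10 = 0 := by rw [fr.1 10 rfl]; simp [hc.h10]
    have e15 : s1.reg 15 = k := by rw [fr.1 15 rfl]; simp [h15]
    have e17 : s1.reg 17 = (n + 1 : ℕ) := by rw [fr.1 17 rfl]; simp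
    have e18 : s1.reg 18 = -1 := by rw [fr.1 18 rfl]; simp
    have a9 : s1.arr 9 = s.arr 9 := by rw [fr.2 9 rfl]; simp
    have a10 : s1.arr 10 = s.arr 10 := by rw [fr.2 10 rfl]; simp
    have hk1 : (k : ℤ) + 1 = ((k + 1 : ℕ) : ℤ) := by simp
    have hk2 : ((k + 1 : ℕ) : ℤ) + 1 = ((k + 2 : ℕ) : ℤ) := by push_cast; ring
    simp only [run_store, State.setReg_reg, State.setArr_reg, reduceIte,
      Nat.reduceEqDiff, e10, e15, e17, e18, hk1, hk2]
    refine ⟨?_, ?_, ?_, trivial, trivial, trivial, fun r => ?_, fun r => ?_, by omega⟩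
    · simpa using i1
    · simpa using i2
    · simpa using i3
    · rw [State.setArr_arr_of_ne _ (by norm_num), State.setArr_arr]
      simp only [Nat.cast_inj, and_true, State.setReg_arr, a9]
    · rw [State.setArr_arr, State.setArr_arr_of_ne _ (by norm_num)]
      simp only [Nat.cast_inj, and_true, State.setReg_arr, a10]

/-- There are linearly many rows, each obtained in quadratic time. Treating the marks as the edges
of a vertex `n + 1` lets the value of the circuit be normalized like an exponent. -/
theorem run_allRows {s : State} {n k : ℕ} {A : ℕ → ℕ → ℤ} {nd : ℕ → Prop} {E F L pos : ℕ → ℕ}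
    {mk : ℕ → ℤ} (hc : Consts n s) (hCl : Closed n nd E k F L pos s) (hC : Circ n A nd E)
    (hA : ∀ i j : ℕ, s.arr 0 i j = A i j) (hmk : ∀ w : ℕ, s.arr 1 w 0 = mk w)
    (hmk1 : ∀ w, (mk w).natAbs ≤ 1) (h5 : ∀ i j : ℕ, s.arr 5 i j = 0) :
    Run allRows s fun s' t => s'.reg 16 = (k + 1 : ℕ) ∧
      NormalMatrix k F (∑ w ∈ range n, mk w * val nd E w) (fun i j => s'.arr 5 i j) ∧
      t ≤ 42000 * (n + 1) ^ 3 := by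
  simp only [allRows, run_seq]
  refine (run_prepareRows hc hCl.reg hmk ?_).conseq ?_
  · intro j
    rw [hA]
    by_contra h
    have := (hC.supp _ _ h).1
    omega
  rintro s1 t1 fr1 ⟨p1, p2, p3, p18, p16, p19, p9, p10, ht1⟩
  have hc1 := hc.of_frame fr1 rfl
  have e15 : s1.reg 15 = k := by rw [fr1.1 15 rfl, hCl.reg]
  -- The matrix now has the row `n + 1` of marks, so it agrees with the original one only on rows up
  -- to `n`.
  set A' : ℕ → ℕ → ℤ := fun i j => s1.arr 0 i j with hA'
  have hA'n : ∀ b ≤ n, ∀ j, A' b j = A b j := fun b hb j => by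
    rw [hA', ← hA]; exact p1 b (by omega) j
  have hA'1 : ∀ i j, (A' i j).natAbs ≤ 1 := by
    intro i j
    by_cases hi : i = n + 1
    · subst hi
      by_cases hj : j < n
      · simp only [hA', p2 j hj]; exact hmk1 j
      · simp only [hA', p3 j (by omega)]; simp
    · simp only [hA', p1 i hi j, hA]; exact hC.abs i j
  have hCl1 : ∀ s2 : State, s2.reg 15 = k → s2.arr 8 = s1.arr 8 → s2.arr 9 = s1.arr 9 →
      s2.arr 10 = s1.arr 10 → s2.arr 11 = s1.arr 11 → Closed n nd E k F L pos s2 := by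
    intro s2 q15 q8 q9 q10 q11
    refine { hCl with reg := q15, base := ?_, adj := ?_, pos_eq := ?_ }
    · intro r h1 h2
      rw [q9, q10, p9, p10, if_neg (by omega), if_neg (by omega)]
      exact hCl.base r h1 h2
    · rw [q11, fr1.2 11 rfl]; exact hCl.adj
    · rw [q8, fr1.2 8 rfl]; exact hCl.pos_eq
  -- The base of a row is a genuine vertex with its exponent equation, or the artificial vertex `n`
  -- with the empty sum, or, for the last row, the marks with offset `0`.
  have hbase : ∀ r, 1 ≤ r → r ≤ k + 1 → ∃ b f : ℕ, s1.arr 9 r 0 = b ∧ s1.arr 10 r 0 = f ∧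
      f ≤ 4 * n + 8 ∧ (r ≤ k → f + ∑ w ∈ range n, A' b w * val nd E w = F r) ∧
      (r = k + 1 → f + ∑ w ∈ range n, A' b w * val nd E w =
        ∑ w ∈ range n, mk w * val nd E w) := by
    intro r h1 h2
    rcases h2.lt_or_eq with h2 | rfl
    · obtain ⟨b, hb, hnb, f, e1, e2, e3, e4⟩ := hCl.base r h1 (by omega)
      refine ⟨b, f, by rw [p9, if_neg (by omega), e1], by rw [p10, if_neg (by omega), e2], e4,
        fun _ => ?_, by omega⟩
      rw [sum_congr rfl fun w _ => by rw [hA'n b hb w], ← e3]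
      rcases hb.lt_or_eq with hb | rfl
      · rw [← hC.exp b hb hnb]
        push_cast
        ring
      · have hz : ∀ w, A b w = 0 := fun w => by
          by_contra h
          exact absurd (hC.supp _ _ h).1 (lt_irrefl _)
        simp [hz, hC.E_last]
    · refine ⟨n + 1, 0, by rw [p9, if_pos rfl], by rw [p10, if_pos rfl]; rfl, by omega, by omega,
        fun _ => ?_⟩
      rw [Nat.cast_zero, zero_add]
      refine sum_congr rfl fun w hw => ?_
      simp only [hA', p2 w (mem_range.1 hw)]
  rw [run_const]
  refine Run.forUp (fun i s' => (∀ r : ℕ, r < 1 ∨ i ≤ r → ∀ j : ℕ, s'.arr 5 r j = 0) ∧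
      ∀ r : ℕ, 1 ≤ r → r < i →
        (∀ j : ℕ, 1 ≤ j → j ≤ k → (s'.arr 5 r j).natAbs ≤ 1) ∧
        (∀ j : ℕ, 1 ≤ j → j < k → F (j + 1) = F j + 1 →
          s'.arr 5 r ((j + 1 : ℕ) : ℤ) = - s'.arr 5 r j → s'.arr 5 r j = 0) ∧
        (r ≤ k → rowSum k F (fun j => s'.arr 5 r j) = F r) ∧
        (r = k + 1 → rowSum k F (fun j => s'.arr 5 r j) = ∑ w ∈ range n, mk w * val nd E w) ∧
        ((∀ j : ℕ, 1 ≤ j → j ≤ k → s'.arr 5 r j = 0) → s'.arr 5 r 0 = 1) ∧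
        (∀ j : ℕ, 1 ≤ j → j ≤ k → s'.arr 5 r j ≠ 0 → s'.arr 5 r 0 = 0))
    1 (k + 2) (2300 * (n + 1) ^ 2) (by simp) (by simp [p19]) (by omega) rfl rfl rfl ?_ ?_ ?_
  · refine ⟨fun r _ j => ?_, by intros; omega⟩
    rw [State.setReg_arr, fr1.2 5 rfl, h5]
  · rintro r s2 fr2 h1r hrk h60 - ⟨i1, i2⟩
    have hr2 : RowRegs n k r s2 := by
      refine ⟨Consts.of_frame (s := s1.setReg 60 1) ?_ fr2 rfl, ?_, ?_, ?_, h60⟩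
      · constructor <;> simp [hc1.h0, hc1.h10, hc1.h11, hc1.h12, hc1.h13]
      · rw [fr2.1 15 rfl]; simp [e15]
      · rw [fr2.1 16 rfl]; simp [p16]
      · rw [fr2.1 18 rfl]; simp [p18]
    have b9 : s2.arr 9 = s1.arr 9 := by rw [fr2.2 9 rfl]; simp
    have b10 : s2.arr 10 = s1.arr 10 := by rw [fr2.2 10 rfl]; simp
    have b8 : s2.arr 8 = s1.arr 8 := by rw [fr2.2 8 rfl]; simp
    have b11 : s2.arr 11 = s1.arr 11 := by rw [fr2.2 11 rfl]; simp
    have b0 : s2.arr 0 = s1.arr 0 := by rw [fr2.2 0 rfl]; simp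
    obtain ⟨b, f, e1, e2, e3, e4, e5⟩ := hbase r h1r (by omega)
    refine (run_row (A := A') hr2 (hCl1 s2 hr2.h15 b8 b9 b10 b11) (by simp [b0, hA']) hA'1
      (by rw [b9, e1]) (by rw [b10, e2]) e3 (i1 r (.inr le_rfl))).conseq ?_
    rintro s3 t3 fr3 ⟨q1, q2, q3, q4, q5, q6, ht3⟩
    refine ⟨⟨fun r' hr' j => ?_, fun r' h1 h2 => ?_⟩, ht3⟩
    · rw [State.setReg_arr, q1 r' (by omega)]
      exact i1 r' (by omega) j
    · rw [State.setReg_arr]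
      by_cases hrr : r' = r
      · subst hrr
        exact ⟨q2, q3, fun h => by rw [q4, e4 h], fun h => by rw [q4, e5 h], q5, q6⟩
      · have q1' : (s3.arr 5 r' : ℤ → ℤ) 0 = s2.arr 5 r' 0 := q1 r' hrr 0
        simp only [q1 r' hrr, q1']
        exact i2 r' h1 (by omega)
  · rintro s2 t2 fr2 - ⟨i1, i2⟩ ht2
    refine ⟨by rw [fr2.1 16 rfl]; simp [p16], ?_, ?_⟩
    · constructor
      · exact fun j => i1 0 (.inl (by omega)) j
      · exact fun r h1 h2 => (i2 r h1 (by omega)).1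
      · exact fun r h1 h2 => (i2 r h1 (by omega)).2.1
      · exact fun r h1 h2 => (i2 r h1 (by omega)).2.2.1 h2
      · exact (i2 (k + 1) (by omega) (by omega)).2.2.2.1 rfl
      · exact fun r h1 h2 => (i2 r h1 (by omega)).2.2.2.2.1
      · exact fun r h1 h2 => (i2 r h1 (by omega)).2.2.2.2.2
    · have hsq : n + 1 ≤ (n + 1) ^ 2 := Nat.le_self_pow (by norm_num) _
      have hle := hCl.le
      have e : (k + 2 - 1) * (2300 * (n + 1) ^ 2 + 2) ≤ (17 * (n + 1)) * (2302 * (n + 1) ^ 2) :=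
        Nat.mul_le_mul (by omega) (by omega)
      have e2 : (17 * (n + 1)) * (2302 * (n + 1) ^ 2) = 39134 * (n + 1) ^ 3 := by ring
      have e3 : n + 1 ≤ (n + 1) ^ 3 := Nat.le_self_pow (by norm_num) _
      clear * - e e2 e3 ht1 ht2
      generalize (n + 1) ^ 3 = m at *
      omega

/-! ### Estimates for reduced signed sums of powers of two -/

theorem rowSum_succ (t : ℕ) (F : ℕ → ℕ) (c : ℕ → ℤ) :
    rowSum (t + 1) F c = rowSum t F c + c (t + 1) * 2 ^ F (t + 1) :=
  sum_Icc_succ_top (by omega) _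

/-- Each further place at most doubles the bound, since `2 ^ e + 2 ^ e ≤ 2 ^ e'` for `e < e'`. -/
theorem abs_rowSum_lt {k : ℕ} {F : ℕ → ℕ} {c : ℕ → ℤ}
    (hF : ∀ r, 1 ≤ r → r < k → F r < F (r + 1)) (hc : ∀ j, 1 ≤ j → j ≤ k → (c j).natAbs ≤ 1)
    {t : ℕ} (ht : t + 1 ≤ k) : |rowSum t F c| < 2 ^ F (t + 1) := by
  induction t with
  | zero => simp [rowSum]
  | succ t ih =>
    have h1 := ih (by omega)
    have h2 : |c (t + 1)| ≤ 1 := by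
      have := hc (t + 1) (by omega) (by omega)
      rw [Int.abs_eq_natAbs]
      omega
    have h3 : (2 : ℤ) ^ (F (t + 1) + 1) ≤ 2 ^ F (t + 1 + 1) :=
      pow_le_pow_right₀ (by norm_num) (hF (t + 1) (by omega) (by omega))
    have h4 : |c (t + 1) * 2 ^ F (t + 1)| ≤ 2 ^ F (t + 1) := by
      rw [abs_mul, abs_of_nonneg (by positivity : (0 : ℤ) ≤ 2 ^ F (t + 1))]
      exact mul_le_of_le_one_left (by positivity) h2
    rw [rowSum_succ]
    have h5 := abs_add_le (rowSum t F c) (c (t + 1) * 2 ^ F (t + 1))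
    rw [pow_succ] at h3
    linarith

theorem rowSum_eq_of_zero {k t : ℕ} {F : ℕ → ℕ} {c : ℕ → ℤ} (htk : t ≤ k)
    (h : ∀ j, t < j → j ≤ k → c j = 0) : rowSum k F c = rowSum t F c := by
  induction k, htk using Nat.le_induction with
  | base => rfl
  | succ k htk ih =>
    rw [rowSum_succ, h (k + 1) (by omega) le_rfl, zero_mul, add_zero]
    exact ih fun j h1 h2 => h j h1 (by omega)

theorem strictMono_F {k : ℕ} {F : ℕ → ℕ} (hF : ∀ r, 1 ≤ r → r < k → F r < F (r + 1)) {i j : ℕ}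
    (hi : 1 ≤ i) (hij : i < j) (hj : j ≤ k) : F i < F j := by
  induction j, hij using Nat.le_induction with
  | base => exact hF i hi (by omega)
  | succ j hij ih => exact (ih (by omega)).trans (hF j (by omega) (by omega))

/-- In a reduced signed sum of powers of `2` with a non-negative value, this value exceeds the
exponents that occur. -/
theorem exponent_lt {k : ℕ} {F : ℕ → ℕ} {c : ℕ → ℤ} (hF1 : F 1 = 0)
    (hF : ∀ r, 1 ≤ r → r < k → F r < F (r + 1)) (hc : ∀ j, 1 ≤ j → j ≤ k → (c j).natAbs ≤ 1)
    (hopp : ∀ j, 1 ≤ j → j < k → F (j + 1) = F j + 1 → c (j + 1) = - c j → c j = 0)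
    (h0 : 0 ≤ rowSum k F c) {j : ℕ} (hj1 : 1 ≤ j) (hjk : j ≤ k) (hj : c j ≠ 0) :
    (F j : ℤ) < rowSum k F c := by
  classical
  obtain ⟨t, ht, hmax⟩ := exists_max_image ((Icc 1 k).filter fun i => c i ≠ 0) id
    ⟨j, mem_filter.2 ⟨mem_Icc.2 ⟨hj1, hjk⟩, hj⟩⟩
  rw [mem_filter, mem_Icc] at ht
  obtain ⟨⟨ht1, htk⟩, htc⟩ := ht
  have hz : ∀ i, t < i → i ≤ k → c i = 0 := fun i h1 h2 => by
    by_contra h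
    have := hmax i (mem_filter.2 ⟨mem_Icc.2 ⟨by omega, h2⟩, h⟩)
    simp at this
    omega
  have hjt : j ≤ t := hmax j (mem_filter.2 ⟨mem_Icc.2 ⟨hj1, hjk⟩, hj⟩)
  have hFjt : F j ≤ F t := by
    rcases hjt.lt_or_eq with h | rfl
    · exact (strictMono_F hF hj1 h htk).le
    · exact le_rfl
  refine lt_of_le_of_lt (Int.ofNat_le.2 hFjt) ?_
  rw [rowSum_eq_of_zero htk hz] at h0 ⊢
  obtain ⟨t, rfl⟩ : ∃ t', t = t' + 1 := ⟨t - 1, by omega⟩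
  have hlt := abs_rowSum_lt hF hc htk
  rw [abs_lt] at hlt
  have hd := hc (t + 1) ht1 htk
  -- The leading power outweighs the rest, so a non-negative value has leading digit `1`.
  have hct : c (t + 1) = 1 := by
    by_contra hne
    have : c (t + 1) = -1 := by omega
    rw [rowSum_succ, this] at h0
    linarith
  rw [rowSum_succ, hct, one_mul]
  rcases Nat.eq_zero_or_pos t with rfl | ht0
  · simp [rowSum, hF1]
  obtain ⟨t, rfl⟩ : ∃ t', t = t' + 1 := ⟨t - 1, by omega⟩
  have hltF := hF (t + 1) (by omega) (by omega)
  obtain ⟨m, hm⟩ : ∃ m, F (t + 1 + 1) = m + 1 := ⟨F (t + 1 + 1) - 1, by omega⟩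
  -- The part below the leading power `2 ^ (m + 1)` is greater than `-2 ^ m`: if the next place has
  -- exponent `m`, its digit is not `-1` by `hopp`; otherwise its exponent is below `m` and there is
  -- room for a digit `-1`.
  have key : -(2 : ℤ) ^ m < rowSum (t + 1) F c := by
    have hlt' := abs_rowSum_lt (t := t) hF hc (by omega)
    rw [abs_lt] at hlt'
    have hd' := hc (t + 1) (by omega) (by omega)
    have hp : (0 : ℤ) < 2 ^ F (t + 1) := by positivity
    rw [rowSum_succ]
    by_cases hadj : m = F (t + 1)
    · have h5 := hopp (t + 1) (by omega) (by omega) (by omega)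
      have h6 : 0 ≤ c (t + 1) := by
        rw [hct] at h5
        omega
      rw [hadj]
      nlinarith
    · have h7 : (2 : ℤ) ^ (F (t + 1) + 1) ≤ 2 ^ m := pow_le_pow_right₀ (by norm_num) (by omega)
      rw [pow_succ] at h7
      have h8 : -1 ≤ c (t + 1) := by omega
      nlinarith
  -- The value exceeds `2 ^ (m + 1) - 2 ^ m = 2 ^ m`, and `2 ^ m ≥ m + 1`, the leading exponent.
  have hm2 : (m : ℤ) < 2 ^ m := by exact_mod_cast Nat.lt_two_pow_self
  rw [hm, pow_succ]
  push_cast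
  linarith

/-! ### From the matrix to a reduced circuit -/

/-- The rows that are needed to express the last one. -/
inductive Used (k : ℕ) (D : ℕ → ℕ → ℤ) : ℕ → Prop
  | root : Used k D (k + 1)
  | step {t s : ℕ} (ht : Used k D t) (hs : s ≤ k) (hD : D t s ≠ 0) : Used k D s

theorem Used.le {k : ℕ} {D : ℕ → ℕ → ℤ} {s : ℕ} (h : Used k D s) : s ≤ k + 1 := by
  cases h with
  | root => exact le_rfl
  | step _ hs _ => omega

theorem signType_coe_eq {x : ℤ} (hx : x.natAbs ≤ 1) : ((SignType.sign x : SignType) : ℤ) = x := by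
  have : x = -1 ∨ x = 0 ∨ x = 1 := by omega
  rcases this with rfl | rfl | rfl <;> rfl

theorem signType_coe_int_real (σ : SignType) : ((σ : ℤ) : ℝ) = (σ : ℝ) := by
  cases σ <;> simp

/-- The value of the `s`-th chain element; the element `0` is the leaf. -/
noncomputable def chainVal (F : ℕ → ℕ) (s : ℕ) : ℝ := if s = 0 then 0 else 2 ^ F s

theorem sum_chainVal (k : ℕ) (F : ℕ → ℕ) (c : ℕ → ℤ) :
    ∑ s ∈ range (k + 1), (c s : ℝ) * chainVal F s = (rowSum k F c : ℤ) := by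
  rw [sum_range_succ', chainVal, if_pos rfl, mul_zero, add_zero, rowSum, range_eq_Ico,
    sum_Ico_add' (fun s => (c s : ℝ) * chainVal F s) 0 k 1]
  push_cast
  refine sum_congr rfl fun s hs => ?_
  have := (mem_Icc.1 hs).1
  rw [chainVal, if_neg (by omega)]

namespace NormalMatrix

variable {k : ℕ} {F : ℕ → ℕ} {N : ℤ} {D : ℕ → ℕ → ℤ}

theorem natAbs_le (h : NormalMatrix k F N D) {r j : ℕ} (hr : r ≤ k + 1) (hj : j ≤ k) :
    (D r j).natAbs ≤ 1 := by
  rcases Nat.eq_zero_or_pos r with rfl | hr0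
  · rw [h.zero]; simp
  rcases Nat.eq_zero_or_pos j with rfl | hj0
  · by_cases hz : ∀ j, 1 ≤ j → j ≤ k → D r j = 0
    · rw [h.flag_eq_one r hr0 hr hz]; simp
    · push Not at hz
      obtain ⟨j, h1, h2, h3⟩ := hz
      rw [h.flag_eq_zero r hr0 hr j h1 h2 h3]; simp
  · exact h.digit r hr0 hr j hj0 hj

/-- This yields acyclicity. The value of row `r` is its exponent `F r`, and by `exponent_lt` it
exceeds every exponent occurring in the row. For the last row the claim is trivial. -/
theorem lt (h : NormalMatrix k F N D) (hF1 : F 1 = 0) (hF : ∀ r, 1 ≤ r → r < k → F r < F (r + 1))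
    {r j : ℕ} (hr : r ≤ k + 1) (hj : j ≤ k) (hD : D r j ≠ 0) : j < r := by
  rcases Nat.eq_zero_or_pos r with rfl | hr0
  · exact absurd (h.zero j) hD
  rcases Nat.eq_zero_or_pos j with rfl | hj0
  · exact hr0
  rcases hr.lt_or_eq with hr' | rfl
  · have h1 := exponent_lt hF1 hF (h.digit r hr0 hr) (h.opp r hr0 hr)
      (by rw [h.sum r hr0 (by omega)]; simp) hj0 hj hD
    rw [h.sum r hr0 (by omega), Nat.cast_lt] at h1
    by_contra hrj
    rcases (not_lt.1 hrj).lt_or_eq with h2 | rfl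
    · exact absurd (strictMono_F hF hr0 h2 hj) (by omega)
    · omega
  · omega

/-- Because of the flag, a row without digits still has an edge to place `0`; hence place `0` will
be the only leaf. -/
theorem exists_ne (h : NormalMatrix k F N D) {r : ℕ} (hr0 : 1 ≤ r) (hr : r ≤ k + 1) :
    ∃ j ≤ k, D r j ≠ 0 := by
  by_cases hz : ∀ j, 1 ≤ j → j ≤ k → D r j = 0
  · exact ⟨0, by omega, by rw [h.flag_eq_one r hr0 hr hz]; simp⟩
  · push Not at hz
    obtain ⟨j, -, h2, h3⟩ := hz
    exact ⟨j, h2, h3⟩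

theorem used_zero (h : NormalMatrix k F N D) (hF1 : F 1 = 0)
    (hF : ∀ r, 1 ≤ r → r < k → F r < F (r + 1)) {s : ℕ} (hs : Used k D s) : Used k D 0 := by
  induction s using Nat.strong_induction_on with
  | _ s ih =>
    rcases Nat.eq_zero_or_pos s with rfl | hs0
    · exact hs
    · obtain ⟨j, hj, hD⟩ := h.exists_ne hs0 hs.le
      exact ih j (h.lt hF1 hF hs.le hj hD) (hs.step hj hD)

/-- The needed rows of the matrix are a reduced circuit. -/
theorem exists_reduct (h : NormalMatrix k F N D) (hF1 : F 1 = 0)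
    (hF : ∀ r, 1 ≤ r → r < k → F r < F (r + 1)) {m : ℕ} {u : ℕ → ℕ}
    (hu : ∀ i j, i < j → j < m → u i < u j) (hU : ∀ i < m, Used k D (u i) ∧ u i ≤ k)
    (hU' : ∀ s ≤ k, Used k D s → ∃ i < m, u i = s) :
    ∃ Q : PowerCircuit (Fin m), (∀ i j : Fin m, (Q.lab i j : ℤ) = D (u i) (u j)) ∧
      (∀ i : Fin m, (Q.mark i : ℤ) = D (k + 1) (u i)) ∧ Q.IsReduced ∧ Q.IsProper ∧ Q.eval = N ∧
      ∀ i j : Fin m, i < j → Q.value i < Q.value j := by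
  have huinj : ∀ i j : Fin m, u i = u j → i = j := fun i j hij => by
    rcases lt_trichotomy i j with h1 | h1 | h1
    · exact absurd hij (hu i j h1 j.2).ne
    · exact h1
    · exact absurd hij.symm (hu j i h1 i.2).ne
  have huk : ∀ i : Fin m, u i ≤ k := fun i => (hU i i.2).2
  have huu : ∀ i : Fin m, Used k D (u i) := fun i => (hU i i.2).1
  have hlt : ∀ i j : Fin m, D (u i) (u j) ≠ 0 → u j < u i := fun i j =>
    h.lt hF1 hF ((huk i).trans (by omega)) (huk j)
  have hget : ∀ s ≤ k, Used k D s → ∃ i : Fin m, u i = s := fun s hs hus => by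
    obtain ⟨i, hi, hi'⟩ := hU' s hs hus
    exact ⟨⟨i, hi⟩, hi'⟩
  -- Places outside the list have coefficient `0` in a needed row, as needed rows are closed under
  -- successors.
  have hsum : ∀ r, Used k D r →
      ∑ j : Fin m, (D r (u j) : ℝ) * chainVal F (u j) = (rowSum k F (D r) : ℤ) := by
    intro r hr
    rw [← sum_chainVal, ← sum_image (s := univ) (g := fun j : Fin m => u j)
      (f := fun s => (D r s : ℝ) * chainVal F s) (fun i _ j _ hij => huinj i j hij)]
    refine sum_subset (fun s hs => ?_) fun s hs hns => ?_
    · obtain ⟨j, -, rfl⟩ := mem_image.1 hs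
      have := huk j
      simp
      omega
    · have hsk : s ≤ k := by simpa [Nat.lt_succ_iff] using hs
      by_cases hD : D r s = 0
      · rw [hD]; simp
      · obtain ⟨i, hi⟩ := hget s hsk (hr.step hsk hD)
        exact absurd (mem_image.2 ⟨i, mem_univ _, hi⟩) hns
  have hlab : ∀ i j : Fin m, ((SignType.sign (D (u i) (u j)) : SignType) : ℤ) = D (u i) (u j) :=
    fun i j => signType_coe_eq (h.natAbs_le ((huk i).trans (by omega)) (huk j))
  have hmark : ∀ i : Fin m, ((SignType.sign (D (k + 1) (u i)) : SignType) : ℤ) = D (k + 1) (u i) :=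
    fun i => signType_coe_eq (h.natAbs_le le_rfl (huk i))
  let Q : PowerCircuit (Fin m) :=
    { lab := fun i j => SignType.sign (D (u i) (u j))
      mark := fun i => SignType.sign (D (k + 1) (u i))
      acyclic := by
        intro v hv
        have key : ∀ a b : Fin m, Relation.TransGen
            (fun a b : Fin m => (SignType.sign (D (u a) (u b)) : SignType) ≠ 0) a b →
            u b < u a := by
          intro a b hab
          induction hab with
          | single h1 => exact hlt _ _ (by rwa [Ne, sign_eq_zero_iff] at h1)
          | tail _ h1 ih => exact (hlt _ _ (by rwa [Ne, sign_eq_zero_iff] at h1)).trans ih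
        exact lt_irrefl _ (key v v hv)
      exists_marked := by
        obtain ⟨j, hj, hD⟩ := h.exists_ne (r := k + 1) (by omega) le_rfl
        obtain ⟨i, hi⟩ := hget j hj (Used.root.step hj hD)
        exact ⟨i, by rwa [Ne, sign_eq_zero_iff, hi]⟩ }
  have hE : ∀ i j : Fin m, Q.Edge i j ↔ D (u i) (u j) ≠ 0 := fun i j => by
    show (SignType.sign (D (u i) (u j)) : SignType) ≠ 0 ↔ _
    rw [Ne, sign_eq_zero_iff]
  have hM : ∀ i : Fin m, Q.Marked i ↔ D (k + 1) (u i) ≠ 0 := fun i => by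
    show (SignType.sign (D (k + 1) (u i)) : SignType) ≠ 0 ↔ _
    rw [Ne, sign_eq_zero_iff]
  have hZ : ∀ i : Fin m, Q.IsZeroVertex i ↔ u i = 0 := by
    intro i
    constructor
    · intro hz
      by_contra hne
      obtain ⟨j, hj, hD⟩ := h.exists_ne (r := u i) (by omega) ((huk i).trans (by omega))
      obtain ⟨i', hi'⟩ := hget j hj ((huu i).step hj hD)
      exact hz i' ((hE i i').2 (by rwa [hi']))
    · intro hz w hw
      rw [hE, hz, h.zero] at hw
      exact hw rfl
  have hlabR : ∀ i j : Fin m, (Q.lab i j : ℝ) = D (u i) (u j) := fun i j => by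
    rw [← signType_coe_int_real]
    exact congrArg _ (hlab i j)
  have hmarkR : ∀ i : Fin m, (Q.mark i : ℝ) = D (k + 1) (u i) := fun i => by
    rw [← signType_coe_int_real]
    exact congrArg _ (hmark i)
  have hval : ∀ i : Fin m, Q.value i = chainVal F (u i) := by
    intro i
    induction i using (Q.wellFounded_edge).induction with
    | _ i ih =>
      rw [Q.value_eq]
      by_cases hz : u i = 0
      · rw [if_pos ((hZ i).2 hz), chainVal, if_pos hz]
      · rw [if_neg (mt (hZ i).1 hz), chainVal, if_neg hz]
        have : ∑ w : Fin m, (Q.lab i w : ℝ) * Q.value w =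
            ∑ w : Fin m, (D (u i) (u w) : ℝ) * chainVal F (u w) := by
          refine sum_congr rfl fun w _ => ?_
          rw [hlabR]
          by_cases hw : D (u i) (u w) = 0
          · rw [hw]; simp
          · rw [ih w ((hE i w).2 hw)]
        rw [this, hsum _ (huu i), h.sum (u i) (by omega) (huk i)]
        simp
  have hvpos : ∀ i : Fin m, u i ≠ 0 → chainVal F (u i) = 2 ^ F (u i) := fun i hi => by
    rw [chainVal, if_neg hi]
  have hvlt : ∀ i j : Fin m, i < j → Q.value i < Q.value j := by
    intro i j hij
    have h1 := hu i j hij j.2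
    rw [hval, hval, hvpos j (by omega)]
    by_cases hz : u i = 0
    · rw [chainVal, if_pos hz]; positivity
    · rw [hvpos i hz]
      exact pow_lt_pow_right₀ (by norm_num) (strictMono_F hF (by omega) h1 (huk j))
  have hvinj : ∀ i j : Fin m, Q.value i = Q.value j ↔ i = j := by
    intro i j
    refine ⟨fun hij => ?_, fun hij => by rw [hij]⟩
    rcases lt_trichotomy i j with h1 | h1 | h1
    · exact absurd hij (hvlt i j h1).ne
    · exact h1
    · exact absurd hij.symm (hvlt j i h1).ne
  have heval : Q.eval = N := by
    rw [PowerCircuit.eval]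
    simp only [hmarkR, hval]
    rw [hsum _ Used.root, h.sum_last]
  refine ⟨Q, hlab, hmark, ⟨?_, hvinj, fun v w₁ w₂ => ⟨?_, ?_⟩⟩, ⟨N, heval, fun v => ?_⟩, heval, hvlt⟩
  -- If the row of the marks has no digits, its flag marks place `0`, nothing else is needed, and
  -- the circuit is trivial.
  · by_cases hz : ∀ j, 1 ≤ j → j ≤ k → D (k + 1) j = 0
    · left
      have key : ∀ s, Used k D s → s = k + 1 ∨ s = 0 := by
        intro s hs
        induction hs with
        | root => exact .inl rfl
        | @step t s ht hs hD ih =>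
          right
          by_contra hs0
          rcases ih with rfl | rfl
          · exact hD (hz s (by omega) hs)
          · exact hD (h.zero s)
      have h00 := h.flag_eq_one (k + 1) (by omega) le_rfl hz
      obtain ⟨i, hi⟩ := hget 0 (by omega) (Used.root.step (by omega) (by rw [h00]; simp))
      refine ⟨i, (hM i).2 (by rw [hi, h00]; simp), fun w => huinj _ _ ?_⟩
      rw [hi]
      rcases key _ (huu w) with h1 | h1
      · have := huk w; omega
      · exact h1
    · right
      push Not at hz
      obtain ⟨j, hj1, hjk, hj⟩ := hz
      refine ⟨?_, ?_, ?_, ?_⟩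
      · have key : ∀ s, Used k D s → s = k + 1 ∨ ∃ i : Fin m, u i = s ∧
            ∃ a, Q.Marked a ∧ Relation.ReflTransGen Q.Edge a i := by
          intro s hs
          induction hs with
          | root => exact .inl rfl
          | @step t s ht hs hD ih =>
            right
            obtain ⟨i, hi⟩ := hget s hs (ht.step hs hD)
            rcases ih with rfl | ⟨i', hi', a, ha, hai⟩
            · exact ⟨i, hi, i, (hM i).2 (by rwa [hi]), .refl⟩
            · exact ⟨i, hi, a, ha, hai.tail ((hE i' i).2 (by rwa [hi, hi']))⟩
        intro v
        rcases key _ (huu v) with h1 | ⟨i, hi, a, ha, hai⟩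
        · have := huk v; omega
        · rw [← huinj _ _ hi]
          exact ⟨a, ha, hai⟩
      · obtain ⟨i, hi⟩ := hget 0 (by omega) (h.used_zero hF1 hF Used.root)
        refine ⟨i, (hZ i).2 hi, fun w hw => huinj _ _ ?_⟩
        rw [hi]
        exact (hZ w).1 hw
      · intro z hz hmz
        rw [hZ] at hz
        rw [hM, hz] at hmz
        exact hmz (h.flag_eq_zero (k + 1) (by omega) le_rfl j hj1 hjk hj)
      · rintro v z ⟨hvz, hz, w, hwz, hvw⟩
        rw [hZ] at hz
        rw [hE, hz] at hvz
        rw [hE] at hvw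
        have hw0 : u w ≠ 0 := fun h0 => hwz (huinj _ _ (by rw [h0, hz]))
        have hv0 : u v ≠ 0 := fun h0 => by
          rw [h0] at hvz
          exact hvz (h.zero _)
        exact hvz (h.flag_eq_zero (u v) (by omega) ((huk v).trans (by omega)) (u w) (by omega)
          (huk w) hvw)
  · rintro ⟨e1, -, e3, e4⟩
    rw [hvinj] at e4
    rw [e4] at e3
    have e5 : Q.lab v w₂ = 0 := by
      generalize Q.lab v w₂ = σ at e3
      revert e3
      cases σ <;> decide
    exact e1 (by rw [e4]; exact e5)
  · rintro ⟨e1, e2, e3, e4⟩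
    have e3' : D (u v) (u w₁) = - D (u v) (u w₂) := by
      have e5 : (Q.lab v w₁ : ℤ) = -(Q.lab v w₂ : ℤ) := by
        rw [e3]
        cases Q.lab v w₂ <;> rfl
      exact (hlab v w₁).symm.trans (e5.trans (congrArg _ (hlab v w₂)))
    rw [hE] at e1 e2
    have hv0 : u v ≠ 0 := fun h0 => by
      rw [h0] at e1
      exact e1 (h.zero _)
    rw [hval, hval] at e4
    -- Twice the value of the leaf is the value of the leaf again; opposite labels on one edge are
    -- impossible.
    by_cases hw2 : u w₂ = 0
    · rw [chainVal, chainVal, if_pos hw2, mul_zero] at e4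
      have hw1 : u w₁ = 0 := by
        by_contra hne
        rw [if_neg hne] at e4
        exact absurd e4 (by positivity)
      rw [hw1, hw2] at e3'
      rw [hw2] at e2
      exact e2 (by omega)
    · have hw1 : u w₁ ≠ 0 := fun h0 => by
        rw [hvpos w₂ hw2, chainVal, if_pos h0] at e4
        exact absurd e4.symm (by positivity)
      rw [hvpos w₂ hw2, hvpos w₁ hw1, ← pow_succ'] at e4
      have e5 : F (u w₁) = F (u w₂) + 1 := Nat.pow_right_injective le_rfl (by exact_mod_cast e4)
      have h12 : u w₂ < u w₁ := by
        by_contra hc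
        rcases (not_lt.1 hc).lt_or_eq with h1 | h1
        · have := strictMono_F hF (by omega) h1 (huk w₂); omega
        · rw [h1] at e5; omega
      -- Values with ratio `2` occupy consecutive places, because `F` is strictly increasing; `opp`
      -- then excludes opposite digits.
      have h13 : u w₁ = u w₂ + 1 := by
        by_contra hne
        have h1 := strictMono_F hF (i := u w₂) (j := u w₂ + 1) (by omega) (by omega)
          (by have := huk w₁; omega)
        have h2 := strictMono_F hF (i := u w₂ + 1) (j := u w₁) (by omega) (by omega) (huk w₁)
        omega
      rw [h13] at e3' e5
      exact e2 (h.opp (u v) (by omega) ((huk v).trans (by omega)) (u w₂) (by omega)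
        (by have := huk w₁; omega) e5 e3')
  · rw [hval]
    by_cases hz : u v = 0
    · exact ⟨0, by rw [chainVal, if_pos hz]; simp⟩
    · exact ⟨2 ^ F (u v), by rw [hvpos v hz]; simp⟩

end NormalMatrix

/-! ### Extracting the needed rows -/

/-- Mark the rows that are needed in array `12`. -/
def markUsed : Prog :=
  .seq (.store 12 16 10 11) <| .seq (.copy 64 16) <| forDown 64 10 <|
    .seq (.load 66 12 64 10) <| .branch (.eq 66 10) .skip <|
      .seq (.const 65 0) <| forUp 65 16 <|
        .seq (.load 63 5 64 65) (.branch (.eq 63 10) .skip (.store 12 65 10 11))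

/-- List the marked rows in array `13`; register `70` gets their number. -/
def listUsed : Prog :=
  .seq (.const 70 0) <| .seq (.const 65 0) <| forUp 65 16 <|
    .seq (.load 66 12 65 10) <| .branch (.eq 66 10) .skip <| .seq (.store 13 70 10 65) (.inc 70)

/-- Write the circuit that consists of the listed rows. -/
def writeCircuit : Prog :=
  .seq (.const 64 0) <| .seq
    (forUp 64 70 <|
      .seq (.load 71 13 64 10) <| .seq (.load 72 5 16 71) <| .seq (.store 1 64 10 72) <|
        .seq (.store 2 64 10 64) <| .seq (.const 65 0) <| forUp 65 70 <|
          .seq (.load 73 13 65 10) <| .seq (.load 74 5 71 73) (.store 0 64 65 74)) <|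
    .copy 0 70

/-- Rows refer only to smaller places, so when a downward pass reaches a row, everything that could
make it needed has been visited. Row `0` is not visited, as it has no successors. -/
theorem run_markUsed {s : State} {k : ℕ} {F : ℕ → ℕ} {N : ℤ} {D : ℕ → ℕ → ℤ} (h10 : s.reg 10 = 0)
    (h11 : s.reg 11 = 1) (h16 : s.reg 16 = (k + 1 : ℕ)) (hD : ∀ i j : ℕ, s.arr 5 i j = D i j)
    (hN : NormalMatrix k F N D) (hF1 : F 1 = 0) (hF : ∀ r, 1 ≤ r → r < k → F r < F (r + 1))
    (h12 : ∀ i : ℕ, s.arr 12 i 0 = 0) :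
    Run markUsed s fun s' t =>
      (∀ i : ℕ, i ≤ k + 1 → (s'.arr 12 i 0 ≠ 0 ↔ Used k D i)) ∧ t ≤ 10 * (k + 2) ^ 2 := by
  have hused : ∀ x : ℕ, ∀ i < x,
      (x = k + 1 ∨ ∃ t, i < t ∧ t ≤ k + 1 ∧ Used k D t ∧ D t x ≠ 0 ∧ x ≤ k) ↔ Used k D x := by
    intro x i hx
    constructor
    · rintro (rfl | ⟨t, -, -, h3, h4, h5⟩)
      · exact .root
      · exact h3.step h5 h4
    · intro h
      cases h with
      | root => exact .inl rfl
      | @step t _ ht hs hD' =>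
        exact .inr ⟨t, hx.trans (hN.lt hF1 hF ht.le hs hD'), ht.le, ht, hD', hs⟩
  simp only [markUsed, run_seq, run_store, run_copy, State.setArr_reg]
  -- After visiting the rows above `i`, a place is marked if it is the root or a successor of a
  -- needed row among those.
  refine Run.forDown (fun i s' => ∀ x : ℕ, x ≤ k + 1 → (s'.arr 12 x 0 ≠ 0 ↔
    (x = k + 1 ∨ ∃ t, i < t ∧ t ≤ k + 1 ∧ Used k D t ∧ D t x ≠ 0 ∧ x ≤ k)))
    0 (k + 1) ((k + 1) * 6 + 6) (by simp [h16]) (by simp [h10]) (by omega) rfl rfl rfl ?_ ?_ ?_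
  · intro x hx
    rw [State.setReg_arr, State.setArr_arr, h16, h10, h11]
    by_cases hxk : x = k + 1
    · simp [hxk]
    · rw [if_neg (by simpa using by omega), h12]
      simp only [ne_eq, not_true_eq_false, hxk, false_or, false_iff, not_exists]
      omega
  · intro i s' fr _ hi h64 _ hI
    have f10 : s'.reg 10 = 0 := by rw [fr.1 10 rfl]; simp [h10]
    have f11 : s'.reg 11 = 1 := by rw [fr.1 11 rfl]; simp [h11]
    have f16 : s'.reg 16 = (k + 1 : ℕ) := by rw [fr.1 16 rfl]; simp [h16]
    have f5 : ∀ i j : ℕ, s'.arr 5 i j = D i j := by rw [fr.2 5 rfl]; simpa using hD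
    have hi1 := hI (i + 1) (by omega)
    simp only [run_seq, run_load, run_branch, Test.holds_eq, State.setReg_reg, reduceIte,
      Nat.reduceEqDiff, f10, h64, run_skip, run_const, State.setReg_arr]
    refine ⟨fun h0 => ⟨fun x hx => ?_, by omega⟩, fun h0 => ?_⟩
    · rw [hI x hx]
      refine or_congr_right ⟨fun ⟨t, h1, h2⟩ => ⟨t, by omega, h2⟩, fun ⟨t, h1, h2, h3, h4⟩ => ?_⟩
      rcases (show t = i + 1 ∨ i + 1 < t by omega) with rfl | h5
      · exfalso
        refine hi1.2 ?_ h0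
        cases h3 with
        | root => exact .inl rfl
        | @step t _ ht hs hD' =>
          exact .inr ⟨t, hN.lt hF1 hF ht.le hs hD', ht.le, ht, hD', hs⟩
      · exact ⟨t, h5, h2, h3, h4⟩
    · have hU : Used k D (i + 1) := by
        rcases hi1.1 h0 with h | ⟨t, -, -, h3, h4, h5⟩
        · rw [h]; exact .root
        · exact h3.step h5 h4
      refine Run.forUp (fun j s2 => ∀ x : ℕ, x ≤ k + 1 → (s2.arr 12 x 0 ≠ 0 ↔
        (s'.arr 12 x 0 ≠ 0 ∨ (x < j ∧ D (i + 1) x ≠ 0))))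
        0 (k + 1) 4 (by simp) (by simp [f16]) (by omega) rfl rfl rfl ?_ ?_ ?_
      · intro x hx
        simp
      · intro j s2 fr2 _ hj h65 _ hI2
        have g10 : s2.reg 10 = 0 := by rw [fr2.1 10 rfl]; simp [f10]
        have g11 : s2.reg 11 = 1 := by rw [fr2.1 11 rfl]; simp [f11]
        have g64 : s2.reg 64 = (i + 1 : ℕ) := by rw [fr2.1 64 rfl]; simp [h64]
        have g5 : ∀ i j : ℕ, s2.arr 5 i j = D i j := by rw [fr2.2 5 rfl]; simpa using f5
        simp only [run_seq, run_load, run_branch, Test.holds_eq, State.setReg_reg, reduceIte,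
          Nat.reduceEqDiff, g10, g64, h65, g5, run_skip, run_store, State.setReg_arr, g11]
        refine ⟨fun h0 => ⟨fun x hx => ?_, by omega⟩, fun h0 => ⟨fun x hx => ?_, by omega⟩⟩
        · rw [hI2 x hx]
          refine or_congr_right ⟨fun ⟨h1, h2⟩ => ⟨by omega, h2⟩, fun ⟨h1, h2⟩ => ⟨?_, h2⟩⟩
          have : x ≠ j := by rintro rfl; exact h2 h0
          omega
        · rw [State.setArr_arr, State.setReg_arr]
          by_cases hxj : x = j
          · subst hxj
            simp [h0]
          · rw [if_neg (by simpa using hxj), hI2 x hx]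
            refine or_congr_right (and_congr_left fun _ => ?_)
            omega
      · intro s2 t fr2 _ hI2 ht
        refine ⟨fun x hx => ?_, by omega⟩
        rw [hI2 x hx, hI x hx, or_assoc]
        refine or_congr_right ⟨?_, ?_⟩
        · rintro (⟨t, h1, h2⟩ | ⟨h1, h2⟩)
          · exact ⟨t, by omega, h2⟩
          · exact ⟨i + 1, by omega, by omega, hU, h2, by omega⟩
        · rintro ⟨t, h1, h2, h3, h4, h5⟩
          rcases (show t = i + 1 ∨ i + 1 < t by omega) with rfl | h6
          · exact .inr ⟨by omega, h4⟩
          · exact .inl ⟨t, h6, h2, h3, h4, h5⟩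
  · intro s' t fr _ hI ht
    rw [Nat.sub_zero] at ht
    refine ⟨fun x hx => ?_, by clear * - ht; nlinarith⟩
    rcases Nat.eq_zero_or_pos x with rfl | hx0
    · rw [hI 0 hx]
      constructor
      · rintro (h | ⟨t, -, -, h3, h4, h5⟩)
        · omega
        · exact h3.step h5 h4
      · intro h
        cases h with
        | @step t _ ht hs hD' =>
          exact .inr ⟨t, hN.lt hF1 hF ht.le hs hD', ht.le, ht, hD', hs⟩
    · rw [hI x hx, hused x 0 hx0]

theorem run_listUsed {s : State} {k : ℕ} {U : ℕ → Prop} (h10 : s.reg 10 = 0)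
    (h16 : s.reg 16 = (k + 1 : ℕ)) (h12 : ∀ i : ℕ, i ≤ k + 1 → (s.arr 12 i 0 ≠ 0 ↔ U i)) :
    Run listUsed s fun s' t => (∃ (m : ℕ) (u : ℕ → ℕ), s'.reg 70 = m ∧ m ≤ k + 1 ∧
      (∀ i < m, s'.arr 13 (i : ℕ) 0 = u i) ∧ (∀ i j, i < j → j < m → u i < u j) ∧
      (∀ i < m, U (u i) ∧ u i ≤ k) ∧ ∀ s ≤ k, U s → ∃ i < m, u i = s) ∧ t ≤ 10 * (k + 2) := by
  simp only [listUsed, run_seq, run_const]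
  refine Run.forUp (fun r s' => ∃ (m : ℕ) (u : ℕ → ℕ), s'.reg 70 = m ∧ m ≤ r ∧
      (∀ i < m, s'.arr 13 (i : ℕ) 0 = u i) ∧ (∀ i j, i < j → j < m → u i < u j) ∧
      (∀ i < m, U (u i) ∧ u i < r) ∧ ∀ s < r, U s → ∃ i < m, u i = s)
    0 (k + 1) 5 (by simp) (by simp [h16]) (by omega) rfl rfl rfl ?_ ?_ ?_
  · exact ⟨0, fun _ => 0, by simp, le_rfl, by simp, by simp, by simp, by simp⟩
  · rintro r s' fr _ hr h65 _ ⟨m, u, h70, hm, h13, hmono, hU, hsur⟩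
    have f10 : s'.reg 10 = 0 := by rw [fr.1 10 rfl]; simp [h10]
    have f12 : s'.arr 12 = s.arr 12 := by rw [fr.2 12 rfl]; simp
    have h12' := h12 r (by omega)
    simp only [run_seq, run_load, run_branch, Test.holds_eq, State.setReg_reg, reduceIte,
      Nat.reduceEqDiff, f10, h65, f12, run_skip, run_store, run_inc, State.setReg_arr,
      State.setArr_reg, h70]
    refine ⟨fun h0 => ⟨⟨m, u, rfl, by omega, h13, hmono, fun i hi => ?_, fun x hx hUx => ?_⟩,
      by omega⟩, fun h0 => ⟨⟨m + 1, fun i => if i = m then r else u i, by push_cast; rfl, by omega,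
        fun i hi => ?_, fun i j hij hj => ?_, fun i hi => ?_, fun x hx hUx => ?_⟩, by omega⟩⟩
    · have := hU i hi
      exact ⟨this.1, by omega⟩
    · refine hsur x ?_ hUx
      have : x ≠ r := by rintro rfl; exact h12'.2 hUx h0
      omega
    · rw [State.setArr_arr, State.setReg_arr]
      by_cases him : i = m
      · simp [him]
      · rw [if_neg (by simpa using him), h13 i (by omega)]
        simp [him]
    · simp only [if_neg (by omega : i ≠ m)]
      by_cases hjm : j = m
      · rw [if_pos hjm]; exact (hU i (by omega)).2
      · rw [if_neg hjm]; exact hmono i j hij (by omega)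
    · by_cases him : i = m
      · simp only [him, reduceIte]; exact ⟨h12'.1 h0, by omega⟩
      · simp only [him, reduceIte]
        have := hU i (by omega)
        exact ⟨this.1, by omega⟩
    · by_cases hxr : x = r
      · exact ⟨m, by omega, by simp [hxr]⟩
      · obtain ⟨i, hi, hi'⟩ := hsur x (by omega) hUx
        exact ⟨i, by omega, by simp only [if_neg (by omega : i ≠ m), hi']⟩
  · rintro s' t fr _ ⟨m, u, h1, h2, h3, h4, h5, h6⟩ ht
    exact ⟨⟨m, u, h1, h2, h3, h4, fun i hi => ⟨(h5 i hi).1, by have := (h5 i hi).2; omega⟩,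
      fun x hx => h6 x (by omega)⟩, by omega⟩

/-- The needed places are listed in increasing order, hence by increasing value, and the required
order of the vertices is the identity. -/
theorem run_writeCircuit {s : State} {k m : ℕ} {u : ℕ → ℕ} {D : ℕ → ℕ → ℤ} (h10 : s.reg 10 = 0)
    (h16 : s.reg 16 = (k + 1 : ℕ)) (hD : ∀ i j : ℕ, s.arr 5 i j = D i j) (h70 : s.reg 70 = m)
    (hm : m ≤ k + 1) (hu : ∀ i < m, s.arr 13 (i : ℕ) 0 = u i) :
    Run writeCircuit s fun s' t => s'.reg 0 = m ∧
      (∀ i < m, ∀ j < m, s'.arr 0 (i : ℕ) (j : ℕ) = D (u i) (u j)) ∧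
      (∀ i < m, s'.arr 1 (i : ℕ) 0 = D (k + 1) (u i)) ∧ (∀ i < m, s'.arr 2 (i : ℕ) 0 = i) ∧
      t ≤ 20 * (k + 2) ^ 2 := by
  simp only [writeCircuit, run_seq, run_const]
  refine Run.forUp (fun r s' => ∀ i < r, (∀ j < m, s'.arr 0 (i : ℕ) (j : ℕ) = D (u i) (u j)) ∧
      s'.arr 1 (i : ℕ) 0 = D (k + 1) (u i) ∧ s'.arr 2 (i : ℕ) 0 = i)
    0 m (m * 5 + 6) (by simp) (by simp [h70]) (by omega) rfl rfl rfl (by simp) ?_ ?_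
  · intro r s' fr _ hr h64 g70 hI
    have f10 : s'.reg 10 = 0 := by rw [fr.1 10 rfl]; simp [h10]
    have f16 : s'.reg 16 = (k + 1 : ℕ) := by rw [fr.1 16 rfl]; simp [h16]
    have f13 : s'.arr 13 = s.arr 13 := by rw [fr.2 13 rfl]; simp
    have f5 : ∀ i j : ℕ, s'.arr 5 i j = D i j := by rw [fr.2 5 rfl]; simpa using hD
    simp only [run_seq, run_load, State.setReg_reg, reduceIte,
      Nat.reduceEqDiff, f10, h64, f16, f13, hu r hr, f5, run_store, State.setReg_arr,
      State.setArr_reg, run_const]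
    refine Run.forUp (fun c s2 => (∀ i < r, ∀ j < m, s2.arr 0 (i : ℕ) (j : ℕ) = D (u i) (u j)) ∧
        (∀ j < c, s2.arr 0 (r : ℕ) (j : ℕ) = D (u r) (u j)))
      0 m 3 (by simp) (by simp [g70]) (by omega) rfl rfl rfl ?_ ?_ ?_
    · exact ⟨fun i hi j hj => by simpa [State.setArr] using (hI i hi).1 j hj, by simp⟩
    · rintro c s2 fr2 _ hc h65 _ ⟨hI1, hI2⟩
      have g10 : s2.reg 10 = 0 := by rw [fr2.1 10 rfl]; simp [f10]
      have g64 : s2.reg 64 = (r : ℕ) := by rw [fr2.1 64 rfl]; simp [h64]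
      have g71 : s2.reg 71 = (u r : ℕ) := by rw [fr2.1 71 rfl]; simp
      have g13 : s2.arr 13 = s.arr 13 := by rw [fr2.2 13 rfl]; simp [f13]
      have g5 : ∀ i j : ℕ, s2.arr 5 i j = D i j := by rw [fr2.2 5 rfl]; simpa using f5
      simp only [run_seq, run_load, State.setReg_reg, reduceIte,
        Nat.reduceEqDiff, g10, h65, g71, g64, g13, hu c hc, g5, run_store, State.setReg_arr]
      refine ⟨⟨fun i hi j hj => ?_, fun j hj => ?_⟩, by omega⟩
      · rw [State.setArr_arr, if_neg (by simpa using by omega)]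
        exact hI1 i hi j hj
      · rw [State.setArr_arr]
        by_cases hjc : j = c
        · simp [hjc]
        · rw [if_neg (by simpa using hjc)]
          exact hI2 j (by omega)
    · rintro s2 t fr2 _ ⟨hI1, hI2⟩ ht
      have g1 := fr2.2 1 rfl
      have g2 := fr2.2 2 rfl
      refine ⟨fun i hi => ?_, by omega⟩
      rw [g1, g2]
      by_cases hir : i = r
      · subst hir
        exact ⟨hI2, by simp [State.setArr], by simp [State.setArr]⟩
      · obtain ⟨-, h2, h3⟩ := hI i (by omega)
        exact ⟨hI1 i (by omega), by simpa [State.setArr, hir] using h2,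
          by simpa [State.setArr, hir] using h3⟩
  · intro s' t fr h64 hI ht
    have g70 : s'.reg 70 = m := by rw [fr.1 70 rfl]; simp [h70]
    rw [run_copy]
    refine ⟨by simp [g70], fun i hi => ?_, fun i hi => ?_, fun i hi => ?_, ?_⟩
    · simpa using (hI i hi).1
    · simpa using (hI i hi).2.1
    · simpa using (hI i hi).2.2
    · have h1 : m * (m * 5 + 6 + 2) ≤ (k + 1) * ((k + 1) * 5 + 6 + 2) := by gcongr
      rw [Nat.sub_zero] at ht
      clear * - h1 ht
      nlinarith

end RAM

/-! ### Natural exponents in proper circuits -/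

namespace PowerCircuit

open Finset

variable {V : Type} [Fintype V] (P : PowerCircuit V)

/-- In a proper circuit, all vertices but the leaves have a value `2 ^ e` with a natural `e`. -/
theorem exists_exponent (hP : P.IsProper) (v : V) (hv : ¬ P.IsZeroVertex v) :
    ∃ e : ℕ, P.value v = 2 ^ e ∧ ∑ w : V, (P.lab v w : ℝ) * P.value w = e := by
  obtain ⟨-, -, hN⟩ := hP
  choose a ha using hN
  have hsum : ∑ w : V, (P.lab v w : ℝ) * P.value w = ((∑ w : V, (P.lab v w : ℤ) * a w : ℤ) : ℝ) := by
    push_cast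
    refine sum_congr rfl fun w _ => ?_
    rw [ha]
  have h1 := P.value_eq v
  rw [if_neg hv, hsum] at h1
  -- A negative integer exponent would give a value strictly between `0` and `1`, which is not a
  -- natural number.
  have h2 : 0 ≤ ∑ w : V, (P.lab v w : ℤ) * a w := by
    by_contra hneg
    have h3 : P.value v < 1 := by
      rw [h1]
      exact Real.rpow_lt_one_of_one_lt_of_neg one_lt_two (by exact_mod_cast not_le.1 hneg)
    have h4 : 0 < P.value v := by
      rw [h1]
      positivity
    rw [ha] at h3 h4
    norm_cast at h3 h4
    omega
  obtain ⟨e, he⟩ := Int.eq_ofNat_of_zero_le h2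
  rw [he] at h1 hsum
  exact ⟨e, by rw [h1]; simp, by rw [hsum]; simp⟩

end PowerCircuit

namespace RAM

open Finset

theorem labArr_coe {n : ℕ} (P : PowerCircuit (Fin n)) (i j : Fin n) :
    labArr P (i : ℕ) (j : ℕ) = P.lab i j := by
  simp [labArr]

theorem markArr_coe {n : ℕ} (P : PowerCircuit (Fin n)) (i : Fin n) :
    markArr P (i : ℕ) 0 = P.mark i := by
  simp [markArr]

theorem natAbs_signType_le (σ : SignType) : (σ : ℤ).natAbs ≤ 1 := by
  cases σ <;> simp

/-- This leaves the real-valued definition of the value behind: from here on everything is a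
statement about integers and natural exponents. -/
theorem exists_circ {n : ℕ} (P : PowerCircuit (Fin n)) (hP : P.IsProper) :
    ∃ nd E, Circ n (fun i j => labArr P i j) nd E ∧
      P.eval = (∑ w ∈ range n, markArr P w 0 * val nd E w : ℤ) := by
  classical
  have hex : ∀ v : Fin n, ∃ e : ℕ, ¬ P.IsZeroVertex v →
      P.value v = 2 ^ e ∧ ∑ w, (P.lab v w : ℝ) * P.value w = e := fun v => by
    by_cases hv : P.IsZeroVertex v
    · exact ⟨0, fun h => absurd hv h⟩
    · exact (P.exists_exponent hP v hv).imp fun e he _ => he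
  choose e he using hex
  -- Vacuous at `v = n`, this makes the artificial vertex non-zero, and the default of `E` gives it
  -- the exponent `0`.
  let nd : ℕ → Prop := fun v => ∀ h : v < n, ¬ P.IsZeroVertex ⟨v, h⟩
  let E : ℕ → ℕ := fun v => if h : v < n then e ⟨v, h⟩ else 0
  have hnd : ∀ v : Fin n, nd v ↔ ¬ P.IsZeroVertex v := fun v => ⟨fun h => h v.2, fun h _ => h⟩
  have hE : ∀ v : Fin n, E v = e v := fun v => by simp [E]
  have hval : ∀ v : Fin n, ((val nd E v : ℤ) : ℝ) = P.value v := fun v => by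
    by_cases hv : P.IsZeroVertex v
    · rw [val, if_neg (by rwa [hnd, not_not]), P.value_eq, if_pos hv, Int.cast_zero]
    · rw [val, if_pos ((hnd v).2 hv), (he v hv).1, hE]
      simp
  have hsupp : ∀ i j : ℕ, labArr P i j ≠ 0 → i < n ∧ j < n := fun i j h => by
    by_contra hc
    exact h (dif_neg (by omega))
  have hedge : ∀ i j : Fin n, labArr P (i : ℕ) (j : ℕ) ≠ 0 ↔ P.Edge i j := fun i j => by
    rw [labArr_coe, PowerCircuit.Edge]
    cases P.lab i j <;> decide
  -- The rank of a vertex is the number of vertices reachable from it by non-empty paths.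
  refine ⟨nd, E, ⟨fun i j => ?_, hsupp, fun v hv => ?_, fun h => absurd h (lt_irrefl n), by simp [E],
    fun v hv hn => ?_, ⟨fun v => if h : v < n then
      #{x | Relation.TransGen P.Edge ⟨v, h⟩ x} else 0, fun v w hvw => ?_⟩⟩, ?_⟩
  · rw [labArr]
    split_ifs
    · exact natAbs_signType_le _
    · simp
  · rw [hnd ⟨v, hv⟩, PowerCircuit.IsZeroVertex]
    push Not
    exact ⟨fun ⟨w, hw⟩ => ⟨w, w.2, (hedge ⟨v, hv⟩ w).2 hw⟩,
      fun ⟨w, hw, h⟩ => ⟨⟨w, hw⟩, (hedge ⟨v, hv⟩ ⟨w, hw⟩).1 h⟩⟩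
  · have h1 := (he ⟨v, hv⟩ ((hnd ⟨v, hv⟩).1 hn)).2
    have h2 : ((∑ w ∈ range n, labArr P v w * val nd E w : ℤ) : ℝ) = e ⟨v, hv⟩ := by
      rw [← h1, ← Fin.sum_univ_eq_sum_range (fun w => labArr P v w * val nd E w)]
      push_cast
      refine sum_congr rfl fun w _ => ?_
      rw [hval, ← signType_coe_int_real, ← labArr_coe]
    rw [show E v = e ⟨v, hv⟩ from hE ⟨v, hv⟩]
    exact_mod_cast h2.symm
  · obtain ⟨hv, hw⟩ := hsupp v w hvw
    have h1 : P.Edge ⟨v, hv⟩ ⟨w, hw⟩ := (hedge ⟨v, hv⟩ ⟨w, hw⟩).1 hvw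
    simp only [dif_pos hv, dif_pos hw]
    refine card_lt_card ⟨fun x hx => ?_, fun hc => ?_⟩
    · simp only [mem_filter, mem_univ, true_and] at hx ⊢
      exact hx.head h1
    · have h2 : (⟨w, hw⟩ : Fin n) ∈ filter (Relation.TransGen P.Edge ⟨w, hw⟩) univ :=
        hc (by simpa using .single h1)
      exact P.acyclic _ (mem_filter.1 h2).2
  · rw [PowerCircuit.eval, ← Fin.sum_univ_eq_sum_range (fun w => markArr P w 0 * val nd E w)]
    push_cast
    refine sum_congr rfl fun w _ => ?_
    rw [hval, ← signType_coe_int_real, ← markArr_coe]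

/-! ### Assembly of the reduction program -/

/-- Set the registers with constant contents. -/
def setConsts : Prog :=
  .seq (.const 10 0) <| .seq (.const 11 1) <| .seq (.const 12 8) <| .seq (.const 13 (-8)) <|
    .seq (.const 31 0) <| forUp 31 0 <|
      .seq (.inc 12) <| .seq (.inc 12) <| .seq (.inc 12) <| .seq (.inc 12) <|
        .seq (.dec 13) <| .seq (.dec 13) <| .seq (.dec 13) (.dec 13)

/-- Replace the circuit in memory by an equivalent reduced one. -/
def reduce : Prog :=
  .seq setConsts <| .seq sortVertices <| .seq closeChain <| .seq allRows <|
    .seq markUsed <| .seq listUsed writeCircuit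

theorem run_setConsts {s : State} {n : ℕ} (h0 : s.reg 0 = n) :
    Run setConsts s fun s' t => Consts n s' ∧ t ≤ 10 * n + 6 := by
  simp only [setConsts, run_seq, run_const]
  refine Run.forUp (fun i s' => s'.reg 12 = 4 * i + 8 ∧ s'.reg 13 = -(4 * i + 8))
    0 n 8 (by simp) (by simp [h0]) (by omega) rfl rfl rfl (by simp) ?_ ?_
  · rintro i s' - - - - - ⟨h1, h2⟩
    simp only [run_seq, run_inc, run_dec, State.setReg_reg, reduceIte, Nat.reduceEqDiff, h1, h2]
    refine ⟨⟨?_, ?_⟩, by omega⟩ <;> push_cast <;> ring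
  · rintro s' t fr - ⟨h1, h2⟩ ht
    refine ⟨⟨?_, ?_, ?_, ?_, ?_⟩, by omega⟩
    · rw [fr.1 0 rfl]; simp [h0]
    · rw [fr.1 10 rfl]; simp
    · rw [fr.1 11 rfl]; simp
    · rw [h1]; push_cast; ring
    · rw [h2]; push_cast; ring

/-- The assumptions on the memory are weaker than equality with `input`, since arrays `2` and `3`
still hold the second circuit after merging. The bound on `m` makes reading off the sign linear in
`n`. -/
theorem run_reduce {s : State} {n : ℕ} {P : PowerCircuit (Fin n)} (hP : P.IsProper)
    (h0 : s.reg 0 = n) (hlab : ∀ i j : ℕ, s.arr 0 i j = labArr P i j)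
    (hmark : ∀ i : ℕ, s.arr 1 i 0 = markArr P i 0)
    (hzero : ∀ a, 4 ≤ a → s.arr a = fun _ _ => 0) :
    Run reduce s fun s' t => (∃ m ≤ 10 * n + 17, ∃ Q : PowerCircuit (Fin m), Q.IsReduced ∧
      Q.IsProper ∧ Q.eval = P.eval ∧ (∀ i j, i < j → Q.value i < Q.value j) ∧
      s'.Contains Q (Equiv.refl _)) ∧ t ≤ 60000 * (n + 1) ^ 3 := by
  obtain ⟨nd, E, hC, heval⟩ := exists_circ P hP
  simp only [reduce, run_seq]
  refine (run_setConsts h0).conseq ?_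
  rintro s1 t1 fr1 ⟨hc1, ht1⟩
  refine (run_sortVertices hc1 (by rw [fr1.2 0 rfl]; exact hlab) hC
    (by rw [fr1.2 7 rfl, hzero 7 (by omega)]; simp)).conseq ?_
  rintro s2 t2 fr2 ⟨⟨q, o, hs⟩, ht2⟩
  have hc2 := hc1.of_frame fr2 rfl
  refine (run_closeChain hc2 hs hC.nd_last
    (by rw [fr2.2 8 rfl, fr1.2 8 rfl, hzero 8 (by omega)]; simp)).conseq ?_
  rintro s3 t3 fr3 ⟨⟨k, F, L, pos, hCl⟩, ht3⟩
  have hc3 := hc2.of_frame fr3 rfl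
  refine (run_allRows (mk := fun w => markArr P w 0) hc3 hCl hC
    (by rw [fr3.2 0 rfl, fr2.2 0 rfl, fr1.2 0 rfl]; exact hlab)
    (by rw [fr3.2 1 rfl, fr2.2 1 rfl, fr1.2 1 rfl]; exact hmark) ?_
    (by rw [fr3.2 5 rfl, fr2.2 5 rfl, fr1.2 5 rfl, hzero 5 (by omega)]; simp)).conseq ?_
  · intro w
    rw [markArr]
    split_ifs
    · exact natAbs_signType_le _
    · simp
  rintro s4 t4 fr4 ⟨h16, hN, ht4⟩
  have hc4 := hc3.of_frame fr4 rfl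
  refine (run_markUsed hc4.h10 hc4.h11 h16 (fun _ _ => rfl) hN hCl.F_one hCl.F_lt
    (by rw [fr4.2 12 rfl, fr3.2 12 rfl, fr2.2 12 rfl, fr1.2 12 rfl, hzero 12 (by omega)]
        simp)).conseq ?_
  rintro s5 t5 fr5 ⟨hU, ht5⟩
  have hc5 := hc4.of_frame fr5 rfl
  refine (run_listUsed hc5.h10 (by rw [fr5.1 16 rfl, h16]) hU).conseq ?_
  rintro s6 t6 fr6 ⟨⟨m, u, h70, hm, h13, hu, hu1, hu2⟩, ht6⟩
  have hc6 := hc5.of_frame fr6 rfl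
  refine (run_writeCircuit (D := fun i j => s4.arr 5 i j) hc6.h10
    (by rw [fr6.1 16 rfl, fr5.1 16 rfl, h16])
    (by rw [fr6.2 5 rfl, fr5.2 5 rfl]; simp) h70 hm h13).conseq ?_
  rintro s7 t7 fr7 ⟨r0, r1, r2, r3, ht7⟩
  obtain ⟨Q, q1, q2, q3, q4, q5, q6⟩ := hN.exists_reduct hCl.F_one hCl.F_lt hu hu1 hu2
  have hk := hCl.le
  refine ⟨⟨m, by omega, Q, q3, q4, by rw [q5, heval], q6, r0, fun i j => ?_, fun i => ?_,
    fun i => r3 i i.2⟩, ?_⟩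
  · rw [r1 i i.2 j j.2, q1]
  · rw [r2 i i.2, q2]
  · have e1 : (k + 2) ^ 2 ≤ (18 * (n + 1)) ^ 2 := Nat.pow_le_pow_left (by omega) 2
    have e2 : (n + 1) ^ 2 ≤ (n + 1) ^ 3 := Nat.pow_le_pow_right (by omega) (by omega)
    have e3 : n + 1 ≤ (n + 1) ^ 2 := Nat.le_self_pow (by norm_num) _
    rw [mul_pow] at e1
    clear * - e1 e2 e3 ht1 ht2 ht3 ht4 ht5 ht6 ht7 hk
    generalize (n + 1) ^ 3 = x3 at *
    generalize (n + 1) ^ 2 = x2 at *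
    generalize (k + 2) ^ 2 = y2 at *
    omega

end RAM

/-! ### The sign of a reduced circuit -/

namespace PowerCircuit

open Finset

/-- If the values of a reduced circuit increase with the vertex numbers, then the sign of the last
marked vertex is the sign of the circuit. -/
theorem sgn_eq_mark {m : ℕ} {Q : PowerCircuit (Fin m)} (hQ : Q.IsReduced) (hP : Q.IsProper)
    (hmono : ∀ i j, i < j → Q.value i < Q.value j) (hm : m ≠ 1) {v : Fin m} (hv : Q.Marked v)
    (htop : ∀ w, v < w → Q.mark w = 0) : Q.sgn = Q.mark v := by
  have hpow : ∀ w, ¬ Q.IsZeroVertex w → ∃ e : ℕ, Q.value w = 2 ^ e := fun w hw =>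
    (Q.exists_exponent hP w hw).imp fun e he => he.1
  have hnn : ∀ w, 0 ≤ Q.value w := fun w => by
    by_cases hw : Q.IsZeroVertex w
    · rw [Q.value_eq, if_pos hw]
    · obtain ⟨e, he⟩ := hpow w hw
      rw [he]; positivity
  have hz : ∀ w, 0 < Q.value w → ¬ Q.IsZeroVertex w := fun w hw h => by
    rw [Q.value_eq, if_pos h] at hw
    exact lt_irrefl _ hw
  -- A non-trivial reduced circuit has an unmarked leaf, so a marked vertex carries a power of `2`.
  have hv0 : 0 < Q.value v := by
    rcases hQ.1 with ⟨u, -, hu⟩ | ⟨-, -, h, -⟩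
    · have : m = 1 := by simpa using Fintype.card_eq_one_iff.2 ⟨u, hu⟩
      exact absurd this hm
    · obtain ⟨e, he⟩ := hpow v fun hzv => h v hzv hv
      rw [he]; positivity
  have hkey : ∀ i : ℕ, ∀ hi : i < m, 0 < Q.value ⟨i, hi⟩ →
      ∑ w ∈ univ with w < ⟨i, hi⟩, Q.value w < Q.value ⟨i, hi⟩ := by
    intro i
    induction i with
    | zero =>
      intro hi h
      rw [filter_false_of_mem (fun w _ => by simp [Fin.lt_def]), sum_empty]
      exact h
    | succ i ih =>
      intro hi h
      have h1 : filter (fun w : Fin m => w < ⟨i + 1, hi⟩) univ =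
          insert ⟨i, by omega⟩ (filter (fun w : Fin m => w < ⟨i, by omega⟩) univ) := by
        ext w
        simp only [mem_filter, mem_univ, true_and, mem_insert, Fin.lt_def, Fin.ext_iff]
        omega
      have h2 := hmono ⟨i, by omega⟩ ⟨i + 1, hi⟩ (by simp [Fin.lt_def])
      rw [h1, sum_insert (by simp)]
      -- If the predecessor has value `0`, nothing positive lies below. Otherwise the sum up to it
      -- is less than twice its value, which is at most the next power of `2`.
      rcases (hnn ⟨i, by omega⟩).eq_or_lt with h3 | h3
      · rw [← h3, zero_add]
        refine lt_of_le_of_lt (sum_nonpos fun w hw => ?_) h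
        rw [h3]
        exact (hmono w _ (by simpa using hw)).le
      · obtain ⟨e, he⟩ := hpow _ (hz _ h3)
        obtain ⟨f, hf⟩ := hpow _ (hz _ h)
        have h4 := ih (by omega) h3
        rw [he, hf] at h2
        rw [he] at h4
        rw [he, hf]
        have h5 : e + 1 ≤ f := (pow_lt_pow_iff_right₀ (one_lt_two)).1 h2
        have h6 : (2 : ℝ) ^ (e + 1) ≤ 2 ^ f := pow_le_pow_right₀ one_le_two h5
        rw [pow_succ] at h6
        linarith
  have hsplit : Q.eval = Q.mark v * Q.value v +
      ∑ w ∈ univ with w < v, (Q.mark w : ℝ) * Q.value w := by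
    rw [eval, ← sum_insert (s := univ.filter (· < v)) (a := v)
      (f := fun w => (Q.mark w : ℝ) * Q.value w) (by simp)]
    refine (sum_subset (subset_univ _) fun w _ hw => ?_).symm
    simp only [mem_insert, mem_filter, mem_univ, true_and, not_or, not_lt] at hw
    rw [htop w (lt_of_le_of_ne hw.2 (Ne.symm hw.1))]
    simp
  have hrest : |∑ w ∈ univ with w < v, (Q.mark w : ℝ) * Q.value w| < Q.value v := by
    refine lt_of_le_of_lt ((abs_sum_le_sum_abs _ _).trans (sum_le_sum fun w _ => ?_))
      (hkey v v.2 hv0)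
    rw [abs_mul, abs_of_nonneg (hnn w)]
    refine mul_le_of_le_one_left (hnn w) ?_
    cases Q.mark w <;> simp
  rw [abs_lt] at hrest
  rw [sgn, hsplit]
  have hv' : Q.mark v ≠ 0 := hv
  generalize Q.mark v = σ at *
  cases σ with
  | zero => exact absurd rfl hv'
  | neg =>
    refine sign_neg ?_
    simp
    linarith
  | pos =>
    refine sign_pos ?_
    simp
    linarith

theorem eval_eq_zero_of_one {Q : PowerCircuit (Fin 1)} : Q.eval = 0 := by
  have h : ∀ v, Q.IsZeroVertex v := fun v w hw => by
    rw [Subsingleton.elim w v] at hw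
    exact Q.acyclic v (.single hw)
  rw [eval]
  refine sum_eq_zero fun v _ => ?_
  rw [value_eq, if_pos (h v), mul_zero]

/-! ### The difference of two circuits -/

section Diff

variable {n m : ℕ} (P : PowerCircuit (Fin n)) (Q : PowerCircuit (Fin m))

/-- The disjoint union of two circuits, where the marks of the second one are negated. -/
def diff : PowerCircuit (Fin (n + m)) where
  lab i j := Fin.addCases (fun a => Fin.addCases (fun b => P.lab a b) (fun _ => 0) j)
    (fun a => Fin.addCases (fun _ => 0) (fun b => Q.lab a b) j) i
  mark i := Fin.addCases P.mark (fun a => - Q.mark a) i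
  acyclic := by
    set R : Fin (n + m) → Fin (n + m) → Prop := fun i j =>
      (Fin.addCases (fun a => Fin.addCases (fun b => P.lab a b) (fun _ => 0) j)
        (fun a => Fin.addCases (fun _ => 0) (fun b => Q.lab a b) j) i : SignType) ≠ 0 with hR
    -- Paths never leave the component in which they start, so a cycle would already be a cycle in
    -- one of the circuits.
    have h1 : ∀ a j, Relation.TransGen R (Fin.castAdd m a) j → ∃ b, j = Fin.castAdd m b ∧
        Relation.TransGen (fun a b => P.lab a b ≠ 0) a b := by
      intro a j h
      induction h with
      | @single j h =>
        induction j using Fin.addCases with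
        | left b => exact ⟨b, rfl, .single (by simpa [hR] using h)⟩
        | right b => simp [hR] at h
      | @tail i j _ h ih =>
        obtain ⟨b, rfl, hb⟩ := ih
        induction j using Fin.addCases with
        | left c => exact ⟨c, rfl, hb.tail (by simpa [hR] using h)⟩
        | right c => simp [hR] at h
    have h2 : ∀ a j, Relation.TransGen R (Fin.natAdd n a) j → ∃ b, j = Fin.natAdd n b ∧
        Relation.TransGen (fun a b => Q.lab a b ≠ 0) a b := by
      intro a j h
      induction h with
      | @single j h =>
        induction j using Fin.addCases with
        | left b => simp [hR] at h
        | right b => exact ⟨b, rfl, .single (by simpa [hR] using h)⟩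
      | @tail i j _ h ih =>
        obtain ⟨b, rfl, hb⟩ := ih
        induction j using Fin.addCases with
        | left c => simp [hR] at h
        | right c => exact ⟨c, rfl, hb.tail (by simpa [hR] using h)⟩
    intro v hv
    induction v using Fin.addCases with
    | left a =>
      obtain ⟨b, hb, h⟩ := h1 a _ hv
      rw [Fin.castAdd_inj] at hb
      subst hb
      exact P.acyclic _ h
    | right a =>
      obtain ⟨b, hb, h⟩ := h2 a _ hv
      rw [Fin.natAdd_inj] at hb
      subst hb
      exact Q.acyclic _ h
  exists_marked := by
    obtain ⟨v, hv⟩ := P.exists_marked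
    exact ⟨Fin.castAdd m v, by simpa using hv⟩

@[simp] theorem diff_lab_left (a b : Fin n) :
    (diff P Q).lab (Fin.castAdd m a) (Fin.castAdd m b) = P.lab a b := by simp [diff]

@[simp] theorem diff_lab_right (a b : Fin m) :
    (diff P Q).lab (Fin.natAdd n a) (Fin.natAdd n b) = Q.lab a b := by simp [diff]

@[simp] theorem diff_lab_left_right (a : Fin n) (b : Fin m) :
    (diff P Q).lab (Fin.castAdd m a) (Fin.natAdd n b) = 0 := by simp [diff]

@[simp] theorem diff_lab_right_left (a : Fin m) (b : Fin n) :
    (diff P Q).lab (Fin.natAdd n a) (Fin.castAdd m b) = 0 := by simp [diff]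

@[simp] theorem diff_mark_left (a : Fin n) :
    (diff P Q).mark (Fin.castAdd m a) = P.mark a := by simp [diff]

@[simp] theorem diff_mark_right (a : Fin m) :
    (diff P Q).mark (Fin.natAdd n a) = - Q.mark a := by simp [diff]

theorem diff_value_left (a : Fin n) : (diff P Q).value (Fin.castAdd m a) = P.value a := by
  induction a using P.wellFounded_edge.induction with
  | _ a ih =>
    rw [value_eq, value_eq, Fin.sum_univ_add]
    have h1 : (diff P Q).IsZeroVertex (Fin.castAdd m a) ↔ P.IsZeroVertex a := by
      simp [IsZeroVertex, Edge, Fin.forall_fin_add]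
    have h2 : ∀ w, (P.lab a w : ℝ) * (diff P Q).value (Fin.castAdd m w) =
        P.lab a w * P.value w := fun w => by
      by_cases hw : P.lab a w = 0
      · simp [hw]
      · rw [ih w hw]
    by_cases hz : P.IsZeroVertex a
    · rw [if_pos (h1.2 hz), if_pos hz]
    · rw [if_neg (mt h1.1 hz), if_neg hz]
      simp [h2]

theorem diff_value_right (a : Fin m) : (diff P Q).value (Fin.natAdd n a) = Q.value a := by
  induction a using Q.wellFounded_edge.induction with
  | _ a ih =>
    rw [value_eq, value_eq, Fin.sum_univ_add]
    have h1 : (diff P Q).IsZeroVertex (Fin.natAdd n a) ↔ Q.IsZeroVertex a := by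
      simp [IsZeroVertex, Edge, Fin.forall_fin_add]
    have h2 : ∀ w, (Q.lab a w : ℝ) * (diff P Q).value (Fin.natAdd n w) =
        Q.lab a w * Q.value w := fun w => by
      by_cases hw : Q.lab a w = 0
      · simp [hw]
      · rw [ih w hw]
    by_cases hz : Q.IsZeroVertex a
    · rw [if_pos (h1.2 hz), if_pos hz]
    · rw [if_neg (mt h1.1 hz), if_neg hz]
      simp [h2]

theorem diff_eval : (diff P Q).eval = P.eval - Q.eval := by
  have h : ∀ σ : SignType, ((-σ : SignType) : ℝ) = -(σ : ℝ) := fun σ => by cases σ <;> simp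
  simp [eval, Fin.sum_univ_add, diff_value_left, diff_value_right, h, sub_eq_add_neg]

theorem diff_isProper (hP : P.IsProper) (hQ : Q.IsProper) : (diff P Q).IsProper := by
  obtain ⟨N, hN, hP⟩ := hP
  obtain ⟨M, hM, hQ⟩ := hQ
  refine ⟨N - M, by rw [diff_eval, hN, hM, Int.cast_sub], fun v => ?_⟩
  induction v using Fin.addCases with
  | left a => rw [diff_value_left]; exact hP a
  | right a => rw [diff_value_right]; exact hQ a

end Diff

end PowerCircuit

/-! ### Reading off the sign, and merging two circuits -/

namespace RAM

open Finset PowerCircuit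

/-- The downward search cannot run past vertex `0`, because a circuit has a marked vertex. The
marked vertex found is the one to which `sgn_eq_mark` applies. -/
theorem run_readOff {s : State} {m : ℕ} {Q : PowerCircuit (Fin m)} (hQ : Q.IsReduced)
    (hP : Q.IsProper) (hmono : ∀ i j, i < j → Q.value i < Q.value j)
    (hs : s.Contains Q (Equiv.refl _)) :
    Run readOff s fun s' t => s'.reg 1 = (Q.sgn : ℤ) ∧ t ≤ 4 * m + 10 := by
  obtain ⟨h0, -, h1, h2⟩ := hs
  simp only [readOff, run_seq, run_const, run_branch, Test.holds_eq, State.setReg_reg, reduceIte,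
    Nat.reduceEqDiff, h0, run_skip, run_copy]
  refine ⟨fun hm => ⟨?_, by omega⟩, fun hm => ?_⟩
  · obtain rfl : m = 1 := by exact_mod_cast hm
    rw [sgn, eval_eq_zero_of_one]
    simp
  have hm : m ≠ 1 := fun h => hm (by simp [h])
  refine Run.loop (fun N s' => ∃ i ≤ m, N = 4 * i ∧ s'.reg 2 = i ∧
      (∀ w : Fin m, i < w → Q.mark w = 0) ∧
      ((s'.reg 1 = 0 ∧ ∀ w : Fin m, i ≤ w → Q.mark w = 0) ∨
        ∃ v : Fin m, i = v ∧ Q.Marked v ∧ s'.reg 1 = (Q.mark v : ℤ))) (4 * m) ?_ ?_ ?_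
  · refine ⟨m, le_rfl, rfl, by simp, fun w hw => ?_, .inl ⟨by simp, fun w hw => ?_⟩⟩ <;>
      exact absurd w.2 (by omega)
  · rintro N s' fr ⟨i, him, rfl, hr2, htop, hI⟩ hb
    have f4 : s'.reg 4 = 0 := by rw [fr.1 4 rfl]; simp
    have f1 : s'.arr 1 = s.arr 1 := by rw [fr.2 1 rfl]; simp
    have f2 : s'.arr 2 = s.arr 2 := by rw [fr.2 2 rfl]; simp
    rw [Test.holds_eq, f4] at hb
    have hall : ∀ w : Fin m, i ≤ w → Q.mark w = 0 := by
      rcases hI with ⟨-, h⟩ | ⟨v, rfl, hv, hv'⟩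
      · exact h
      · rw [hb] at hv'
        exfalso
        have : Q.mark v ≠ 0 := hv
        generalize Q.mark v = σ at *
        revert this hv'
        cases σ <;> simp
    have hi : i ≠ 0 := by
      rintro rfl
      obtain ⟨v, hv⟩ := Q.exists_marked
      exact hv (hall v (by omega))
    obtain ⟨i, rfl⟩ : ∃ e, i = e + 1 := ⟨i - 1, by omega⟩
    have e1 : ((i + 1 : ℕ) : ℤ) - 1 = i := by simp
    have e2 : s.arr 2 (i : ℕ) 0 = i := h2 ⟨i, by omega⟩
    have e3 : s.arr 1 (i : ℕ) 0 = Q.mark ⟨i, by omega⟩ := h1 ⟨i, by omega⟩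
    simp only [run_seq, run_dec, run_load, State.setReg_reg, State.setReg_arr, reduceIte,
      Nat.reduceEqDiff, hr2, e1, f1, f2, f4, e2, e3]
    refine ⟨4 * i, ⟨i, by omega, rfl, rfl, fun w hw => hall w hw, ?_⟩, by omega⟩
    by_cases hmk : Q.mark ⟨i, by omega⟩ = 0
    · refine .inl ⟨by rw [hmk]; rfl, fun w hw => ?_⟩
      rcases hw.lt_or_eq with hw | hw
      · exact hall w hw
      · rw [← hmk]
        exact congrArg _ (Fin.ext hw.symm)
    · exact .inr ⟨⟨i, by omega⟩, rfl, hmk, rfl⟩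
  · rintro N s' t fr ⟨i, him, rfl, hr2, htop, hI⟩ hb ht
    have f4 : s'.reg 4 = 0 := by rw [fr.1 4 rfl]; simp
    rw [Test.holds_eq, f4] at hb
    rcases hI with ⟨h, -⟩ | ⟨v, rfl, hv, hv'⟩
    · exact absurd h hb
    · exact ⟨by rw [hv', sgn_eq_mark hQ hP hmono hm hv fun w hw => htop w hw], by omega⟩

theorem run_compare {s : State} {n : ℕ} {P : PowerCircuit (Fin n)} (hP : P.IsProper)
    (h0 : s.reg 0 = n) (hlab : ∀ i j : ℕ, s.arr 0 i j = labArr P i j)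
    (hmark : ∀ i : ℕ, s.arr 1 i 0 = markArr P i 0)
    (hzero : ∀ a, 4 ≤ a → s.arr a = fun _ _ => 0) :
    Run (compare reduce) s fun s' t => s'.reg 1 = (P.sgn : ℤ) ∧ t ≤ 60100 * (n + 1) ^ 3 := by
  rw [compare, run_seq]
  refine (run_reduce hP h0 hlab hmark hzero).conseq ?_
  rintro s1 t1 - ⟨⟨m, hm, Q, hQ, hQP, hQe, hmono, hs⟩, ht1⟩
  refine (run_readOff hQ hQP hmono hs).conseq ?_
  rintro s2 t2 - ⟨h1, ht2⟩
  refine ⟨by rw [h1, sgn, sgn, hQe], ?_⟩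
  have : n + 1 ≤ (n + 1) ^ 3 := Nat.le_self_pow (by norm_num) _
  omega

/-- Add the second circuit in memory, with negated marks, to the first one. -/
def merge : Prog :=
  .seq (.const 10 0) <| .seq (.copy 20 0) <| .seq (.const 64 0) <| .seq
    (forUp 64 1 <|
      .seq (.load 66 3 64 10) <| .seq (.const 67 0) <|
        .seq (.branch (.eq 66 10) .skip (.branch (.lt 66 10) (.inc 67) (.dec 67))) <|
          .seq (.store 1 20 10 67) <| .seq (.copy 21 0) <| .seq (.const 65 0) <|
            .seq (forUp 65 1 (.seq (.load 68 2 64 65) <| .seq (.store 0 20 21 68) (.inc 21)))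
              (.inc 20)) <|
    .copy 0 20

/-- The default `0` of `labArr P` outside its range also covers the pairs of vertices from different
components, so only the block of `Q` has to be written. -/
theorem labArr_diff {n m : ℕ} (P : PowerCircuit (Fin n)) (Q : PowerCircuit (Fin m)) (i j : ℕ) :
    labArr (diff P Q) i j = if n ≤ i ∧ i < n + m ∧ n ≤ j ∧ j < n + m
      then labArr Q (i - n : ℕ) (j - n : ℕ) else labArr P i j := by
  by_cases hij : i < n + m ∧ j < n + m
  · have h1 := labArr_coe (diff P Q) ⟨i, hij.1⟩ ⟨j, hij.2⟩
    dsimp only at h1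
    rw [h1]
    by_cases hi : i < n
    · rw [if_neg (by omega), show (⟨i, hij.1⟩ : Fin (n + m)) = Fin.castAdd m ⟨i, hi⟩ from rfl]
      by_cases hj : j < n
      · rw [show (⟨j, hij.2⟩ : Fin (n + m)) = Fin.castAdd m ⟨j, hj⟩ from rfl, diff_lab_left]
        exact (labArr_coe P ⟨i, hi⟩ ⟨j, hj⟩).symm
      · rw [show (⟨j, hij.2⟩ : Fin (n + m)) = Fin.natAdd n ⟨j - n, by omega⟩ from
          Fin.ext (by simp; omega), diff_lab_left_right, labArr, dif_neg (by omega)]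
        rfl
    · rw [show (⟨i, hij.1⟩ : Fin (n + m)) = Fin.natAdd n ⟨i - n, by omega⟩ from
          Fin.ext (by simp; omega)]
      by_cases hj : j < n
      · rw [if_neg (by omega), show (⟨j, hij.2⟩ : Fin (n + m)) = Fin.castAdd m ⟨j, hj⟩ from rfl,
          diff_lab_right_left, labArr, dif_neg (by omega)]
        rfl
      · rw [if_pos (by omega), show (⟨j, hij.2⟩ : Fin (n + m)) = Fin.natAdd n ⟨j - n, by omega⟩ from
          Fin.ext (by simp; omega), diff_lab_right]
        exact (labArr_coe Q ⟨i - n, by omega⟩ ⟨j - n, by omega⟩).symm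
  · rw [if_neg (by omega), labArr, labArr, dif_neg (by push_cast; omega), dif_neg (by omega)]

theorem markArr_diff {n m : ℕ} (P : PowerCircuit (Fin n)) (Q : PowerCircuit (Fin m)) (i : ℕ) :
    markArr (diff P Q) i 0 = if n ≤ i ∧ i < n + m then - markArr Q (i - n : ℕ) 0
      else markArr P i 0 := by
  by_cases hij : i < n + m
  · have h1 := markArr_coe (diff P Q) ⟨i, hij⟩
    dsimp only at h1
    rw [h1]
    by_cases hi : i < n
    · rw [if_neg (by omega), show (⟨i, hij⟩ : Fin (n + m)) = Fin.castAdd m ⟨i, hi⟩ from rfl,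
        diff_mark_left]
      exact (markArr_coe P ⟨i, hi⟩).symm
    · rw [if_pos (by omega), show (⟨i, hij⟩ : Fin (n + m)) = Fin.natAdd n ⟨i - n, by omega⟩ from
          Fin.ext (by simp; omega), diff_mark_right]
      have h2 := markArr_coe Q ⟨i - n, by omega⟩
      dsimp only at h2
      rw [h2]
      cases Q.mark ⟨i - n, by omega⟩ <;> rfl
  · rw [if_neg (by omega), markArr, markArr, dif_neg (by push_cast; omega), dif_neg (by omega)]

theorem run_merge {n m : ℕ} (P : PowerCircuit (Fin n)) (Q : PowerCircuit (Fin m)) :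
    Run merge (inputPair P Q) fun s' t => s'.reg 0 = (n + m : ℕ) ∧
      (∀ i j : ℕ, s'.arr 0 i j = labArr (diff P Q) i j) ∧
      (∀ i : ℕ, s'.arr 1 i 0 = markArr (diff P Q) i 0) ∧ t ≤ 30 * (m + 1) ^ 2 := by
  set s := inputPair P Q with hs
  have r0 : s.reg 0 = n := rfl
  have r1 : s.reg 1 = m := rfl
  have a0 : s.arr 0 = labArr P := rfl
  have a1 : s.arr 1 = markArr P := rfl
  have a2 : s.arr 2 = labArr Q := rfl
  have a3 : s.arr 3 = markArr Q := rfl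
  clear_value s
  simp only [merge, run_seq, run_const, run_copy, State.setReg_reg, reduceIte, Nat.reduceEqDiff, r0]
  refine Run.forUp (fun r s' => s'.reg 20 = (n + r : ℕ) ∧
      (∀ i j : ℕ, s'.arr 0 i j = if n ≤ i ∧ i < n + r ∧ n ≤ j ∧ j < n + m
        then labArr Q (i - n : ℕ) (j - n : ℕ) else labArr P i j) ∧
      ∀ i : ℕ, s'.arr 1 i 0 = if n ≤ i ∧ i < n + r then - markArr Q (i - n : ℕ) 0
        else markArr P i 0)
    0 m (m * 5 + 12) (by simp) (by simp [r1]) (by omega) rfl rfl rfl ?_ ?_ ?_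
  · refine ⟨by simp, fun i j => ?_, fun i => ?_⟩
    · rw [if_neg (by omega)]; simp [a0]
    · rw [if_neg (by omega)]; simp [a1]
  · rintro r s' fr - hr h64 g1 ⟨h20, hI0, hI1⟩
    have f10 : s'.reg 10 = 0 := by rw [fr.1 10 rfl]; simp
    have f0 : s'.reg 0 = n := by rw [fr.1 0 rfl]; simp [r0]
    have f2 : s'.arr 2 = labArr Q := by rw [fr.2 2 rfl]; simp [a2]
    have f3 : s'.arr 3 = markArr Q := by rw [fr.2 3 rfl]; simp [a3]
    have hmk : (markArr Q r 0).natAbs ≤ 1 := by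
      rw [markArr]
      split_ifs
      · exact natAbs_signType_le _
      · simp
    simp only [run_seq, run_load, run_const, h64, f10, f3]
    -- Marks lie in `{-1, 0, 1}`, so negation is a case distinction with one increment or decrement
    -- of `0`.
    have hneg : ∀ s2 : State, s2.reg 66 = markArr Q r 0 → s2.reg 10 = 0 → s2.reg 67 = 0 →
        Run (.branch (.eq 66 10) .skip (.branch (.lt 66 10) (.inc 67) (.dec 67))) s2
          fun s3 t => s3 = s2.setReg 67 (- markArr Q r 0) ∧ t ≤ 3 := by
      intro s2 e1 e2 e3
      have hself : ∀ c : ℤ, c = 0 → s2 = s2.setReg 67 c := fun c hc => by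
        rw [hc, ← e3]
        simp [State.setReg]
      simp only [run_branch, Test.holds_eq, Test.holds_lt, run_skip, run_inc, run_dec, e1, e2, e3]
      refine ⟨fun h => ⟨hself _ (by omega), by omega⟩, fun h => ⟨fun h' => ⟨?_, by omega⟩,
        fun h' => ⟨?_, by omega⟩⟩⟩
      · congr 1; omega
      · congr 1; omega
    refine (hneg _ (by simp) (by simp [f10]) (by simp)).conseq ?_
    rintro s3 t3 - ⟨rfl, ht3⟩
    simp only [run_store, run_copy, State.setReg_reg, State.setArr_reg, reduceIte,
      Nat.reduceEqDiff, h20, f10, f0]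
    refine Run.forUp (fun c s2 => s2.reg 21 = (n + c : ℕ) ∧
        ∀ i j : ℕ, s2.arr 0 i j = if i = n + r ∧ n ≤ j ∧ j < n + c
          then labArr Q r (j - n : ℕ) else s'.arr 0 i j)
      0 m 3 (by simp) (by simp [g1]) (by omega) rfl rfl rfl ?_ ?_ ?_
    · refine ⟨by simp, fun i j => ?_⟩
      rw [if_neg (by omega)]
      simp
    · rintro c s2 fr2 - hc h65 - ⟨h21, hI⟩
      have k20 : s2.reg 20 = (n + r : ℕ) := by rw [fr2.1 20 rfl]; simp [h20]
      have k64 : s2.reg 64 = r := by rw [fr2.1 64 rfl]; simp [h64]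
      have k2 : s2.arr 2 = labArr Q := by rw [fr2.2 2 rfl]; simp [f2]
      simp only [run_seq, run_load, run_store, run_inc, State.setReg_reg, State.setArr_reg,
        reduceIte, Nat.reduceEqDiff, h21, k20, k64, k2, h65, State.setReg_arr]
      refine ⟨⟨by push_cast; ring, fun i j => ?_⟩, by omega⟩
      rw [State.setArr_arr, State.setReg_arr, hI]
      by_cases h1 : i = n + r ∧ j = n + c
      · obtain ⟨rfl, rfl⟩ := h1
        rw [if_pos ⟨rfl, rfl⟩, if_pos (by omega), Nat.add_sub_cancel_left]
      · rw [if_neg (by exact_mod_cast h1)]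
        by_cases h2 : i = n + r ∧ n ≤ j ∧ j < n + c
        · rw [if_pos h2, if_pos (by omega)]
        · rw [if_neg h2, if_neg (by omega)]
    · rintro s2 t fr2 - ⟨-, hI⟩ ht
      have k20 : s2.reg 20 = (n + r : ℕ) := by rw [fr2.1 20 rfl]; simp [h20]
      have k1 := fr2.2 1 rfl
      rw [run_inc]
      refine ⟨⟨by simp [k20]; ring, fun i j => ?_, fun i => ?_⟩, by omega⟩
      · rw [State.setReg_arr, State.setReg_arr, hI, hI0]
        by_cases h1 : i = n + r ∧ n ≤ j ∧ j < n + m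
        · rw [if_pos h1, if_pos (by omega), h1.1, Nat.add_sub_cancel_left]
        · rw [if_neg h1]
          by_cases h2 : n ≤ i ∧ i < n + r ∧ n ≤ j ∧ j < n + m
          · rw [if_pos h2, if_pos (by omega)]
          · rw [if_neg h2, if_neg (by omega)]
      · rw [State.setReg_arr, State.setReg_arr, k1, State.setReg_arr, State.setReg_arr,
          State.setArr_arr, State.setReg_arr, State.setReg_arr, State.setReg_arr, hI1]
        by_cases h1 : i = n + r
        · subst h1
          rw [if_pos ⟨rfl, rfl⟩, if_pos (by omega), Nat.add_sub_cancel_left]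
        · rw [if_neg (by simpa using by omega)]
          by_cases h2 : n ≤ i ∧ i < n + r
          · rw [if_pos h2, if_pos (by omega)]
          · rw [if_neg h2, if_neg (by omega)]
  · rintro s' t fr - ⟨h20, hI0, hI1⟩ ht
    refine ⟨h20, fun i j => ?_, fun i => ?_, ?_⟩
    · rw [State.setReg_arr, hI0, labArr_diff]
    · rw [State.setReg_arr, hI1, markArr_diff]
    · rw [Nat.sub_zero] at ht
      clear * - ht
      nlinarith

theorem one_le_of_circuit {n : ℕ} (P : PowerCircuit (Fin n)) : 1 ≤ n := by
  obtain ⟨v, -⟩ := P.exists_marked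
  exact Nat.one_le_iff_ne_zero.2 v.pos.ne'

/-- Circuits have at least one vertex, which allows bounds in `n + 1` to be turned into bounds in
`n` with a factor `8`. -/
theorem succ_cube_le {n : ℕ} (hn : 1 ≤ n) : (n + 1) ^ 3 ≤ 8 * n ^ 3 :=
  (Nat.pow_le_pow_left (by omega : n + 1 ≤ 2 * n) 3).trans (by rw [mul_pow]; norm_num)

end RAM

/-- There is a reduction program that turns every proper constant power circuit into an equivalent
reduced one, with its vertices listed by increasing value, in cubic time in the number of vertices;
the algorithm `compare` based on it computes the sign of the value in cubic time; and the values of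
two circuits can be compared in cubic time. -/
theorem mainTheorem9 :
    ∃ reduce : RAM.Prog,
      (∃ C : ℕ, ∀ (n : ℕ) (P : PowerCircuit (Fin n)), P.IsProper →
        ∃ (s : RAM.State) (t : ℕ), RAM.Exec reduce (RAM.input P) s t ∧ t ≤ C * n ^ 3 ∧
          s.ContainsReduct P) ∧
      (∃ C : ℕ, ∀ (n : ℕ) (P : PowerCircuit (Fin n)), P.IsProper →
        ∃ (s : RAM.State) (t : ℕ), RAM.Exec (RAM.compare reduce) (RAM.input P) s t ∧
          t ≤ C * n ^ 3 ∧ s.reg 1 = (P.sgn : ℤ)) ∧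
      ∃ (compareTwo : RAM.Prog) (C : ℕ),
        ∀ (n m : ℕ) (P : PowerCircuit (Fin n)) (Q : PowerCircuit (Fin m)),
          P.IsProper → Q.IsProper →
          ∃ (s : RAM.State) (t : ℕ), RAM.Exec compareTwo (RAM.inputPair P Q) s t ∧
            t ≤ C * (n + m) ^ 3 ∧ s.reg 1 = (SignType.sign (P.eval - Q.eval) : ℤ) := by
  have hinput : ∀ (n : ℕ) (P : PowerCircuit (Fin n)) (a : ℕ), 4 ≤ a →
      (RAM.input P).arr a = fun _ _ => 0 := fun n P a ha => by
    simp [RAM.input, show a ≠ 0 by omega, show a ≠ 1 by omega]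
  -- The constants are `8 * 60000`, `8 * 60100` and `8 * (60100 + 30)`, the `30` coming from the
  -- merging.
  refine ⟨RAM.reduce, ⟨480000, fun n P hP => ?_⟩, ⟨480800, fun n P hP => ?_⟩,
    .seq RAM.merge (RAM.compare RAM.reduce), 481040, fun n m P Q hP hQ => ?_⟩
  · obtain ⟨s, t, he, ⟨m, -, Q, h1, h2, h3, h4, h5⟩, ht⟩ := RAM.run_reduce (s := RAM.input P) hP rfl
      (fun _ _ => rfl) (fun _ => rfl) (hinput n P)
    refine ⟨s, t, he, ?_, m, Q, Equiv.refl _, h1, h2, h3, h4, h5⟩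
    have := RAM.succ_cube_le (RAM.one_le_of_circuit P)
    omega
  · obtain ⟨s, t, he, h1, ht⟩ := RAM.run_compare (s := RAM.input P) hP rfl
      (fun _ _ => rfl) (fun _ => rfl) (hinput n P)
    refine ⟨s, t, he, ?_, h1⟩
    have := RAM.succ_cube_le (RAM.one_le_of_circuit P)
    omega
  · have hrun : RAM.Run (.seq RAM.merge (RAM.compare RAM.reduce)) (RAM.inputPair P Q) fun s t =>
        s.reg 1 = ((P.diff Q).sgn : ℤ) ∧ t ≤ 60100 * (n + m + 1) ^ 3 + 30 * (m + 1) ^ 2 := by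
      rw [RAM.run_seq]
      refine (RAM.run_merge P Q).conseq ?_
      rintro s1 t1 fr1 ⟨h0, hlab, hmark, ht1⟩
      refine (RAM.run_compare (PowerCircuit.diff_isProper P Q hP hQ) h0 hlab hmark
        fun a ha => ?_).conseq ?_
      · have h : RAM.merge.modArr a = false := by
          simp [RAM.merge, RAM.forUp, RAM.Prog.modArr]
          omega
        rw [fr1.2 a h]
        simp [RAM.inputPair, show a ≠ 0 by omega, show a ≠ 1 by omega, show a ≠ 2 by omega,
          show a ≠ 3 by omega]
      · rintro s2 t2 - ⟨h1, ht2⟩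
        exact ⟨h1, by omega⟩
    obtain ⟨s, t, he, h1, ht⟩ := hrun
    refine ⟨s, t, he, ?_, by rw [h1, PowerCircuit.sgn, PowerCircuit.diff_eval]⟩
    have e1 := RAM.succ_cube_le (n := n + m) (by have := RAM.one_le_of_circuit P; omega)
    have e2 : (m + 1) ^ 2 ≤ (n + m + 1) ^ 3 :=
      (Nat.pow_le_pow_left (by omega) 2).trans (Nat.pow_le_pow_right (by omega) (by omega))
    omega
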